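/- Let $n\ge 1$, let $N,m,p,k\ge 0$ be integers, and consider the system $$u^\sigma_t+g^\sigma(t,x,u,\partial_x u,\dots,\partial_x^m u)=0,\qquad \sigma=1,\dots,N,$$ for $u=(u^1,\dots,u^N)$ as functions of $t$ and $x=(x^1,\dots,x^n)$. Repeated indices are summed; $\partial/\partial u^\sigma_{i_1\cdots i_r}$ is the symmetric partial derivative (the derivative in the coordinate $u^\sigma_J$ divided by the number $r!/J!$ of ordered tuples representing the multi-index $J$). Let $D_i$ be the total $x^i$-derivative and $\mathcal D_t=\partial_t-\sum_J (D_Jg^\rho)\,\partial/\partial u^\rho_J$ the total $t$-derivative on the solution space (i.e. after eliminating $u_t$ and its differential consequences). *Domain.* Let $\tilde u^\sigma(t,x)$ be given functions and put $u_{(\lambda)}=\lambda u+(1-\lambda)\tilde u$. All expressions are smooth functions of $t,x,u$ and finitely many $x$-derivatives of $u$ on an open set $\Omega$ of $x$-jets (for instance the whole jet space) such that, with $B$ the projection of $\Omega$ to $(t,x)$-space, $\tilde u$ is smooth on $B$; $(rt,sx)\in B$ whenever $(t,x)\in B$ and $r,s\in[0,1]$; and the jet of $u_{(\lambda)}$ lies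 in $\Omega$ whenever that of $u$ does and $\lambda\in[0,1]$. *Conservation laws.* A conservation law in normal form is a tuple of such expressions $\Phi^t,\Phi^i$ with $\mathcal D_t\Phi^t+D_i\Phi^i=0$ identically on $\Omega$. Two such tuples agree to within trivial conserved densities if $$\Phi'^t=\Phi^t+D_i\theta^i,\qquad \Phi'^i=\Phi^i-\mathcal D_t\theta^i+D_j\psi^{ij},\qquad \psi^{ij}=-\psi^{ji},$$ for some such expressions $\theta^i,\psi^{ij}$. The multipliers of a conservation law with density $\Phi^t$ of order at most $k$ are $$\Lambda_\sigma=\frac{\partial\Phi^t}{\partial u^\sigma}-D_i\frac{\partial\Phi^t}{\partial u^\sigma_i}+\dots+(-1)^kD_{i_1}\cdots D_{i_k}\frac{\partial\Phi^t}{\partial u^\sigma_{i_1\cdots i_k}} .$$ *Notation.* For $F=g$, $q=m$ or $F=\Lambda$, $q=p$ put $$S^i[V,W;F[u_{(\lambda)}]]=\sum_{\ell=0}^{q-1}\sum_{r=0}^{q-\ell-1}(-1)^r\,(D_{i_1}\cdots D_{i_\ell}V^\rho)\,D_{j_1}\cdots D_{j_r}\Big(W_\sigma\,\frac{\partial F_\sigma}{\partial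 u^\rho_{i\,i_1\cdots i_\ell\, j_1\cdots j_r}}[u_{(\lambda)}]\Big)$$ (with $F_\sigma=g^\sigma$ for $F=g$), and let $$K(t,x)=(\tilde u^\rho_t+g^\rho[\tilde u])\,\Lambda_\rho[\tilde u].$$ **Theorem.** Let $\Phi^t,\Phi^i$ (of order at most $k$) be a conservation law in normal form, in particular any nontrivial one, and suppose that its multipliers $\Lambda_\sigma$ have order at most $p$. Then the integrals in $$\hat\Phi^t=\int_0^1(u^\sigma-\tilde u^\sigma)\,\Lambda_\sigma[u_{(\lambda)}]\,d\lambda+t\int_0^1\lambda^nK(\lambda t,\lambda x)\,d\lambda,$$ $$\hat\Phi^i=x^i\int_0^1\lambda^nK(\lambda t,\lambda x)\,d\lambda+\int_0^1\Big(S^i\big[u-\tilde u,\Lambda[u_{(\lambda)}];g[u_{(\lambda)}]\big]+S^i\big[u-\tilde u,\,g[u_{(\lambda)}]-\lambda g[u]+(1-\lambda)\tilde u_t;\,\Lambda[u_{(\lambda)}]\big]\Big)d\lambda$$ converge on $\Omega$; $\hat\Phi^t,\hat\Phi^i$ is a conservation law in normal form; and it agrees with $\Phi^t,\Phi^i$ to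 within trivial conserved densities. -/

import Mathlib

open scoped ContDiff

namespace ConsLaw

noncomputable section

/-- Multi-indices `J` of derivatives with respect to `x = (x¹, …, xⁿ)`. -/
abbrev MultiIndex (n : ℕ) := Fin n → ℕ

/-- The space of independent variables `(t, x)`. -/
abbrev Base (n : ℕ) := ℝ × (Fin n → ℝ)

/-- The space of all `x`-jets: a point `z` has `z.1 = (t, x)` and `z.2 σ J = u^σ_J`, the value of the
derivative `∂_x^J u^σ`. There are no `t`-derivatives of `u` among the coordinates (normal form).
The topology is the product topology. -/
abbrev Jet (n N : ℕ) := Base n × (Fin N → MultiIndex n → ℝ)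

/-- The multi-indices of order at most `k`. -/
def multiIndicesLE (n k : ℕ) : Finset (MultiIndex n) :=
  (Fintype.piFinset fun _ => Finset.range (k + 1)).filter fun J => ∑ i, J i ≤ k

/-- The finite-dimensional space of `x`-jets of order at most `k`. -/
abbrev JetLE (n N k : ℕ) := Base n × (Fin N → multiIndicesLE n k → ℝ)

variable {n N : ℕ}

/-- Forget all derivatives of order larger than `k`. -/
def trunc (k : ℕ) (z : Jet n N) : JetLE n N k := (z.1, fun σ J => z.2 σ J)

/-- `F` is a smooth expression `F(t, x, u, ∂ₓu, …, ∂ₓᵏu)` on the set `Ω` of jets.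
(If `Ω` is open then so is its image under `trunc k`.) -/
def IsDiffFun (Ω : Set (Jet n N)) (k : ℕ) (F : Jet n N → ℝ) : Prop :=
  ∃ f : JetLE n N k → ℝ, ContDiffOn ℝ ∞ f (trunc k '' Ω) ∧ ∀ z ∈ Ω, F z = f (trunc k z)

/-- The partial derivative with respect to the jet coordinate `u^σ_J`. -/
def coordDeriv (σ : Fin N) (J : MultiIndex n) (F : Jet n N → ℝ) (z : Jet n N) : ℝ :=
  lineDeriv ℝ F z (0, Pi.single σ (Pi.single J 1))

/-- The total derivative `D_i = ∂_{x^i} + ∑ u^σ_{J + e_i} ∂_{u^σ_J}`, as the derivative along that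
vector field. -/
def D (i : Fin n) (F : Jet n N → ℝ) (z : Jet n N) : ℝ :=
  lineDeriv ℝ F z ((0, Pi.single i 1), fun σ J => z.2 σ (J + Pi.single i 1))

/-- `D_{i₁} ⋯ D_{i_r}` for a list of indices. -/
def DList (L : List (Fin n)) (F : Jet n N → ℝ) : Jet n N → ℝ := L.foldr D F

/-- `D_J = D_1^{J 1} ⋯ D_n^{J n}` for a multi-index. -/
def DMulti (J : MultiIndex n) (F : Jet n N → ℝ) : Jet n N → ℝ :=
  (List.finRange n).foldr (fun i G => (D i)^[J i] G) F

/-- The total `t`-derivative on the solution space of `u^σ_t + g^σ = 0`, obtained by eliminating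
`u_t` and its differential consequences: `∂_t - ∑ (D_J g^ρ) ∂_{u^ρ_J}`. -/
def DtSol (g : Fin N → Jet n N → ℝ) (F : Jet n N → ℝ) (z : Jet n N) : ℝ :=
  lineDeriv ℝ F z ((1, 0), fun ρ J => -DMulti J (g ρ) z)

/-- The multi-index of a list of indices. -/
def listIndex (L : List (Fin n)) : MultiIndex n := fun a => L.count a

/-- The symmetric partial derivative `∂F/∂u^σ_{i₁⋯i_r}`, normalised for the summation convention:
the derivative in the coordinate `u^σ_J` is divided equally among the `r!/J!` ordered index tuples
that represent `J`, so that `∑_{i₁,…,i_r} (∂F/∂u^σ_{i₁⋯i_r}) V_{i₁⋯i_r} = ∑_J (∂F/∂u^σ_J) V_J`. -/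
def symDeriv (σ : Fin N) (L : List (Fin n)) (F : Jet n N → ℝ) (z : Jet n N) : ℝ :=
  (Nat.multinomial Finset.univ (listIndex L) : ℝ)⁻¹ * coordDeriv σ (listIndex L) F z

/-- The restricted Euler operator
`∂_{u^σ} - D_i ∂_{u^σ_i} + D_i D_j ∂_{u^σ_{ij}} - ⋯` on expressions of order at most `k`. -/
def eulerHat (k : ℕ) (σ : Fin N) (F : Jet n N → ℝ) (z : Jet n N) : ℝ :=
  ∑ r ∈ Finset.range (k + 1), (-1 : ℝ) ^ r *
    ∑ I : Fin r → Fin n, DList (List.ofFn I) (symDeriv σ (List.ofFn I) F) z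

/-- A conservation law in normal form, of order at most `k`, of the system `u^σ_t + g^σ = 0`:
smooth densities `Φt`, `Φx i` whose divergence `D_t Φt + D_i Φx i` vanishes on the solution space. -/
def IsNormalConservationLaw (Ω : Set (Jet n N)) (g : Fin N → Jet n N → ℝ) (k : ℕ)
    (Φt : Jet n N → ℝ) (Φx : Fin n → Jet n N → ℝ) : Prop :=
  IsDiffFun Ω k Φt ∧ (∀ i, IsDiffFun Ω k (Φx i)) ∧
    ∀ z ∈ Ω, DtSol g Φt z + ∑ i, D i (Φx i) z = 0

/-- Two pairs of densities in normal form agree to within trivial conserved densities: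
`Φt' = Φt + D_i θ^i` and `Φx' i = Φx i - D_t θ^i + D_j ψ^{ij}` with `ψ^{ij} = -ψ^{ji}`, where `D_t`
is taken on the solution space. -/
def AgreeUpToTrivial (Ω : Set (Jet n N)) (g : Fin N → Jet n N → ℝ)
    (Φt : Jet n N → ℝ) (Φx : Fin n → Jet n N → ℝ)
    (Φt' : Jet n N → ℝ) (Φx' : Fin n → Jet n N → ℝ) : Prop :=
  ∃ (r : ℕ) (θ : Fin n → Jet n N → ℝ) (ψ : Fin n → Fin n → Jet n N → ℝ),
    (∀ i, IsDiffFun Ω r (θ i)) ∧ (∀ i j, IsDiffFun Ω r (ψ i j)) ∧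
    (∀ i j, ∀ z ∈ Ω, ψ i j z = -ψ j i z) ∧
    (∀ z ∈ Ω, Φt' z = Φt z + ∑ i, D i (θ i) z) ∧
    ∀ i, ∀ z ∈ Ω, Φx' i z = Φx i z - DtSol g (θ i) z + ∑ j, D j (ψ i j) z

/-- The trilinear expression
`∑_{ℓ<m} ∑_{k<m-ℓ} (-1)^k (D_{i₁}⋯D_{i_ℓ} V^ρ) D_{j₁}⋯D_{j_k}(W_σ C^σ_ρ^{i i₁⋯i_ℓ j₁⋯j_k})`,
summed over all repeated indices, where the coefficients `C` are given. -/
def trilinear (m : ℕ) (i : Fin n) (V W : Fin N → Jet n N → ℝ)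
    (C : Fin N → Fin N → List (Fin n) → Jet n N → ℝ) (z : Jet n N) : ℝ :=
  ∑ l ∈ Finset.range m, ∑ k ∈ Finset.range (m - l), (-1 : ℝ) ^ k *
    ∑ I : Fin l → Fin n, ∑ J : Fin k → Fin n, ∑ ρ, ∑ σ,
      DList (List.ofFn I) (V ρ) z *
        DList (List.ofFn J)
          (fun y => W σ y * C σ ρ (i :: (List.ofFn I ++ List.ofFn J)) y) z

/-- The partial derivative `∂_x^J f` of a function of `(t, x)`. -/
def partialMulti (J : MultiIndex n) (f : Base n → ℝ) : Base n → ℝ :=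
  (List.finRange n).foldr
    (fun i G => (fun (h : Base n → ℝ) q => lineDeriv ℝ h q (0, Pi.single i 1))^[J i] G) f

/-- The `t`-derivative of a function of `(t, x)`. -/
def partialT (f : Base n → ℝ) (b : Base n) : ℝ := lineDeriv ℝ f b (1, 0)

/-- The `x`-jet at `(t, x)` of functions `w^σ(t, x)`. -/
def jetOf (w : Fin N → Base n → ℝ) (b : Base n) : Jet n N :=
  (b, fun σ J => partialMulti J (w σ) b)

/-- The jet of `u_(s) = s u + (1 - s) w`, as a function of the jet `z` of `u`. -/
def homotopy (w : Fin N → Base n → ℝ) (s : ℝ) (z : Jet n N) : Jet n N :=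
  (z.1, fun σ J => s * z.2 σ J + (1 - s) * (jetOf w z.1).2 σ J)

/-- The bilinear coefficients `(∂F_σ/∂u^ρ_{i₁⋯i_r})[u_(s)]`. -/
def coeffAt (w : Fin N → Base n → ℝ) (s : ℝ) (F : Fin N → Jet n N → ℝ)
    (σ ρ : Fin N) (L : List (Fin n)) (z : Jet n N) : ℝ :=
  symDeriv ρ L (F σ) (homotopy w s z)

/-- `K(t, x) = ((u_(s)^ρ_t + g^ρ[u_(s)]) Λ_ρ[u_(s)])` at `s = 0`, where `u_(0) = w`. -/
def kernelK (g Λ : Fin N → Jet n N → ℝ) (w : Fin N → Base n → ℝ) (b : Base n) : ℝ :=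
  ∑ ρ, (partialT (w ρ) b + g ρ (jetOf w b)) * Λ ρ (jetOf w b)

/-- The integrand `(u^σ - w^σ) Λ_σ[u_(s)]`. -/
def integrandT (Λ : Fin N → Jet n N → ℝ) (w : Fin N → Base n → ℝ) (s : ℝ) (z : Jet n N) : ℝ :=
  ∑ σ, (z.2 σ 0 - w σ z.1) * Λ σ (homotopy w s z)

/-- The integrand
`S^i[u - w, Λ[u_(s)]; g[u_(s)]] + S^i[u - w, g[u_(s)] - s g[u] + (1 - s) w_t; Λ[u_(s)]]`. -/
def integrandX (m p : ℕ) (g Λ : Fin N → Jet n N → ℝ) (w : Fin N → Base n → ℝ) (i : Fin n)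
    (s : ℝ) (z : Jet n N) : ℝ :=
  trilinear m i (fun ρ y => y.2 ρ 0 - w ρ y.1) (fun σ y => Λ σ (homotopy w s y))
      (coeffAt w s g) z +
    trilinear p i (fun ρ y => y.2 ρ 0 - w ρ y.1)
      (fun σ y => g σ (homotopy w s y) - s * g σ y + (1 - s) * partialT (w σ) y.1)
      (coeffAt w s Λ) z

/-- The density `Φ^t` given by the construction formula. -/
def formulaT (g Λ : Fin N → Jet n N → ℝ) (w : Fin N → Base n → ℝ) (z : Jet n N) : ℝ :=
  (∫ s in (0 : ℝ)..1, integrandT Λ w s z) +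
    z.1.1 * ∫ s in (0 : ℝ)..1, s ^ n * kernelK g Λ w (s • z.1)

/-- The densities `Φ^i` given by the construction formula. -/
def formulaX (m p : ℕ) (g Λ : Fin N → Jet n N → ℝ) (w : Fin N → Base n → ℝ) (i : Fin n)
    (z : Jet n N) : ℝ :=
  z.1.2 i * (∫ s in (0 : ℝ)..1, s ^ n * kernelK g Λ w (s • z.1)) +
    ∫ s in (0 : ℝ)..1, integrandX m p g Λ w i s z

/-- The set `Ω` of jets on which the expressions are nonsingular is open, the functions `w^σ` are
smooth over its projection to `(t, x)`-space, `Ω` contains the jet of `u_(s)`, `0 ≤ s ≤ 1`, whenever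
it contains the jet of `u`, and its projection is star-shaped about the origin in `t` and in `x`.
The whole jet space is such a set, with any smooth `w`. -/
structure IsAdmissible (Ω : Set (Jet n N)) (w : Fin N → Base n → ℝ) : Prop where
  isOpen : IsOpen Ω
  smooth : ∀ σ, ContDiffOn ℝ ∞ (w σ) (Prod.fst '' Ω)
  homotopy_mem : ∀ z ∈ Ω, ∀ s ∈ Set.Icc (0 : ℝ) 1, homotopy w s z ∈ Ω
  scale_mem : ∀ b ∈ Prod.fst '' Ω, ∀ r ∈ Set.Icc (0 : ℝ) 1, ∀ s ∈ Set.Icc (0 : ℝ) 1,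
    (r * b.1, s • b.2) ∈ Prod.fst '' Ω

end

end ConsLaw

/-! Write w for ũ, V = u - w, and let Q = ∂_t u_(s) + g[u_(s)], with u_t eliminated, be the residual
of the system along the homotopy u_(s) = s u + (1-s) w. The proof integrates in s from w to u, and
then treats what remains at s = 0 by scaling (t, x).

Density. Integration by parts, in the form of Green's formula `sum_derivation_greenCurrent`, gives
∂_s Φ^t[u_(s)] = V·Λ[u_(s)] + D_i A^i(V), where A^i is Green's current with coefficients taken from
Φ^t (`paramS_density`). Hence Φ^t[u] - Φ^t[w] is ∫ V·Λ[u_(s)] ds up to a total divergence.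

Flux. Since u_(s) need not be a solution, 𝒟_t(Φ^t[u_(s)]) differs from (𝒟_tΦ^t)[u_(s)] by the
linearisation of Φ^t in the direction Q, and the flux Φ^i[u_(s)] has to be corrected by -A^i(Q).
Consider ∂_s(Φ^i[u_(s)] - A^i(Q)) + 𝒟_t A^i(V) minus the two expressions S^i of the formula. As ∂_s
Q is 𝒟_t V plus the linearisation of g in the direction V (`paramS_residual`), the terms in 𝒟_t V
cancel, and what is left is a linear operator in V that involves x-derivatives only. The linearised
conservation law shows that its divergence is of order zero in V (`exists_flux_potential`).

The point of the argument is to let V be arbitrary in this operator. If an operator is written as ∑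
D_J(a_J v), with its coefficients inside the derivatives, then D_i acts on symbols as multiplication
by X_i. So the symbols P^i satisfy ∑ X_i P^i = constant; the constant is zero, and exactness of the
Koszul complex of the variables gives P^i = ∑ X_j B^{ij} with B antisymmetric. This is
`exists_antisymm_potential`, and it makes the difference of the fluxes a curl
(`exists_paramS_flux_potential`).

Endpoints. At s = 1 the residual Q is zero and the flux is Φ^i[u]. At s = 0 the density Φ^t[w] and
the flux Φ^i[w] - A^i(Q) are functions of (t, x) alone with divergence K
(`sum_baseD_backgroundFlux`). The radial Poincaré homotopy writes them as (t, x) times ∫ λⁿ K(λt,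
λx) dλ plus the divergence of an antisymmetric array Ψ (`exists_base_potential`). The entries of Ψ
with a t-index contribute to θ and the others to ψ. Collecting the terms gives
`exists_trivial_densities`, and conservation of the constructed densities follows from it.

All identities are proved in the algebra `Tame` of smooth functions of finitely many coordinates on
an open set, where the D_i, 𝒟_t and ∂_s are derivations and D_i commutes with the others. The
relation `Represents` carries them back to the pointwise definitions. -/

namespace ConsLaw

/-! ### Iterates of commuting derivations. -/

section IteratedDerivations

variable {n : ℕ} {S : Type*} [CommRing S] [Algebra ℝ S]

/-- The composite `D_1^{J 1} ⋯ D_n^{J n}`. -/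
noncomputable def iterD (D : Fin n → Derivation ℝ S S) (J : MultiIndex n) : Module.End ℝ S :=
  ((List.finRange n).map fun i => ((D i : S →ₗ[ℝ] S) : Module.End ℝ S) ^ J i).prod

/-- Without repetitions in the list, raising the exponent at `i` inserts one factor `f i`, and this
commutes to the front. -/
theorem list_prod_pow_add_single {M : Type*} [Monoid M] {ι : Type*} [DecidableEq ι] (f : ι → M)
    (hf : ∀ i j, f i * f j = f j * f i) (J : ι → ℕ) (i : ι) (l : List ι) (hl : l.Nodup) :
    (l.map fun j => f j ^ (J + Pi.single i 1 : ι → ℕ) j).prod =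
      if i ∈ l then f i * (l.map fun j => f j ^ J j).prod else (l.map fun j => f j ^ J j).prod := by
  induction l with
  | nil => simp
  | cons a l ih =>
    have hl' := List.nodup_cons.1 hl
    simp only [List.map_cons, List.prod_cons, ih hl'.2]
    by_cases h : i = a
    · subst h
      simp only [hl'.1, if_false, Pi.add_apply, Pi.single_eq_same, List.mem_cons, true_or, if_true,
        pow_succ', mul_assoc]
    · have h1 : (J + Pi.single i 1 : ι → ℕ) a = J a := by
        simp [Pi.single_eq_of_ne (Ne.symm h)]
      rw [h1]
      by_cases hi : i ∈ l
      · have : Commute (f a ^ J a) (f i) := (Commute.pow_left (hf a i) _)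
        simp only [hi, if_true, List.mem_cons, or_true]
        rw [← mul_assoc, this.eq, mul_assoc]
      · simp [hi, h]

variable (D : Fin n → Derivation ℝ S S)

theorem iterD_zero : iterD D 0 = 1 := by
  simp [iterD]

variable (hD : ∀ i j f, D i (D j f) = D j (D i f))

include hD in
theorem iterD_add_single (J : MultiIndex n) (i : Fin n) (f : S) :
    iterD D (J + Pi.single i 1) f = D i (iterD D J f) := by
  have := list_prod_pow_add_single (fun i => ((D i : S →ₗ[ℝ] S) : Module.End ℝ S))
    (fun i j => by ext f; exact hD i j f) J i _ (List.nodup_finRange n)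
  simp only [List.mem_finRange, if_true] at this
  unfold iterD
  rw [this]
  rfl

/-- The iterated derivative `D_{i₁} ⋯ D_{i_r}` along a list. -/
def listD (L : List (Fin n)) (f : S) : S := L.foldr (fun i g => D i g) f

@[simp] theorem listD_nil (f : S) : listD D [] f = f := rfl

@[simp] theorem listD_cons (i : Fin n) (L : List (Fin n)) (f : S) :
    listD D (i :: L) f = D i (listD D L f) := rfl

theorem listIndex_cons (i : Fin n) (L : List (Fin n)) :
    listIndex (i :: L) = listIndex L + Pi.single i 1 := by
  ext a
  simp only [listIndex, Pi.add_apply, List.count_cons, Pi.single_apply, beq_iff_eq]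
  congr 1
  simp [eq_comm]

include hD in
theorem listD_eq_iterD (L : List (Fin n)) (f : S) : listD D L f = iterD D (listIndex L) f := by
  induction L with
  | nil =>
    have : listIndex ([] : List (Fin n)) = 0 := by ext a; simp [listIndex]
    rw [this, iterD_zero]; rfl
  | cons i L ih => rw [listD_cons, ih, listIndex_cons, iterD_add_single D hD]

theorem listD_add (L : List (Fin n)) (f g : S) : listD D L (f + g) = listD D L f + listD D L g := by
  induction L with
  | nil => rfl
  | cons i L ih => simp [ih]

theorem listD_zero (L : List (Fin n)) : listD D L (0 : S) = 0 := by
  induction L with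
  | nil => rfl
  | cons i L ih => simp [ih]

/-- Induction on the total degree. The added index is arbitrary, so identities for iterated
derivatives reduce to a single derivation. -/
theorem multi_induction {P : MultiIndex n → Prop} (h0 : P 0)
    (h1 : ∀ J i, P J → P (J + Pi.single i 1)) (J : MultiIndex n) : P J := by
  generalize hd : ∑ i, J i = d
  induction d generalizing J with
  | zero =>
    have : J = 0 := by ext i; exact (Finset.sum_eq_zero_iff.1 hd) i (Finset.mem_univ i)
    rwa [this]
  | succ d ih =>
    obtain ⟨i, hi⟩ : ∃ i, J i ≠ 0 := by
      by_contra! h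
      simp [h] at hd
    have hJ : J = (J - Pi.single i 1) + Pi.single i 1 := by
      ext a
      by_cases ha : a = i
      · subst ha; simp; omega
      · simp [ha]
    rw [hJ]
    apply h1
    apply ih
    rw [hJ] at hd
    simp only [Pi.add_apply, Finset.sum_add_distrib, Finset.sum_pi_single', Finset.mem_univ,
      if_true] at hd
    omega

variable {S' : Type*} [CommRing S'] [Algebra ℝ S'] (D' : Fin n → Derivation ℝ S' S')

include hD in
-- No linearity of `χ` is needed. It is used for pullbacks, for linearisations and for derivations
-- that commute with the `D i`.
theorem map_iterD {χ : S → S'} (hD' : ∀ i j f, D' i (D' j f) = D' j (D' i f))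
    (hχ : ∀ i f, χ (D i f) = D' i (χ f)) (J : MultiIndex n) (f : S) :
    χ (iterD D J f) = iterD D' J (χ f) := by
  induction J using multi_induction with
  | h0 => simp [iterD_zero]
  | h1 J i ih => rw [iterD_add_single D hD, iterD_add_single D' hD', hχ, ih]

theorem map_listD {χ : S → S'} (hχ : ∀ i f, χ (D i f) = D' i (χ f)) (L : List (Fin n)) (f : S) :
    χ (listD D L f) = listD D' L (χ f) := by
  induction L with
  | nil => rfl
  | cons i L ih => simp [hχ, ih]

end IteratedDerivations

/-! ### Symbols of differential operators and the Koszul complex. -/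

section Operators

open MvPolynomial

variable {n : ℕ} {S : Type*} [CommRing S] [Algebra ℝ S] (D : Fin n → Derivation ℝ S S)
  (hD : ∀ i j f, D i (D j f) = D j (D i f))

/-- The total differential operator `v ↦ ∑_J D_J (a_J v)` with symbol `∑_J a_J X^J`. -/
noncomputable def opAct (P : MvPolynomial (Fin n) S) (v : S) : S :=
  (AddMonoidAlgebra.coeff P).sum fun J a => iterD D (⇑J) (a * v)

theorem opAct_add (P Q : MvPolynomial (Fin n) S) (v : S) :
    opAct D (P + Q) v = opAct D P v + opAct D Q v := by
  unfold opAct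
  rw [AddMonoidAlgebra.coeff_add]
  exact Finsupp.sum_add_index' (by simp) (by simp [add_mul])

theorem opAct_monomial (J : Fin n →₀ ℕ) (a v : S) :
    opAct D (monomial J a) v = iterD D (⇑J) (a * v) := by
  unfold opAct
  exact Finsupp.sum_single_index (by simp)

theorem opAct_zero (v : S) : opAct D 0 v = 0 := by
  unfold opAct
  exact Finsupp.sum_zero_index

/-- The operator with a given symbol, as an additive function of the symbol. -/
noncomputable def opActHom (v : S) : MvPolynomial (Fin n) S →+ S where
  toFun P := opAct D P v
  map_zero' := opAct_zero D v
  map_add' P Q := opAct_add D P Q v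

theorem opAct_sum {κ : Type*} (s : Finset κ) (P : κ → MvPolynomial (Fin n) S) (v : S) :
    opAct D (∑ k ∈ s, P k) v = ∑ k ∈ s, opAct D (P k) v :=
  map_sum (opActHom D v) P s

theorem opAct_neg (P : MvPolynomial (Fin n) S) (v : S) : opAct D (-P) v = -opAct D P v :=
  map_neg (opActHom D v) P

theorem opAct_sub (P Q : MvPolynomial (Fin n) S) (v : S) :
    opAct D (P - Q) v = opAct D P v - opAct D Q v :=
  map_sub (opActHom D v) P Q

theorem opAct_C (a v : S) : opAct D (C a) v = a * v := by
  rw [← monomial_zero', opAct_monomial]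
  simp [iterD_zero]

include hD in
-- Because the coefficients stand inside the derivatives, composing with `D i` on the left produces
-- no commutator terms. Divergences of operators thus become polynomial combinations of the
-- variables.
theorem opAct_X_mul (i : Fin n) (P : MvPolynomial (Fin n) S) (v : S) :
    opAct D (X i * P) v = D i (opAct D P v) := by
  induction P using MvPolynomial.induction_on' with
  | monomial J a =>
    rw [X, monomial_mul, one_mul, opAct_monomial, opAct_monomial, ← iterD_add_single D hD]
    congr 2
    ext a
    simp [Finsupp.single_apply, Pi.single_apply, add_comm, eq_comm]
  | add P Q hP hQ => rw [mul_add, opAct_add, hP, hQ, opAct_add, map_add]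

variable (x : Fin n → S) (hx : ∀ i j, D i (x j) = if i = j then 1 else 0)

include hD hx in
-- The commutator of an operator with multiplication by a coordinate is the derivative of its
-- symbol; this lowers the order by one.
theorem opAct_pderiv (i : Fin n) (P : MvPolynomial (Fin n) S) (v : S) :
    opAct D (pderiv i P) v = opAct D P (x i * v) - x i * opAct D P v := by
  induction P using MvPolynomial.induction_on with
  | C a => rw [pderiv_C, opAct_zero, opAct_C, opAct_C]; ring
  | add P Q hP hQ => rw [map_add, opAct_add, hP, hQ, opAct_add, opAct_add]; ring
  | mul_X P j ih =>
    rw [(pderiv i).leibniz, pderiv_X, mul_comm P (X j), opAct_X_mul D hD, opAct_X_mul D hD,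
      smul_eq_mul, smul_eq_mul, opAct_add, opAct_X_mul D hD, ih]
    have h1 : opAct D P (x i * v) = (opAct D P (x i * v) - x i * opAct D P v)
      + x i * opAct D P v := by ring
    rw [map_sub, (D j).leibniz, hx, smul_eq_mul, smul_eq_mul]
    by_cases h : j = i
    · subst h; simp; ring
    · have : (Pi.single i 1 : Fin n → MvPolynomial (Fin n) S) j = 0 := Pi.single_eq_of_ne h _
      simp only [this, mul_zero, opAct_zero, if_neg h]
      ring

include hD hx in
-- Induction on the order: commutators of the zero operator with the coordinates vanish, so all
-- derivatives of the symbol vanish and the symbol is constant; a constant symbol is read off by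
-- applying the operator to 1.
theorem eq_zero_of_opAct_eq_zero (P : MvPolynomial (Fin n) S) (hP : ∀ v, opAct D P v = 0) :
    P = 0 := by
  -- Torsion-freeness allows division by the exponent `J i` produced by `pderiv`.
  have : Algebra ℚ S := Algebra.compHom S (algebraMap ℚ ℝ)
  have : IsAddTorsionFree S := IsAddTorsionFree.of_module_rat S
  suffices H : ∀ d (P : MvPolynomial (Fin n) S), (∀ J ∈ P.support, J.degree ≤ d) →
      (∀ v, opAct D P v = 0) → P = 0 from
    H (P.support.sup fun J => J.degree) P
      (fun J hJ => Finset.le_sup (f := fun J : Fin n →₀ ℕ => J.degree) hJ) hP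
  intro d
  induction d with
  | zero =>
    intro P hd hP
    have hC : P = C (coeff 0 P) := by
      ext J
      rw [coeff_C]
      split_ifs with h
      · rw [h]
      · by_contra hne
        have := hd J (mem_support_iff.2 hne)
        exact h ((Finsupp.degree_eq_zero_iff J).1 (Nat.le_zero.1 this)).symm
    have h1 := hP 1
    rw [hC, opAct_C, mul_one] at h1
    rw [hC, h1, map_zero]
  | succ d ih =>
    intro P hd hP
    have hder : ∀ i, pderiv i P = 0 := by
      intro i
      apply ih
      · intro J hJ
        have : J + Finsupp.single i 1 ∈ P.support := by
          rw [mem_support_iff] at hJ ⊢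
          intro h0
          rw [coeff_pderiv, h0] at hJ
          simp at hJ
        have := hd _ this
        rw [map_add, Finsupp.degree_single] at this
        omega
      · intro v
        rw [opAct_pderiv D hD x hx, hP, hP, mul_zero, sub_zero]
    have hcoef : ∀ J, J ≠ 0 → coeff J P = 0 := by
      intro J hJ
      obtain ⟨i, hi⟩ : ∃ i, J i ≠ 0 := by
        by_contra! h
        exact hJ (Finsupp.ext h)
      have h2 := congrArg (coeff (J - Finsupp.single i 1)) (hder i)
      rw [coeff_pderiv, coeff_zero, tsub_add_cancel_of_le
        (by rw [Finsupp.single_le_iff]; omega)] at h2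
      have h3 : (J i) • coeff J P = 0 := by
        rw [nsmul_eq_mul, mul_comm]
        rw [Finsupp.tsub_apply, Finsupp.single_eq_same] at h2
        have h4 : ((J i - 1 : ℕ) : S) + 1 = (J i : S) := by
          have : J i - 1 + 1 = J i := by omega
          exact_mod_cast congrArg (Nat.cast (R := S)) this
        rwa [h4] at h2
      exact (smul_eq_zero.1 h3).resolve_left hi
    apply ih P _ hP
    intro J hJ
    by_cases h : J = 0
    · simp [h]
    · exact absurd (hcoef J h) (mem_support_iff.1 hJ)

/-- Multiply the homogeneous component of degree `d` by `f d`. -/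
noncomputable def degreeScale (f : ℕ → ℝ) : MvPolynomial (Fin n) S →ₗ[S] MvPolynomial (Fin n) S :=
  (basisMonomials (Fin n) S).constr S fun J => monomial J (algebraMap ℝ S (f J.degree))

theorem degreeScale_monomial (f : ℕ → ℝ) (J : Fin n →₀ ℕ) (a : S) :
    degreeScale f (monomial J a) = monomial J (algebraMap ℝ S (f J.degree) * a) := by
  have h : monomial J a = a • basisMonomials (Fin n) S J := by
    simp [smul_monomial]
  rw [h, map_smul, degreeScale, Module.Basis.constr_basis, smul_monomial, smul_eq_mul, mul_comm]

/-- Multiplication by a variable raises the degree by one, hence the shift of the weights. -/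
theorem X_mul_degreeScale (f : ℕ → ℝ) (i : Fin n) (P : MvPolynomial (Fin n) S) :
    X i * degreeScale (fun d => f (d + 1)) P = degreeScale f (X i * P) := by
  induction P using MvPolynomial.induction_on' with
  | monomial J a =>
    rw [degreeScale_monomial, X, monomial_mul, monomial_mul, degreeScale_monomial, one_mul, one_mul,
      map_add, Finsupp.degree_single, add_comm 1]
  | add P Q hP hQ => rw [map_add, mul_add, hP, hQ, mul_add, map_add]

/-- By Euler's identity `∑ X_j ∂_j + 1` multiplies the component of degree `d` by `d + 1`, and the
weights invert this. -/
theorem degreeScale_euler (P : MvPolynomial (Fin n) S) :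
    degreeScale (fun d => ((d : ℝ) + 1)⁻¹) (∑ j, X j * pderiv j P + P) = P := by
  induction P using MvPolynomial.induction_on' with
  | monomial J a =>
    simp_rw [X_mul_pderiv_monomial]
    rw [← Finset.sum_smul]
    have hdeg : ∑ i, J i = J.degree := (Finsupp.degree_eq_sum J).symm
    rw [hdeg, map_add, map_nsmul, degreeScale_monomial, ← succ_nsmul, smul_monomial]
    congr 1
    rw [nsmul_eq_mul, ← mul_assoc]
    have : ((J.degree + 1 : ℕ) : S) = algebraMap ℝ S ((J.degree : ℝ) + 1) := by simp
    rw [this, ← map_mul, mul_inv_cancel₀ (by positivity), map_one, one_mul]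
  | add P Q hP hQ =>
    conv_rhs => rw [← hP, ← hQ]
    rw [← map_add]
    congr 1
    simp only [map_add, mul_add, Finset.sum_add_distrib]
    ring

/-- First syzygies of the variables are Koszul syzygies. -/
theorem exists_antisymm_of_sum_X_mul_eq_zero (P : Fin n → MvPolynomial (Fin n) S)
    (hP : ∑ i, X i * P i = 0) :
    ∃ B : Fin n → Fin n → MvPolynomial (Fin n) S, (∀ i j, B i j = -B j i) ∧
      ∀ i, P i = ∑ j, X j * B i j := by
  -- Applying `∂_i` to `∑ X_j P_j = 0` gives `P_i = -∑ X_j ∂_i P_j`. Therefore `∑ X_j (∂_j P_i - ∂_i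
  -- P_j)` is `(∑ X_j ∂_j + 1) P_i`, which is inverted degree by degree. The weight is `1/(d+2)`
  -- here because it turns into `1/(d+1)` once `X_j` is multiplied in.
  refine ⟨fun i j => degreeScale (fun d => (((d + 1 : ℕ) : ℝ) + 1)⁻¹)
    (pderiv j (P i) - pderiv i (P j)), fun i j => ?_, fun i => ?_⟩
  · rw [← map_neg, neg_sub]
  · have h1 : ∀ j, X j * degreeScale (fun d => (((d + 1 : ℕ) : ℝ) + 1)⁻¹)
        (pderiv j (P i) - pderiv i (P j)) =
        degreeScale (fun d => ((d : ℝ) + 1)⁻¹) (X j * (pderiv j (P i) - pderiv i (P j))) :=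
      fun j => X_mul_degreeScale (fun d => ((d : ℝ) + 1)⁻¹) j _
    simp_rw [h1]
    rw [← map_sum]
    conv_lhs => rw [← degreeScale_euler (P i)]
    congr 1
    have h2 := congrArg (pderiv i) hP
    simp only [map_sum, (pderiv i).leibniz, map_zero, pderiv_X, smul_eq_mul,
      Finset.sum_add_distrib] at h2
    have h3 : ∑ j, P j * (Pi.single i 1 : Fin n → MvPolynomial (Fin n) S) j = P i := by
      simp [Pi.single_apply]
    rw [h3] at h2
    simp only [mul_sub, Finset.sum_sub_distrib]
    linear_combination h2

end Operators

end ConsLaw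

namespace ConsLaw

/-! ### Total differential operators with divergence of order zero. -/

section TotalOperators

open MvPolynomial

variable {n N : ℕ} {S : Type*} [CommRing S] [Algebra ℝ S] (D : Fin n → Derivation ℝ S S)
  (hD : ∀ i j f, D i (D j f) = D j (D i f))

/-- `A` is a linear total differential operator in `V = (V¹, …, Vᴺ)`. -/
def IsTotalOp (A : (Fin N → S) → S) : Prop :=
  ∃ P : Fin N → MvPolynomial (Fin n) S, ∀ V, A V = ∑ ρ, opAct D (P ρ) (V ρ)

variable {D}

theorem IsTotalOp.zero : IsTotalOp (N := N) D fun _ => 0 :=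
  ⟨fun _ => 0, fun V => by simp [opAct_zero]⟩

theorem IsTotalOp.add {A B : (Fin N → S) → S} (hA : IsTotalOp D A) (hB : IsTotalOp D B) :
    IsTotalOp D fun V => A V + B V := by
  obtain ⟨P, hP⟩ := hA
  obtain ⟨Q, hQ⟩ := hB
  exact ⟨fun ρ => P ρ + Q ρ, fun V => by simp [hP, hQ, opAct_add, Finset.sum_add_distrib]⟩

theorem IsTotalOp.neg {A : (Fin N → S) → S} (hA : IsTotalOp D A) :
    IsTotalOp D fun V => -A V := by
  obtain ⟨P, hP⟩ := hA
  exact ⟨fun ρ => -P ρ, fun V => by simp [hP, opAct_neg]⟩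

theorem IsTotalOp.sub {A B : (Fin N → S) → S} (hA : IsTotalOp D A) (hB : IsTotalOp D B) :
    IsTotalOp D fun V => A V - B V := by
  simpa only [sub_eq_add_neg] using hA.add hB.neg

theorem IsTotalOp.sum {κ : Type*} (s : Finset κ) {A : κ → (Fin N → S) → S}
    (hA : ∀ k ∈ s, IsTotalOp D (A k)) : IsTotalOp D fun V => ∑ k ∈ s, A k V := by
  classical
  induction s using Finset.induction_on with
  | empty => simpa using IsTotalOp.zero
  | insert a s ha ih =>
    simp only [Finset.sum_insert ha]
    exact (hA a (Finset.mem_insert_self _ _)).add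
      (ih fun k hk => hA k (Finset.mem_insert_of_mem hk))

theorem IsTotalOp.component (ρ : Fin N) : IsTotalOp D fun V => V ρ := by
  classical
  refine ⟨Pi.single ρ (C 1), fun V => ?_⟩
  rw [Finset.sum_eq_single ρ]
  · rw [Pi.single_eq_same, opAct_C, one_mul]
  · intro b _ hb
    rw [Pi.single_eq_of_ne hb, opAct_zero]
  · simp

include hD in
theorem IsTotalOp.derivation {A : (Fin N → S) → S} (hA : IsTotalOp D A) (i : Fin n) :
    IsTotalOp D fun V => D i (A V) := by
  obtain ⟨P, hP⟩ := hA
  exact ⟨fun ρ => X i * P ρ, fun V => by simp [hP, opAct_X_mul D hD]⟩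

include hD in
theorem IsTotalOp.listD {A : (Fin N → S) → S} (hA : IsTotalOp D A) (L : List (Fin n)) :
    IsTotalOp D fun V => listD D L (A V) := by
  induction L with
  | nil => exact hA
  | cons i L ih => exact ih.derivation hD i

include hD in
-- By induction on the symbol, with `c D_i(Pv) = D_i(c Pv) - (D_i c) Pv` moving the factor inside
-- the derivatives.
theorem exists_mul_opAct (c : S) (P : MvPolynomial (Fin n) S) :
    ∃ Q : MvPolynomial (Fin n) S, ∀ v, c * opAct D P v = opAct D Q v := by
  induction P using MvPolynomial.induction_on generalizing c with
  | C a => exact ⟨C (c * a), fun v => by rw [opAct_C, opAct_C, mul_assoc]⟩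
  | add P P' hP hP' =>
    obtain ⟨Q, hQ⟩ := hP c
    obtain ⟨Q', hQ'⟩ := hP' c
    exact ⟨Q + Q', fun v => by rw [opAct_add, mul_add, hQ, hQ', opAct_add]⟩
  | mul_X P i ih =>
    obtain ⟨Q, hQ⟩ := ih c
    obtain ⟨Q', hQ'⟩ := ih (D i c)
    refine ⟨X i * Q - Q', fun v => ?_⟩
    rw [mul_comm P, opAct_X_mul D hD, opAct_sub, opAct_X_mul D hD, ← hQ, ← hQ', (D i).leibniz,
      smul_eq_mul, smul_eq_mul]
    ring

include hD in
theorem IsTotalOp.const_mul {A : (Fin N → S) → S} (hA : IsTotalOp D A) (c : S) :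
    IsTotalOp D fun V => c * A V := by
  obtain ⟨P, hP⟩ := hA
  choose Q hQ using fun ρ => exists_mul_opAct hD c (P ρ)
  exact ⟨Q, fun V => by simp only [hP, Finset.mul_sum, hQ]⟩

theorem opAct_apply_zero (P : MvPolynomial (Fin n) S) : opAct D P 0 = 0 := by
  induction P using MvPolynomial.induction_on' with
  | monomial J a => simp [opAct_monomial]
  | add P Q hP hQ => rw [opAct_add, hP, hQ, add_zero]

include hD in
/-- If the divergence of operators `A^i` is an operator of order zero then it vanishes, and the
`A^i` are themselves divergences of an antisymmetric array. -/
theorem exists_antisymm_potential (x : Fin n → S) (hx : ∀ i j, D i (x j) = if i = j then 1 else 0)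
    (A : Fin n → (Fin N → S) → S) (hA : ∀ i, IsTotalOp D (A i)) (Ξ : Fin N → S)
    (hdiv : ∀ V, ∑ i, D i (A i V) = ∑ ρ, Ξ ρ * V ρ) (V : Fin N → S) :
    ∃ ψ : Fin n → Fin n → S, (∀ i j, ψ i j = -ψ j i) ∧ ∀ i, A i V = ∑ j, D j (ψ i j) := by
  choose P hP using hA
  have key : ∀ ρ, ∑ i, X i * P i ρ = 0 := by
    intro ρ
    have h1 : ∑ i, X i * P i ρ - C (Ξ ρ) = 0 := by
      apply eq_zero_of_opAct_eq_zero D hD x hx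
      intro v
      -- Inputs with one nonzero component isolate the symbols belonging to `ρ`; here it matters
      -- that `V` is arbitrary.
      have h2 := hdiv (Pi.single ρ v)
      have h3 : ∀ i, A i (Pi.single ρ v) = opAct D (P i ρ) v := by
        intro i
        rw [hP, Finset.sum_eq_single ρ]
        · rw [Pi.single_eq_same]
        · intro b _ hb
          rw [Pi.single_eq_of_ne hb, opAct_apply_zero]
        · simp
      simp only [h3] at h2
      rw [Finset.sum_eq_single ρ (fun b _ hb => by rw [Pi.single_eq_of_ne hb, mul_zero])
        (by simp), Pi.single_eq_same] at h2
      rw [opAct_sub, opAct_sum, opAct_C, sub_eq_zero, ← h2]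
      exact Finset.sum_congr rfl fun i _ => opAct_X_mul D hD i _ v
    -- Multiples of the variables have no constant term, which forces `Ξ ρ = 0`.
    have h4 := congrArg (coeff 0) h1
    rw [coeff_sub, coeff_sum, coeff_C, if_pos rfl, coeff_zero, Finset.sum_eq_zero, zero_sub,
      neg_eq_zero] at h4
    · rwa [h4, map_zero, sub_zero] at h1
    · intro i _
      rw [coeff_X_mul']
      simp
  choose B hB1 hB2 using fun ρ => exists_antisymm_of_sum_X_mul_eq_zero (fun i => P i ρ) (key ρ)
  refine ⟨fun i j => ∑ ρ, opAct D (B ρ i j) (V ρ), fun i j => ?_, fun i => ?_⟩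
  · rw [← Finset.sum_neg_distrib]
    refine Finset.sum_congr rfl fun ρ _ => ?_
    rw [hB1, opAct_neg]
  · simp only [map_sum]
    rw [Finset.sum_comm, hP]
    refine Finset.sum_congr rfl fun ρ _ => ?_
    rw [hB2, opAct_sum]
    exact Finset.sum_congr rfl fun j _ => opAct_X_mul D hD j _ _

end TotalOperators

/-! ### Green's formula and the linearised conservation law. -/

section Green

variable {n N : ℕ} {S : Type*} [CommRing S] [Algebra ℝ S] (D : Fin n → Derivation ℝ S S)

/-- The current of Green's formula for the operator `∑_L c_L D_L`. -/
def greenCurrent (q : ℕ) (i : Fin n) (c : List (Fin n) → S) (V : S) : S :=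
  ∑ l ∈ Finset.range q, ∑ r ∈ Finset.range (q - l), (-1) ^ r *
    ∑ I : Fin l → Fin n, ∑ J : Fin r → Fin n,
      listD D (List.ofFn I) V * listD D (List.ofFn J) (c (i :: (List.ofFn I ++ List.ofFn J)))

/-- The operator `∑_L c_L D_L` on lists of length at most `q`. -/
def listOp (q : ℕ) (c : List (Fin n) → S) (V : S) : S :=
  ∑ r ∈ Finset.range (q + 1), ∑ I : Fin r → Fin n, c (List.ofFn I) * listD D (List.ofFn I) V

/-- The zeroth order part `∑_L (-1)^|L| D_L c_L` of the formal adjoint. -/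
def listAdjoint (q : ℕ) (c : List (Fin n) → S) : S :=
  ∑ r ∈ Finset.range (q + 1), (-1) ^ r * ∑ I : Fin r → Fin n, listD D (List.ofFn I) (c (List.ofFn I))

theorem sum_ofFn_succ {M : Type*} [AddCommMonoid M] (l : ℕ) (f : List (Fin n) → M) :
    ∑ I : Fin (l + 1) → Fin n, f (List.ofFn I) =
      ∑ i, ∑ I : Fin l → Fin n, f (i :: List.ofFn I) := by
  rw [← (Fin.consEquiv fun _ : Fin (l + 1) => Fin n).sum_comp, Fintype.sum_prod_type]
  simp [Fin.consEquiv]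

theorem sum_ofFn_zero {M : Type*} [AddCommMonoid M] (f : List (Fin n) → M) :
    ∑ I : Fin 0 → Fin n, f (List.ofFn I) = f [] := by
  simp

/-- Along each antidiagonal `l + r = const` the alternating sum telescopes to its two ends. With `Y
l r` having `l` derivatives on `V` and `r` on the coefficient, this is repeated integration by
parts. -/
theorem sum_triangle_telescope {S : Type*} [CommRing S] (Y : ℕ → ℕ → S) (q : ℕ) :
    ∑ l ∈ Finset.range q, ∑ r ∈ Finset.range (q - l), (-1) ^ r * (Y (l + 1) r + Y l (r + 1)) =
      ∑ r ∈ Finset.range (q + 1), Y r 0 - ∑ r ∈ Finset.range (q + 1), (-1) ^ r * Y 0 r := by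
  induction q with
  | zero => simp
  | succ q ih =>
    rw [Finset.sum_range_succ (fun r => Y r 0), Finset.sum_range_succ (fun r => (-1) ^ r * Y 0 r)]
    have h1 : ∑ l ∈ Finset.range (q + 1), ∑ r ∈ Finset.range (q + 1 - l),
        (-1) ^ r * (Y (l + 1) r + Y l (r + 1)) =
        ∑ l ∈ Finset.range (q + 1), (∑ r ∈ Finset.range (q - l),
          (-1) ^ r * (Y (l + 1) r + Y l (r + 1)) +
          (-1) ^ (q - l) * (Y (l + 1) (q - l) + Y l (q - l + 1))) := by
      refine Finset.sum_congr rfl fun l hl => ?_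
      have : q + 1 - l = (q - l) + 1 := by
        have := Finset.mem_range.1 hl
        omega
      rw [this, Finset.sum_range_succ]
    rw [h1, Finset.sum_add_distrib, Finset.sum_range_succ (fun l => ∑ r ∈ Finset.range (q - l),
      (-1) ^ r * (Y (l + 1) r + Y l (r + 1))), ih]
    -- Passing from `q` to `q + 1` adds exactly the antidiagonal `l + r = q`.
    have h2 : ∑ l ∈ Finset.range (q + 1),
        (-1) ^ (q - l) * (Y (l + 1) (q - l) + Y l (q - l + 1)) =
        ∑ l ∈ Finset.range (q + 1), ((-1) ^ (q + 1 - (l + 1)) * Y (l + 1) (q + 1 - (l + 1)) -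
          (-1) ^ (q + 1 - l) * Y l (q + 1 - l)) := by
      refine Finset.sum_congr rfl fun l hl => ?_
      have : q + 1 - l = (q - l) + 1 := by
        have := Finset.mem_range.1 hl
        omega
      rw [this, Nat.add_sub_add_right, pow_succ]
      ring
    rw [h2, Finset.sum_range_sub (fun l => (-1) ^ (q + 1 - l) * Y l (q + 1 - l))]
    simp
    ring

/-- Green's formula. -/
theorem sum_derivation_greenCurrent (q : ℕ) (c : List (Fin n) → S)
    (hc : ∀ L L', L.Perm L' → c L = c L') (V : S) :
    ∑ i, D i (greenCurrent D q i c V) = listOp D q c V - V * listAdjoint D q c := by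
  let Y : ℕ → ℕ → S := fun l r => ∑ I : Fin l → Fin n, ∑ J : Fin r → Fin n,
    listD D (List.ofFn I) V * listD D (List.ofFn J) (c (List.ofFn I ++ List.ofFn J))
  have h1 : ∀ l r, Y (l + 1) r = ∑ i, ∑ I : Fin l → Fin n, ∑ J : Fin r → Fin n,
      D i (listD D (List.ofFn I) V) *
        listD D (List.ofFn J) (c (i :: (List.ofFn I ++ List.ofFn J))) := fun l r =>
    sum_ofFn_succ l fun L => ∑ J : Fin r → Fin n,
      listD D L V * listD D (List.ofFn J) (c (L ++ List.ofFn J))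
  have h2 : ∀ l r, Y l (r + 1) = ∑ i, ∑ I : Fin l → Fin n, ∑ J : Fin r → Fin n,
      listD D (List.ofFn I) V *
        D i (listD D (List.ofFn J) (c (i :: (List.ofFn I ++ List.ofFn J)))) := by
    intro l r
    rw [Finset.sum_comm]
    refine Finset.sum_congr rfl fun I _ => ?_
    rw [sum_ofFn_succ r fun L => listD D (List.ofFn I) V * listD D L (c (List.ofFn I ++ L))]
    refine Finset.sum_congr rfl fun i _ => Finset.sum_congr rfl fun J _ => ?_
    -- Symmetry of the coefficients brings the index of the outer derivative to the front of the
    -- list, where `greenCurrent` has it.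
    rw [listD_cons, hc _ _ List.perm_middle]
  have h3 : ∀ (r : ℕ) (i : Fin n) (f : S), D i ((-1) ^ r * f) = (-1) ^ r * D i f := by
    intro r i f
    rcases neg_one_pow_eq_or S r with h | h <;> simp [h]
  have h4 : ∑ i, D i (greenCurrent D q i c V) = ∑ l ∈ Finset.range q,
      ∑ r ∈ Finset.range (q - l), (-1) ^ r * (Y (l + 1) r + Y l (r + 1)) := by
    simp only [greenCurrent, map_sum]
    rw [Finset.sum_comm]
    refine Finset.sum_congr rfl fun l _ => ?_
    rw [Finset.sum_comm]
    refine Finset.sum_congr rfl fun r _ => ?_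
    simp only [h3, map_sum]
    rw [← Finset.mul_sum, h1, h2]
    congr 1
    rw [← Finset.sum_add_distrib]
    refine Finset.sum_congr rfl fun i _ => ?_
    rw [← Finset.sum_add_distrib]
    refine Finset.sum_congr rfl fun I _ => ?_
    rw [← Finset.sum_add_distrib]
    refine Finset.sum_congr rfl fun J _ => ?_
    rw [(D i).leibniz, smul_eq_mul, smul_eq_mul]
    ring
  rw [h4, sum_triangle_telescope, listOp, listAdjoint, Finset.mul_sum]
  congr 1
  · refine Finset.sum_congr rfl fun r _ => Finset.sum_congr rfl fun I _ => ?_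
    simp [mul_comm]
  · refine Finset.sum_congr rfl fun r _ => ?_
    rw [mul_left_comm, Finset.mul_sum]
    simp [Finset.mul_sum]

theorem listOp_mul (q : ℕ) (a : S) (c : List (Fin n) → S) (V : S) :
    listOp D q (fun L => a * c L) V = a * listOp D q c V := by
  simp only [listOp, Finset.mul_sum, mul_assoc]

theorem greenCurrent_zero_right (q : ℕ) (i : Fin n) (c : List (Fin n) → S) :
    greenCurrent D q i c 0 = 0 := by
  simp [greenCurrent, listD_zero]

variable {S' : Type*} [CommRing S'] [Algebra ℝ S'] (D' : Fin n → Derivation ℝ S' S')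

theorem map_greenCurrent (χ : S →ₐ[ℝ] S') (hχ : ∀ i f, χ (D i f) = D' i (χ f)) (q : ℕ) (i : Fin n)
    (c : List (Fin n) → S) (V : S) :
    χ (greenCurrent D q i c V) = greenCurrent D' q i (fun L => χ (c L)) (χ V) := by
  simp only [greenCurrent, map_sum, map_mul, map_pow, map_neg, map_one, map_listD D D' hχ]

theorem map_listAdjoint (χ : S →+ S') (hχ : ∀ i f, χ (D i f) = D' i (χ f)) (q : ℕ)
    (c : List (Fin n) → S) :
    χ (listAdjoint D q c) = listAdjoint D' q (fun L => χ (c L)) := by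
  have h3 : ∀ (r : ℕ) (f : S), χ ((-1) ^ r * f) = (-1) ^ r * χ f := by
    intro r f
    rcases Nat.even_or_odd r with h | h <;> simp [h]
  simp only [listAdjoint, map_sum, h3, map_listD D D' hχ]

/-- A derivation commuting with the `D_i` acts on Green's current by the product rule. -/
theorem derivation_greenCurrent (E : Derivation ℝ S S) (hE : ∀ i f, E (D i f) = D i (E f)) (q : ℕ)
    (i : Fin n) (c : List (Fin n) → S) (V : S) :
    E (greenCurrent D q i c V) =
      greenCurrent D q i (fun L => E (c L)) V + greenCurrent D q i c (E V) := by
  have h3 : ∀ (r : ℕ) (f : S), E ((-1) ^ r * f) = (-1) ^ r * E f := by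
    intro r f
    rcases neg_one_pow_eq_or S r with h | h <;> simp [h]
  simp only [greenCurrent, map_sum, h3, ← Finset.sum_add_distrib, ← mul_add, E.leibniz,
    map_listD D D hE, smul_eq_mul]
  refine Finset.sum_congr rfl fun l _ => Finset.sum_congr rfl fun r _ => ?_
  congr 1
  refine Finset.sum_congr rfl fun I _ => Finset.sum_congr rfl fun J _ => ?_
  ring

variable {D} (hD : ∀ i j f, D i (D j f) = D j (D i f))

include hD in
-- Together with the next lemma: Green's current is bilinear and differential in its two arguments,
-- so it is a total operator in `V` whichever of them contains `V`.
theorem IsTotalOp.greenCurrent_right {A : (Fin N → S) → S} (hA : IsTotalOp D A) (q : ℕ) (i : Fin n)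
    (c : List (Fin n) → S) : IsTotalOp D fun V => greenCurrent D q i c (A V) := by
  unfold greenCurrent
  refine IsTotalOp.sum _ fun l _ => IsTotalOp.sum _ fun r _ => IsTotalOp.const_mul hD ?_ _
  refine IsTotalOp.sum _ fun I _ => IsTotalOp.sum _ fun J _ => ?_
  have h := (hA.listD hD (List.ofFn I)).const_mul hD
    (ConsLaw.listD D (List.ofFn J) (c (i :: (List.ofFn I ++ List.ofFn J))))
  convert! h using 2
  exact mul_comm _ _

include hD in
theorem IsTotalOp.greenCurrent_left {c : List (Fin n) → (Fin N → S) → S}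
    (hc : ∀ L, IsTotalOp D (c L)) (q : ℕ) (i : Fin n) (Q : S) :
    IsTotalOp D fun V => greenCurrent D q i (fun L => c L V) Q := by
  unfold greenCurrent
  refine IsTotalOp.sum _ fun l _ => IsTotalOp.sum _ fun r _ => IsTotalOp.const_mul hD ?_ _
  refine IsTotalOp.sum _ fun I _ => IsTotalOp.sum _ fun J _ => ?_
  exact ((hc _).listD hD _).const_mul hD _

include hD in
theorem IsTotalOp.listOp {A : (Fin N → S) → S} (hA : IsTotalOp D A) (q : ℕ)
    (c : List (Fin n) → S) : IsTotalOp D fun V => listOp D q c (A V) := by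
  unfold ConsLaw.listOp
  exact IsTotalOp.sum _ fun l _ => IsTotalOp.sum _ fun r _ => (hA.listD hD _).const_mul hD _

include hD in
/-- The linearised conservation law off the solution space: the difference between the linearised
spatial flux and the currents built from the multipliers is a trivial flux. -/
theorem exists_flux_potential (x : Fin n → S) (hx : ∀ i j, D i (x j) = if i = j then 1 else 0)
    (k m p : ℕ) (Q : Fin N → S) (c c' : Fin N → List (Fin n) → S)
    (δc : Fin N → List (Fin n) → (Fin N → S) → S)
    (hc : ∀ σ L L', L.Perm L' → c σ L = c σ L') (hc' : ∀ σ L L', L.Perm L' → c' σ L = c' σ L')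
    (hδc : ∀ σ V L L', L.Perm L' → δc σ L V = δc σ L' V) (hδcop : ∀ σ L, IsTotalOp D (δc σ L))
    (Λ : Fin N → S) (gc Λc : Fin N → Fin N → List (Fin n) → S)
    (hgc : ∀ σ ρ L L', L.Perm L' → gc σ ρ L = gc σ ρ L')
    (hΛc : ∀ σ ρ L L', L.Perm L' → Λc σ ρ L = Λc σ ρ L')
    (hΛ : ∀ σ, listAdjoint D k (c σ) = Λ σ)
    (hδΛ : ∀ σ V, listAdjoint D k (fun L => δc σ L V) = ∑ ρ, listOp D p (Λc σ ρ) (V ρ))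
    (δX : Fin n → (Fin N → S) → S) (hδX : ∀ i, IsTotalOp D (δX i))
    (hlin : ∀ V, ∑ σ, listOp D k (c' σ) (V σ) - ∑ σ, listOp D k (fun L => δc σ L V) (Q σ) -
      ∑ σ, listOp D k (c σ) (∑ ρ, listOp D m (gc σ ρ) (V ρ)) + ∑ i, D i (δX i V) = 0)
    (V : Fin N → S) :
    ∃ ψ : Fin n → Fin n → S, (∀ i j, ψ i j = -ψ j i) ∧ ∀ i,
      ∑ σ, greenCurrent D k i (c' σ) (V σ) - ∑ σ, greenCurrent D k i (fun L => δc σ L V) (Q σ) -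
        ∑ σ, greenCurrent D k i (c σ) (∑ ρ, listOp D m (gc σ ρ) (V ρ)) + δX i V -
        ∑ ρ, ∑ σ, greenCurrent D m i (fun L => Λ σ * gc σ ρ L) (V ρ) -
        ∑ ρ, ∑ σ, greenCurrent D p i (fun L => Q σ * Λc σ ρ L) (V ρ) = ∑ j, D j (ψ i j) := by
  refine exists_antisymm_potential hD x hx
    (fun i V => ∑ σ, greenCurrent D k i (c' σ) (V σ) -
        ∑ σ, greenCurrent D k i (fun L => δc σ L V) (Q σ) -
        ∑ σ, greenCurrent D k i (c σ) (∑ ρ, listOp D m (gc σ ρ) (V ρ)) + δX i V -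
        ∑ ρ, ∑ σ, greenCurrent D m i (fun L => Λ σ * gc σ ρ L) (V ρ) -
        ∑ ρ, ∑ σ, greenCurrent D p i (fun L => Q σ * Λc σ ρ L) (V ρ))
    (fun i => ?_)
    -- These are the adjoint terms that Green's formula leaves with an undifferentiated `V`. The
    -- adjoint terms with `Q` and with the linearised `g` cancel against the two currents that
    -- contain `Q` and `Λ`, and the remaining operator terms are `hlin`.
    (fun ρ => -listAdjoint D k (c' ρ) + ∑ σ, listAdjoint D m (fun L => Λ σ * gc σ ρ L) +
      ∑ σ, listAdjoint D p (fun L => Q σ * Λc σ ρ L)) (fun V => ?_) V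
  · refine IsTotalOp.sub (IsTotalOp.sub (IsTotalOp.add (IsTotalOp.sub (IsTotalOp.sub ?_ ?_) ?_)
      (hδX i)) ?_) ?_
    · exact IsTotalOp.sum _ fun σ _ => (IsTotalOp.component σ).greenCurrent_right hD k i _
    · exact IsTotalOp.sum _ fun σ _ => IsTotalOp.greenCurrent_left hD (hδcop σ) k i _
    · refine IsTotalOp.sum _ fun σ _ => IsTotalOp.greenCurrent_right hD ?_ k i _
      exact IsTotalOp.sum _ fun ρ _ => (IsTotalOp.component ρ).listOp hD m _
    · exact IsTotalOp.sum _ fun ρ _ => IsTotalOp.sum _ fun σ _ =>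
        (IsTotalOp.component ρ).greenCurrent_right hD m i _
    · exact IsTotalOp.sum _ fun ρ _ => IsTotalOp.sum _ fun σ _ =>
        (IsTotalOp.component ρ).greenCurrent_right hD p i _
  · have e1 : ∀ (A : Fin n → Fin N → S), ∑ i, D i (∑ σ, A i σ) = ∑ σ, ∑ i, D i (A i σ) := by
      intro A
      simp only [map_sum]
      exact Finset.sum_comm
    have e2 : ∀ (A : Fin n → Fin N → Fin N → S),
        ∑ i, D i (∑ ρ, ∑ σ, A i ρ σ) = ∑ ρ, ∑ σ, ∑ i, D i (A i ρ σ) := by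
      intro A
      rw [e1]
      exact Finset.sum_congr rfl fun ρ _ => e1 _
    simp only [map_add, map_sub, Finset.sum_add_distrib, Finset.sum_sub_distrib]
    rw [e1, e1, e1, e2, e2]
    simp only [sum_derivation_greenCurrent D _ _ (hc _), sum_derivation_greenCurrent D _ _ (hc' _),
      sum_derivation_greenCurrent D _ _ (hδc _ V)]
    have s1 : ∀ ρ σ, ∑ i, D i (greenCurrent D m i (fun L => Λ σ * gc σ ρ L) (V ρ)) =
        Λ σ * listOp D m (gc σ ρ) (V ρ) - V ρ * listAdjoint D m (fun L => Λ σ * gc σ ρ L) := by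
      intro ρ σ
      rw [sum_derivation_greenCurrent D m _ (fun L L' h => by rw [hgc σ ρ L L' h]), listOp_mul]
    have s2 : ∀ ρ σ, ∑ i, D i (greenCurrent D p i (fun L => Q σ * Λc σ ρ L) (V ρ)) =
        Q σ * listOp D p (Λc σ ρ) (V ρ) - V ρ * listAdjoint D p (fun L => Q σ * Λc σ ρ L) := by
      intro ρ σ
      rw [sum_derivation_greenCurrent D p _ (fun L L' h => by rw [hΛc σ ρ L L' h]), listOp_mul]
    simp only [s1, s2, hδΛ, hΛ, Finset.sum_sub_distrib]
    have t1 : ∑ ρ, ∑ σ, Λ σ * listOp D m (gc σ ρ) (V ρ) =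
        ∑ σ, (∑ ρ, listOp D m (gc σ ρ) (V ρ)) * Λ σ := by
      rw [Finset.sum_comm]
      refine Finset.sum_congr rfl fun σ _ => ?_
      rw [Finset.sum_mul]
      exact Finset.sum_congr rfl fun ρ _ => mul_comm _ _
    have t2 : ∑ ρ, ∑ σ, Q σ * listOp D p (Λc σ ρ) (V ρ) =
        ∑ σ, Q σ * ∑ ρ, listOp D p (Λc σ ρ) (V ρ) := by
      rw [Finset.sum_comm]
      exact Finset.sum_congr rfl fun σ _ => (Finset.mul_sum _ _ _).symm
    have t3 : ∑ ρ, (-listAdjoint D k (c' ρ) + ∑ σ, listAdjoint D m (fun L => Λ σ * gc σ ρ L) +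
        ∑ σ, listAdjoint D p (fun L => Q σ * Λc σ ρ L)) * V ρ =
        -(∑ ρ, V ρ * listAdjoint D k (c' ρ)) +
        ∑ ρ, ∑ σ, V ρ * listAdjoint D m (fun L => Λ σ * gc σ ρ L) +
        ∑ ρ, ∑ σ, V ρ * listAdjoint D p (fun L => Q σ * Λc σ ρ L) := by
      rw [← Finset.sum_neg_distrib, ← Finset.sum_add_distrib, ← Finset.sum_add_distrib]
      refine Finset.sum_congr rfl fun ρ _ => ?_
      rw [← Finset.mul_sum, ← Finset.mul_sum]
      ring
    rw [t1, t2, t3]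
    linear_combination hlin V

end Green

end ConsLaw

/-! ### Smooth functions of finitely many coordinates and their derivations. -/

namespace ConsLaw

open TopologicalSpace

/-- A family of coordinates on a topological vector space together with dual vectors. -/
structure CoordSystem (ι X : Type*) [AddCommGroup X] [Module ℝ X] [TopologicalSpace X] where
  coord : ι → X →L[ℝ] ℝ
  vec : ι → X
  coord_vec_self : ∀ a, coord a (vec a) = 1
  coord_vec_ne : ∀ a b, a ≠ b → coord a (vec b) = 0

section TameFunctions

variable {ι X : Type*} [AddCommGroup X] [Module ℝ X] [TopologicalSpace X] (C : CoordSystem ι X)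

namespace CoordSystem

/-- The projection to finitely many coordinates. -/
noncomputable def proj (c : Finset ι) : X →L[ℝ] (c → ℝ) :=
  ContinuousLinearMap.pi fun a => C.coord a

@[simp] theorem proj_apply (c : Finset ι) (z : X) (a : c) : C.proj c z a = C.coord a z := rfl

theorem proj_vec_of_notMem {c : Finset ι} {a : ι} (ha : a ∉ c) : C.proj c (C.vec a) = 0 := by
  ext b
  exact C.coord_vec_ne b a fun h => ha (h ▸ b.2)

theorem proj_vec_of_mem [DecidableEq ι] {c : Finset ι} {a : ι} (ha : a ∈ c) :
    C.proj c (C.vec a) = Pi.single ⟨a, ha⟩ 1 := by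
  ext b
  by_cases h : b = ⟨a, ha⟩
  · subst h
    simp [C.coord_vec_self]
  · rw [Pi.single_eq_of_ne h]
    exact C.coord_vec_ne b a fun h' => h (Subtype.ext h')

theorem proj_eq_sum (c : Finset ι) (v : X) :
    C.proj c v = ∑ a ∈ c, C.coord a v • C.proj c (C.vec a) := by
  classical
  ext b
  rw [Finset.sum_apply, Finset.sum_eq_single b.1]
  · simp [C.coord_vec_self]
  · intro a _ hab
    simp [C.coord_vec_ne b a (Ne.symm hab)]
  · simp

/-- `f` is a smooth function of the coordinates in `c`. -/
def Factors (O : Opens X) (c : Finset ι) (f : O → ℝ) : Prop :=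
  ∃ φ : (c → ℝ) → ℝ, ContDiffOn ℝ ∞ φ (C.proj c '' O) ∧ ∀ z : O, f z = φ (C.proj c z)

variable {C} {O : Opens X} {c : Finset ι} {f : O → ℝ}

theorem Factors.mono {c' : Finset ι} (h : C.Factors O c f) (hc : c ⊆ c') : C.Factors O c' f := by
  obtain ⟨φ, h1, h2⟩ := h
  let r : (c' → ℝ) →L[ℝ] (c → ℝ) :=
    ContinuousLinearMap.pi fun a => ContinuousLinearMap.proj (⟨a.1, hc a.2⟩ : c')
  refine ⟨fun y => φ (r y), h1.comp r.contDiff.contDiffOn ?_, fun z => h2 z⟩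
  rintro _ ⟨z, hz, rfl⟩
  exact ⟨z, hz, rfl⟩

variable [IsTopologicalAddGroup X] [ContinuousSMul ℝ X]

variable (C) in
-- The dual vectors give a continuous affine section of the projection through each point of `O`;
-- the preimage of `O` under it is a neighbourhood inside the image.
theorem isOpen_image_proj (c : Finset ι) {O : Set X} (hO : IsOpen O) :
    IsOpen (C.proj c '' O) := by
  classical
  rw [isOpen_iff_mem_nhds]
  rintro _ ⟨z, hz, rfl⟩
  let s : (c → ℝ) → X := fun y => z + ∑ a : c, (y a - C.coord a z) • C.vec a
  have hs : Continuous s := by fun_prop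
  have hs0 : s (C.proj c z) = z := by simp [s]
  have hps : ∀ y, C.proj c (s y) = y := by
    intro y
    ext b
    simp only [s, map_add, map_sum, map_smul, proj_apply, smul_eq_mul]
    rw [Finset.sum_eq_single b]
    · simp [C.coord_vec_self]
    · intro a _ hab
      rw [C.coord_vec_ne b a fun h => hab (Subtype.ext h.symm), mul_zero]
    · simp
  have : s ⁻¹' O ∈ nhds (C.proj c z) := hs.continuousAt.preimage_mem_nhds (by
    rw [hs0]; exact hO.mem_nhds hz)
  filter_upwards [this] with y hy
  exact ⟨s y, hy, hps y⟩

/-- The chain rule along a curve. -/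
theorem hasDerivAt_comp_curve {φ : (c → ℝ) → ℝ} (hφ : ContDiffOn ℝ ∞ φ (C.proj c '' O))
    {F : X → ℝ} (hF : ∀ z ∈ O, F z = φ (C.proj c z)) {γ : ℝ → X} (h0 : γ 0 ∈ O)
    (hγ : ∀ᶠ t in nhds 0, γ t ∈ O) {y : c → ℝ}
    (hy : ∀ a : c, HasDerivAt (fun t => C.coord a (γ t)) (y a) 0) :
    HasDerivAt (fun t => F (γ t)) (fderiv ℝ φ (C.proj c (γ 0)) y) 0 := by
  have hopen := C.isOpen_image_proj c O.isOpen
  have hd : DifferentiableAt ℝ φ (C.proj c (γ 0)) :=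
    (hφ.contDiffAt (hopen.mem_nhds ⟨_, h0, rfl⟩)).differentiableAt (by simp)
  have h1 : HasDerivAt (fun t => C.proj c (γ t)) y 0 := hasDerivAt_pi.2 hy
  refine (hd.hasFDerivAt.comp_hasDerivAt 0 h1).congr_of_eventuallyEq ?_
  filter_upwards [hγ] with t ht
  exact hF _ ht

theorem hasLineDerivAt_of_factors {φ : (c → ℝ) → ℝ} (hφ : ContDiffOn ℝ ∞ φ (C.proj c '' O))
    {F : X → ℝ} (hF : ∀ z ∈ O, F z = φ (C.proj c z)) {z : X} (hz : z ∈ O) (v : X) :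
    HasLineDerivAt ℝ F (fderiv ℝ φ (C.proj c z) (C.proj c v)) z v := by
  have h := hasDerivAt_comp_curve hφ hF (γ := fun t => z + t • v) (y := C.proj c v) (by simpa)
    (by
      have hc : Continuous fun t : ℝ => z + t • v := by fun_prop
      exact hc.continuousAt.preimage_mem_nhds (O.isOpen.mem_nhds (by simpa)))
    (fun a => by
      simp only [map_add, map_smul, smul_eq_mul, proj_apply]
      simpa using ((hasDerivAt_id (0 : ℝ)).mul_const (C.coord a v)).const_add (C.coord a z))
  simpa [HasLineDerivAt] using h

variable (C O) in
/-- The algebra of smooth functions of finitely many coordinates. -/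
def tame : Subalgebra ℝ (O → ℝ) where
  carrier := {f | ∃ c, C.Factors O c f}
  mul_mem' := by
    classical
    rintro f g ⟨c, hf⟩ ⟨c', hg⟩
    obtain ⟨φ, h1, h2⟩ := hf.mono (Finset.subset_union_left (s₂ := c'))
    obtain ⟨ψ, h3, h4⟩ := hg.mono (Finset.subset_union_right (s₁ := c))
    exact ⟨_, fun y => φ y * ψ y, h1.mul h3, fun z => by simp [h2, h4]⟩
  add_mem' := by
    classical
    rintro f g ⟨c, hf⟩ ⟨c', hg⟩
    obtain ⟨φ, h1, h2⟩ := hf.mono (Finset.subset_union_left (s₂ := c'))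
    obtain ⟨ψ, h3, h4⟩ := hg.mono (Finset.subset_union_right (s₁ := c))
    exact ⟨_, fun y => φ y + ψ y, h1.add h3, fun z => by simp [h2, h4]⟩
  algebraMap_mem' r := ⟨∅, fun _ => r, contDiffOn_const, fun _ => rfl⟩

variable (C O) in
/-- The algebra of smooth functions of finitely many coordinates, as a type. -/
def Tame : Type _ := C.tame O

noncomputable instance : CommRing (C.Tame O) := inferInstanceAs (CommRing (C.tame O))

noncomputable instance : Algebra ℝ (C.Tame O) := inferInstanceAs (Algebra ℝ (C.tame O))

@[ext] theorem Tame.ext {f g : C.Tame O} (h : ∀ z, f.1 z = g.1 z) : f = g :=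
  Subtype.ext (funext h)

theorem Tame.exists_factors (f : C.Tame O) : ∃ c, C.Factors O c f.1 := f.2

/-- The partial derivative of a function on an open set. -/
noncomputable def partialFun (C : CoordSystem ι X) (a : ι) (f : O → ℝ) : O → ℝ := fun z =>
  lineDeriv ℝ (Function.extend Subtype.val f 0) z (C.vec a)

theorem extend_apply {X : Type*} [TopologicalSpace X] {O : Opens X} (f : O → ℝ) {z : X} (hz : z ∈ O) :
    Function.extend Subtype.val f 0 z = f ⟨z, hz⟩ :=
  Subtype.val_injective.extend_apply f 0 ⟨z, hz⟩

theorem partialFun_eq {φ : (c → ℝ) → ℝ} (hφ : ContDiffOn ℝ ∞ φ (C.proj c '' O))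
    (hf : ∀ z : O, f z = φ (C.proj c z)) (a : ι) (z : O) :
    C.partialFun a f z = fderiv ℝ φ (C.proj c z) (C.proj c (C.vec a)) :=
  (hasLineDerivAt_of_factors hφ (fun z hz => by rw [extend_apply f hz, hf]) z.2 _).lineDeriv

theorem contDiffOn_fderiv_apply {φ : (c → ℝ) → ℝ} (hφ : ContDiffOn ℝ ∞ φ (C.proj c '' O))
    (v : c → ℝ) : ContDiffOn ℝ ∞ (fun y => fderiv ℝ φ y v) (C.proj c '' O) :=
  (hφ.fderiv_of_isOpen (C.isOpen_image_proj c O.isOpen) (m := ∞) (by simp)).clm_apply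
    contDiffOn_const

theorem Factors.partialFun (h : C.Factors O c f) (a : ι) :
    C.Factors O c (C.partialFun a f) := by
  obtain ⟨φ, h1, h2⟩ := h
  exact ⟨fun y => fderiv ℝ φ y (C.proj c (C.vec a)), contDiffOn_fderiv_apply h1 _,
    fun z => partialFun_eq h1 h2 a z⟩

theorem Factors.partialFun_eq_zero (h : C.Factors O c f) {a : ι} (ha : a ∉ c) :
    C.partialFun a f = 0 := by
  obtain ⟨φ, h1, h2⟩ := h
  ext z
  rw [partialFun_eq h1 h2, C.proj_vec_of_notMem ha, map_zero]
  rfl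

theorem hasLineDerivAt_extend (f : C.Tame O) (z : O) (a : ι) :
    HasLineDerivAt ℝ (Function.extend Subtype.val f.1 0) (C.partialFun a f.1 z) z (C.vec a) := by
  obtain ⟨c, φ, h1, h2⟩ := Tame.exists_factors f
  rw [partialFun_eq h1 h2]
  exact hasLineDerivAt_of_factors h1 (fun z hz => by rw [extend_apply _ hz, h2]) z.2 _

/-- Extension by zero respects sums, products and scalars, the condition `op 0 0 = 0` covering the
points outside `O`. The rules for `lineDeriv` then apply to globally defined functions. -/
theorem extend_map₂ {X : Type*} [TopologicalSpace X] {O : Opens X} (f g : O → ℝ) (op : ℝ → ℝ → ℝ)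
    (h0 : op 0 0 = 0) (z : X) :
    Function.extend Subtype.val (fun z => op (f z) (g z)) 0 z =
      op (Function.extend Subtype.val f 0 z) (Function.extend Subtype.val g 0 z) := by
  by_cases hz : z ∈ O
  · rw [extend_apply _ hz, extend_apply _ hz, extend_apply _ hz]
  · have : ¬∃ a : O, a.1 = z := by
      rintro ⟨a, rfl⟩
      exact hz a.2
    rw [Function.extend_apply' _ _ _ this, Function.extend_apply' _ _ _ this,
      Function.extend_apply' _ _ _ this]
    exact h0.symm

variable (C O) in
/-- The partial derivative with respect to a coordinate. -/
noncomputable def pd (a : ι) : Derivation ℝ (C.Tame O) (C.Tame O) :=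
  Derivation.mk'
    { toFun := fun f => ⟨C.partialFun a f.1, by
        obtain ⟨c, hc⟩ := Tame.exists_factors f
        exact ⟨c, hc.partialFun a⟩⟩
      map_add' := fun f g => by
        ext z
        refine HasLineDerivAt.lineDeriv ?_
        have := HasDerivAt.add (hasLineDerivAt_extend f z a) (hasLineDerivAt_extend g z a)
        refine HasDerivAt.congr_of_eventuallyEq this (Filter.Eventually.of_forall fun t => ?_)
        exact extend_map₂ f.1 g.1 (· + ·) (by simp) _
      map_smul' := fun r f => by
        ext z
        refine HasLineDerivAt.lineDeriv ?_
        have := HasDerivAt.const_mul r (hasLineDerivAt_extend f z a)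
        refine HasDerivAt.congr_of_eventuallyEq this (Filter.Eventually.of_forall fun t => ?_)
        exact extend_map₂ f.1 f.1 (fun x _ => r * x) (by simp) _ }
    (fun f g => by
      ext z
      refine HasLineDerivAt.lineDeriv ?_
      have := HasDerivAt.mul (hasLineDerivAt_extend f z a) (hasLineDerivAt_extend g z a)
      rw [zero_smul, add_zero, extend_apply _ z.2, extend_apply _ z.2] at this
      have h : HasLineDerivAt ℝ (Function.extend Subtype.val (f * g).1 0)
          (f.1 z * C.partialFun a g.1 z + g.1 z * C.partialFun a f.1 z) z (C.vec a) := by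
        refine HasDerivAt.congr_of_eventuallyEq (f := _) ?_ (Filter.Eventually.of_forall fun t =>
          extend_map₂ f.1 g.1 (· * ·) (by simp) _)
        convert! this using 1
        ring
      exact h)

theorem pd_factors {f : C.Tame O} (hc : C.Factors O c f.1) (a : ι) :
    C.Factors O c (C.pd O a f).1 := hc.partialFun a

theorem pd_eq_zero {f : C.Tame O} (hc : C.Factors O c f.1) {a : ι} (ha : a ∉ c) :
    C.pd O a f = 0 := Subtype.ext (hc.partialFun_eq_zero ha)

/-- Symmetry of the second derivative of a finite-dimensional representative. -/
theorem pd_comm (a b : ι) (f : C.Tame O) :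
    C.pd O a (C.pd O b f) = C.pd O b (C.pd O a f) := by
  obtain ⟨c, φ, h1, h2⟩ := Tame.exists_factors f
  have key : ∀ a b : ι, ∀ z : O, (C.pd O a (C.pd O b f)).1 z =
      fderiv ℝ (fderiv ℝ φ) (C.proj c z) (C.proj c (C.vec a)) (C.proj c (C.vec b)) := by
    intro a b z
    have h3 := partialFun_eq (contDiffOn_fderiv_apply h1 (C.proj c (C.vec b)))
      (f := (C.pd O b f).1) (partialFun_eq h1 h2 b) a z
    refine h3.trans ?_
    have hU := (C.isOpen_image_proj c O.isOpen).mem_nhds ⟨z.1, z.2, rfl⟩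
    have hd : DifferentiableAt ℝ (fderiv ℝ φ) (C.proj c z) :=
      ((h1.fderiv_of_isOpen (C.isOpen_image_proj c O.isOpen) (m := ∞) (by simp)).contDiffAt
        hU).differentiableAt (by simp)
    rw [fderiv_clm_apply hd (differentiableAt_const _)]
    simp
  ext z
  rw [key, key]
  have hU := (C.isOpen_image_proj c O.isOpen).mem_nhds ⟨z.1, z.2, rfl⟩
  exact ((h1.contDiffAt hU).isSymmSndFDerivAt (by
    rw [minSmoothness_of_isRCLikeNormedField]
    exact (WithTop.coe_le_coe.2 le_top : ((2 : ℕ∞) : WithTop ℕ∞) ≤ _))).eq _ _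

variable (C O) in
/-- All partial derivatives of a function. -/
noncomputable def grad : Derivation ℝ (C.Tame O) (ι →₀ C.Tame O) :=
  Derivation.mk'
    { toFun := fun f => Finsupp.ofSupportFinite (fun a => C.pd O a f) (by
        obtain ⟨c, hc⟩ := Tame.exists_factors f
        refine c.finite_toSet.subset fun a ha => ?_
        by_contra h
        exact ha (pd_eq_zero hc h))
      map_add' := fun f g => by
        ext1 a
        exact map_add (C.pd O a) f g
      map_smul' := fun r f => by
        ext1 a
        exact (C.pd O a).map_smul r f }
    (fun f g => by
      ext1 a
      exact (C.pd O a).leibniz f g)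

variable (C) in
/-- The derivation given by a vector field with components `Y`. -/
noncomputable def lie (Y : ι → C.Tame O) : Derivation ℝ (C.Tame O) (C.Tame O) :=
  (Finsupp.linearCombination (C.Tame O) Y).compDer (C.grad O)

theorem grad_support_subset {f : C.Tame O} (hc : C.Factors O c f.1) : (C.grad O f).support ⊆ c := by
  intro a ha
  by_contra h
  exact Finsupp.mem_support_iff.1 ha (pd_eq_zero hc h)

theorem lie_apply (Y : ι → C.Tame O) {f : C.Tame O} (hc : C.Factors O c f.1) :
    C.lie Y f = ∑ a ∈ c, C.pd O a f * Y a := by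
  change Finsupp.linearCombination (C.Tame O) Y (C.grad O f) = _
  rw [Finsupp.linearCombination_apply,
    Finsupp.sum_of_support_subset _ (grad_support_subset hc) _ (by simp)]
  rfl

/-- A vector field acts as the derivative along its value at a point. -/
theorem lie_apply_hasLineDerivAt (Y : ι → C.Tame O) (f : C.Tame O) {F : X → ℝ}
    (hF : ∀ z : O, F z = f.1 z) (z : O) (v : X) (hv : ∀ a, C.coord a v = (Y a).1 z) :
    HasLineDerivAt ℝ F ((C.lie Y f).1 z) z v := by
  obtain ⟨c, φ, h1, h2⟩ := Tame.exists_factors f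
  rw [lie_apply Y ⟨φ, h1, h2⟩]
  have h3 := hasLineDerivAt_of_factors h1 (F := F) (fun z hz => by rw [hF ⟨z, hz⟩, h2]) z.2 v
  convert! h3 using 1
  rw [C.proj_eq_sum c v, map_sum]
  simp only [map_smul]
  have : ∀ s : Finset ι, (∑ a ∈ s, C.pd O a f * Y a : C.Tame O).1 z =
      ∑ a ∈ s, (C.pd O a f).1 z * (Y a).1 z := by
    classical
    intro s
    induction s using Finset.induction_on with
    | empty => rfl
    | insert a s ha ih => rw [Finset.sum_insert ha, Finset.sum_insert ha, ← ih]; rfl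
  rw [this]
  refine Finset.sum_congr rfl fun a _ => ?_
  rw [hv, smul_eq_mul, mul_comm]
  congr 1
  exact partialFun_eq h1 h2 a z

/-- The second-order terms are symmetric and cancel, so the commutator is again given by a vector
field. -/
theorem lie_sub_lie (Y Z : ι → C.Tame O) {f : C.Tame O} (hc : C.Factors O c f.1) :
    C.lie Y (C.lie Z f) - C.lie Z (C.lie Y f) =
      ∑ a ∈ c, C.pd O a f * (C.lie Y (Z a) - C.lie Z (Y a)) := by
  have key : ∀ Y Z : ι → C.Tame O, C.lie Y (C.lie Z f) =
      ∑ a ∈ c, C.pd O a f * C.lie Y (Z a) +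
      ∑ a ∈ c, ∑ b ∈ c, C.pd O b (C.pd O a f) * Y b * Z a := by
    intro Y Z
    rw [lie_apply Z hc, map_sum, ← Finset.sum_add_distrib]
    refine Finset.sum_congr rfl fun a _ => ?_
    rw [Derivation.leibniz, smul_eq_mul, smul_eq_mul, lie_apply Y (pd_factors hc a),
      Finset.mul_sum]
    congr 1
    exact Finset.sum_congr rfl fun b _ => by ring
  rw [key Y Z, key Z Y]
  have : ∑ a ∈ c, ∑ b ∈ c, C.pd O b (C.pd O a f) * Y b * Z a =
      ∑ a ∈ c, ∑ b ∈ c, C.pd O b (C.pd O a f) * Z b * Y a := by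
    rw [Finset.sum_comm]
    refine Finset.sum_congr rfl fun a _ => Finset.sum_congr rfl fun b _ => ?_
    rw [pd_comm a b]
    ring
  rw [this]
  simp only [mul_sub, Finset.sum_sub_distrib]
  ring

/-- Commutation needs to be checked only on the components. Every commutation relation of the total
derivatives is proved through this. -/
theorem lie_comm {Y Z : ι → C.Tame O} (h : ∀ a, C.lie Y (Z a) = C.lie Z (Y a)) (f : C.Tame O) :
    C.lie Y (C.lie Z f) = C.lie Z (C.lie Y f) := by
  obtain ⟨c, hc⟩ := Tame.exists_factors f
  rw [← sub_eq_zero, lie_sub_lie Y Z hc]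
  simp [h]

variable (C O) in
/-- A coordinate as a function. -/
def coordFun (a : ι) : C.Tame O :=
  ⟨fun z => C.coord a z, {a}, fun y => y ⟨a, Finset.mem_singleton_self a⟩,
    (contDiff_apply ℝ ℝ _).contDiffOn, fun _ => rfl⟩

theorem lie_coordFun (Y : ι → C.Tame O) (a : ι) : C.lie Y (C.coordFun O a) = Y a := by
  have hc : C.Factors O {a} (C.coordFun O a).1 :=
    ⟨fun y => y ⟨a, Finset.mem_singleton_self a⟩, (contDiff_apply ℝ ℝ _).contDiffOn, fun _ => rfl⟩
  rw [lie_apply Y hc, Finset.sum_singleton]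
  have : C.pd O a (C.coordFun O a) = 1 := by
    ext z
    refine HasLineDerivAt.lineDeriv ?_
    have h := hasLineDerivAt_of_factors (C := C) (O := O) (c := {a})
      (φ := fun y => y ⟨a, Finset.mem_singleton_self a⟩) (contDiff_apply ℝ ℝ _).contDiffOn
      (F := Function.extend Subtype.val (C.coordFun O a).1 0)
      (fun z hz => extend_apply _ hz) z.2 (C.vec a)
    convert! h using 1
    have h2 : fderiv ℝ (fun y : ({a} : Finset ι) → ℝ => y ⟨a, Finset.mem_singleton_self a⟩)
        (C.proj {a} z) = ContinuousLinearMap.proj ⟨a, Finset.mem_singleton_self a⟩ :=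
      (ContinuousLinearMap.proj (R := ℝ) (φ := fun _ : ({a} : Finset ι) => ℝ)
        ⟨a, Finset.mem_singleton_self a⟩).fderiv
    rw [h2]
    exact (C.coord_vec_self a).symm
  rw [this, one_mul]

end CoordSystem

end TameFunctions

end ConsLaw

/-! ### Pullbacks and vector fields along a map. -/

namespace ConsLaw

open TopologicalSpace CoordSystem

/-- A map between open sets all of whose coordinates are smooth functions of finitely many
coordinates. -/
structure TameMap {ι' X' ι X : Type*} [AddCommGroup X'] [Module ℝ X'] [TopologicalSpace X']
    [AddCommGroup X] [Module ℝ X] [TopologicalSpace X] (C' : CoordSystem ι' X') (O' : Opens X')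
    (C : CoordSystem ι X) (O : Opens X) where
  toFun : O' → O
  comp : ι → C'.Tame O'
  comp_eq : ∀ a z, C.coord a (toFun z) = (comp a).1 z

namespace TameMap

variable {ι' X' ι X : Type*} [AddCommGroup X'] [Module ℝ X'] [TopologicalSpace X']
  [IsTopologicalAddGroup X'] [ContinuousSMul ℝ X']
  [AddCommGroup X] [Module ℝ X] [TopologicalSpace X]
  [IsTopologicalAddGroup X] [ContinuousSMul ℝ X]
  {C' : CoordSystem ι' X'} {O' : Opens X'} {C : CoordSystem ι X} {O : Opens X}
  (H : TameMap C' O' C O)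

theorem proj_toFun (c : Finset ι) (z : O') :
    C.proj c (H.toFun z) = fun a : c => (H.comp a).1 z := by
  ext a
  exact H.comp_eq a z

/-- `f` depends on finitely many components of the map and each of these on finitely many
coordinates; the union of these sets serves for the composite. -/
theorem comp_mem (f : C.Tame O) : (fun z => f.1 (H.toFun z)) ∈ C'.tame O' := by
  classical
  obtain ⟨c, φ, h1, h2⟩ := Tame.exists_factors f
  choose d hd using fun a => Tame.exists_factors (H.comp a)
  choose h hh1 hh2 using fun a : c => (hd a).mono (Finset.subset_biUnion_of_mem d a.2)
  have hmap : ∀ z : O', (fun a : c => h a (C'.proj (c.biUnion d) z)) = C.proj c (H.toFun z) := by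
    intro z
    rw [H.proj_toFun]
    ext a
    exact (hh2 a z).symm
  refine ⟨c.biUnion d, fun y => φ fun a => h a y, h1.comp (contDiffOn_pi.2 hh1) ?_, fun z => ?_⟩
  · rintro _ ⟨z, hz, rfl⟩
    exact ⟨_, (H.toFun ⟨z, hz⟩).2, (hmap ⟨z, hz⟩).symm⟩
  · exact (h2 _).trans (congrArg φ (hmap z).symm)

/-- Composition with a tame map. -/
def pullback : C.Tame O →ₐ[ℝ] C'.Tame O' where
  toFun f := ⟨fun z => f.1 (H.toFun z), H.comp_mem f⟩
  map_one' := rfl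
  map_mul' _ _ := rfl
  map_zero' := rfl
  map_add' _ _ := rfl
  commutes' _ := rfl

@[simp] theorem pullback_apply (f : C.Tame O) (z : O') :
    (H.pullback f).1 z = f.1 (H.toFun z) := rfl

theorem pullback_coordFun (a : ι) : H.pullback (C.coordFun O a) = H.comp a := by
  ext z
  exact H.comp_eq a z

theorem sum_val {κ : Type*} (s : Finset κ) (f : κ → C.Tame O) (z : O) :
    (∑ k ∈ s, f k).1 z = ∑ k ∈ s, (f k).1 z := by
  classical
  induction s using Finset.induction_on with
  | empty => rfl
  | insert a s ha ih => rw [Finset.sum_insert ha, Finset.sum_insert ha, ← ih]; rfl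

theorem pd_pullback {f : C.Tame O} {c : Finset ι} (hc : C.Factors O c f.1) (b : ι') :
    C'.pd O' b (H.pullback f) = ∑ a ∈ c, H.pullback (C.pd O a f) * C'.pd O' b (H.comp a) := by
  classical
  obtain ⟨φ, h1, h2⟩ := hc
  ext z
  refine HasLineDerivAt.lineDeriv ?_
  have hd : DifferentiableAt ℝ φ (C.proj c (H.toFun z)) :=
    (h1.contDiffAt ((C.isOpen_image_proj c O.isOpen).mem_nhds
      ⟨_, (H.toFun z).2, rfl⟩)).differentiableAt (by simp)
  let y : ℝ → c → ℝ := fun t a => Function.extend Subtype.val (H.comp a).1 0 (z.1 + t • C'.vec b)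
  have hy0 : y 0 = C.proj c (H.toFun z) := by
    rw [H.proj_toFun]
    ext a
    simp only [y, zero_smul, add_zero, extend_apply _ z.2]
  have hy : HasDerivAt y (fun a => (C'.pd O' b (H.comp a)).1 z) 0 :=
    hasDerivAt_pi.2 fun a => hasLineDerivAt_extend (H.comp a) z b
  rw [← hy0] at hd
  have h3 := hd.hasFDerivAt.comp_hasDerivAt 0 hy
  have h4 : HasDerivAt (fun t : ℝ => Function.extend Subtype.val (H.pullback f).1 0
      (z.1 + t • C'.vec b)) (fderiv ℝ φ (y 0) fun a => (C'.pd O' b (H.comp a)).1 z) 0 := by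
    refine h3.congr_of_eventuallyEq ?_
    have hcont : Continuous fun t : ℝ => z.1 + t • C'.vec b := by fun_prop
    have := hcont.continuousAt.preimage_mem_nhds (x := (0 : ℝ))
      (O'.isOpen.mem_nhds (by simpa using z.2))
    filter_upwards [this] with t ht
    have ht' : z.1 + t • C'.vec b ∈ O' := ht
    rw [extend_apply _ ht', pullback_apply, h2, H.proj_toFun]
    simp only [Function.comp, y, extend_apply _ ht']
  have h5 : (∑ a ∈ c, H.pullback (C.pd O a f) * C'.pd O' b (H.comp a) : C'.Tame O').1 z =
      fderiv ℝ φ (y 0) fun a => (C'.pd O' b (H.comp a)).1 z := by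
    rw [sum_val, ← Finset.sum_coe_sort]
    have h6 : (fun a : c => (C'.pd O' b (H.comp a)).1 z) =
        ∑ a : c, (C'.pd O' b (H.comp a)).1 z • C.proj c (C.vec a) := by
      have h7 : ∀ a : c, C.proj c (C.vec a) = Pi.single a 1 := fun a => C.proj_vec_of_mem a.2
      ext a
      simp [h7, Pi.single_apply]
    rw [h6, map_sum]
    refine Finset.sum_congr rfl fun a _ => ?_
    have : (H.pullback (C.pd O a f)).1 z = fderiv ℝ φ (C.proj c (H.toFun z)) (C.proj c (C.vec a)) :=
      partialFun_eq h1 h2 a _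
    change (H.pullback (C.pd O a f)).1 z * (C'.pd O' b (H.comp a)).1 z = _
    rw [this, map_smul, smul_eq_mul, mul_comm, hy0]
  exact h5 ▸ h4

/-- The derivation along the map `H` given by a vector field with components `Y` along `H`. -/
noncomputable def along (Y : ι → C'.Tame O') : C.Tame O →+ C'.Tame O' :=
  (Finsupp.liftAddHom fun a =>
    (AddMonoidHom.mulRight (Y a)).comp (H.pullback : C.Tame O →+ C'.Tame O')).comp
    ((C.grad O : C.Tame O →ₗ[ℝ] ι →₀ C.Tame O) : C.Tame O →+ ι →₀ C.Tame O)

theorem along_apply (Y : ι → C'.Tame O') {f : C.Tame O} {c : Finset ι} (hc : C.Factors O c f.1) :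
    H.along Y f = ∑ a ∈ c, H.pullback (C.pd O a f) * Y a := by
  change Finsupp.liftAddHom _ (C.grad O f) = _
  rw [Finsupp.liftAddHom_apply,
    Finsupp.sum_of_support_subset _ (grad_support_subset hc) _ (by simp)]
  rfl

theorem along_coordFun (Y : ι → C'.Tame O') (a : ι) : H.along Y (C.coordFun O a) = Y a := by
  classical
  have hc : C.Factors O {a} (C.coordFun O a).1 :=
    ⟨fun y => y ⟨a, Finset.mem_singleton_self a⟩, (contDiff_apply ℝ ℝ _).contDiffOn, fun _ => rfl⟩
  rw [H.along_apply Y hc, Finset.sum_singleton]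
  have := lie_coordFun (C := C) (O := O) (Pi.single a 1) a
  rw [lie_apply _ hc, Finset.sum_singleton, Pi.single_eq_same, mul_one] at this
  rw [this, map_one, one_mul]

theorem lie_pullback (Y : ι' → C'.Tame O') (f : C.Tame O) :
    C'.lie Y (H.pullback f) = H.along (fun a => C'.lie Y (H.comp a)) f := by
  classical
  obtain ⟨c, hc⟩ := Tame.exists_factors f
  choose d hd using fun a => Tame.exists_factors (H.comp a)
  obtain ⟨d', hd'⟩ := Tame.exists_factors (H.pullback f)
  let e := d' ∪ c.biUnion d
  have he : ∀ a ∈ c, C'.Factors O' e (H.comp a).1 := fun a ha =>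
    (hd a).mono ((Finset.subset_biUnion_of_mem d ha).trans Finset.subset_union_right)
  rw [lie_apply Y (hd'.mono (Finset.subset_union_left : d' ⊆ e)), H.along_apply _ hc]
  simp only [H.pd_pullback hc, Finset.sum_mul]
  rw [Finset.sum_comm]
  refine Finset.sum_congr rfl fun a ha => ?_
  rw [lie_apply Y (he a ha), Finset.mul_sum]
  exact Finset.sum_congr rfl fun b _ => mul_assoc _ _ _

theorem along_pullback (Z : ι → C.Tame O) (f : C.Tame O) :
    H.along (fun a => H.pullback (Z a)) f = H.pullback (C.lie Z f) := by
  obtain ⟨c, hc⟩ := Tame.exists_factors f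
  rw [H.along_apply _ hc, lie_apply _ hc, map_sum]
  simp

theorem along_add (Y Y' : ι → C'.Tame O') (f : C.Tame O) :
    H.along (fun a => Y a + Y' a) f = H.along Y f + H.along Y' f := by
  obtain ⟨c, hc⟩ := Tame.exists_factors f
  simp only [H.along_apply _ hc, mul_add, Finset.sum_add_distrib]

/-- Related vector fields. -/
theorem lie_pullback_of_related {Y : ι' → C'.Tame O'} {Z : ι → C.Tame O}
    (h : ∀ a, C'.lie Y (H.comp a) = H.pullback (Z a)) (f : C.Tame O) :
    C'.lie Y (H.pullback f) = H.pullback (C.lie Z f) := by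
  rw [H.lie_pullback, ← H.along_pullback]
  simp only [h]

/-- The product rule for the components and the partial derivatives separately; symmetry of second
partials turns the second part into derivatives along `Z`. -/
theorem along_lie (Y : ι → C'.Tame O') (Z : ι → C.Tame O) {f : C.Tame O} {c : Finset ι}
    (hc : C.Factors O c f.1) :
    H.along Y (C.lie Z f) = ∑ a ∈ c, H.pullback (C.pd O a f) * H.along Y (Z a) +
      ∑ a ∈ c, H.pullback (C.lie Z (C.pd O a f)) * Y a := by
  classical
  choose d hd using fun a => Tame.exists_factors (Z a)
  let e := c ∪ c.biUnion d
  have hZ : ∀ a ∈ c, C.Factors O e (Z a).1 := fun a ha =>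
    (hd a).mono ((Finset.subset_biUnion_of_mem d ha).trans Finset.subset_union_right)
  have hce : C.Factors O e f.1 := hc.mono Finset.subset_union_left
  rw [lie_apply Z hc, map_sum]
  have h1 : ∀ a ∈ c, H.along Y (C.pd O a f * Z a) =
      H.pullback (C.pd O a f) * H.along Y (Z a) + H.along Y (C.pd O a f) * H.pullback (Z a) := by
    intro a ha
    have hprod : C.Factors O e (C.pd O a f * Z a).1 := by
      obtain ⟨φ, p1, p2⟩ := pd_factors hce a
      obtain ⟨ψ, p3, p4⟩ := hZ a ha
      exact ⟨fun y => φ y * ψ y, p1.mul p3, fun z => congrArg₂ (· * ·) (p2 z) (p4 z)⟩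
    rw [H.along_apply Y hprod, H.along_apply Y (hZ a ha), H.along_apply Y (pd_factors hce a),
      Finset.mul_sum, Finset.sum_mul, ← Finset.sum_add_distrib]
    refine Finset.sum_congr rfl fun b _ => ?_
    rw [Derivation.leibniz, smul_eq_mul, smul_eq_mul, map_add, map_mul, map_mul]
    ring
  rw [Finset.sum_congr rfl h1, Finset.sum_add_distrib]
  congr 1
  simp only [H.along_apply Y (pd_factors hc _), lie_apply Z (pd_factors hc _), map_sum, map_mul,
    Finset.sum_mul]
  rw [Finset.sum_comm]
  refine Finset.sum_congr rfl fun a _ => Finset.sum_congr rfl fun b _ => ?_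
  rw [pd_comm a b]
  ring

theorem lie_along {Y : ι → C'.Tame O'} (W : ι' → C'.Tame O') {f : C.Tame O} {c : Finset ι}
    (hc : C.Factors O c f.1) :
    C'.lie W (H.along Y f) = ∑ a ∈ c, H.pullback (C.pd O a f) * C'.lie W (Y a) +
      ∑ a ∈ c, C'.lie W (H.pullback (C.pd O a f)) * Y a := by
  rw [H.along_apply Y hc, map_sum, ← Finset.sum_add_distrib]
  refine Finset.sum_congr rfl fun a _ => ?_
  rw [Derivation.leibniz, smul_eq_mul, smul_eq_mul]
  ring

/-- Linearisation commutes with related vector fields. -/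
theorem lie_along_of_related {Y : ι → C'.Tame O'} {W : ι' → C'.Tame O'} {Z : ι → C.Tame O}
    (h : ∀ a, C'.lie W (H.comp a) = H.pullback (Z a)) (hY : ∀ a, C'.lie W (Y a) = H.along Y (Z a))
    (f : C.Tame O) : C'.lie W (H.along Y f) = H.along Y (C.lie Z f) := by
  obtain ⟨c, hc⟩ := Tame.exists_factors f
  rw [H.lie_along W hc, H.along_lie Y Z hc]
  simp only [hY, H.lie_pullback_of_related h]

/-- Symmetry of the second linearisation. -/
theorem sum_along_pd_comm (Y Y' : ι → C'.Tame O') {f : C.Tame O} {c : Finset ι}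
    (hc : C.Factors O c f.1) :
    ∑ a ∈ c, H.along Y (C.pd O a f) * Y' a = ∑ a ∈ c, H.along Y' (C.pd O a f) * Y a := by
  simp only [H.along_apply _ (pd_factors hc _), Finset.sum_mul]
  rw [Finset.sum_comm]
  refine Finset.sum_congr rfl fun a _ => Finset.sum_congr rfl fun b _ => ?_
  rw [pd_comm a b]
  ring

end TameMap

end ConsLaw

namespace ConsLaw

open TopologicalSpace CoordSystem MeasureTheory

/-! ### Smooth dependence of an integral over [0, 1] on parameters. -/

section ParametricIntegral

/-- The derivative is bounded on the compact segment over `x`. The tube lemma extends membership in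
`W` and the bound, enlarged by one, to a neighbourhood of `x`, so differentiation under the integral
is justified by a constant bound. -/
theorem hasFDerivAt_parametric_integral {E F : Type} [NormedAddCommGroup E] [NormedSpace ℝ E]
    [NormedAddCommGroup F] [NormedSpace ℝ F] [CompleteSpace F] {W : Set (ℝ × E)} (hW : IsOpen W)
    {f : ℝ × E → F} (hf : ContDiffOn ℝ 1 f W) {x : E} (hx : ∀ s ∈ Set.Icc (0 : ℝ) 1, (s, x) ∈ W) :
    HasFDerivAt (fun y => ∫ s in (0 : ℝ)..1, f (s, y))
      (∫ s in (0 : ℝ)..1, (fderiv ℝ f (s, x)).comp (ContinuousLinearMap.inr ℝ ℝ E)) x := by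
  let f' : ℝ × E → E →L[ℝ] F := fun p => (fderiv ℝ f p).comp (ContinuousLinearMap.inr ℝ ℝ E)
  have hf' : ContinuousOn f' W :=
    (hf.continuousOn_fderiv_of_isOpen hW le_rfl).clm_comp continuousOn_const
  have hK : IsCompact (Set.Icc (0 : ℝ) 1 ×ˢ ({x} : Set E)) := isCompact_Icc.prod isCompact_singleton
  have hKW : Set.Icc (0 : ℝ) 1 ×ˢ ({x} : Set E) ⊆ W := by
    rintro ⟨s, y⟩ ⟨hs, hy⟩
    obtain rfl : y = x := hy
    exact hx s hs
  obtain ⟨M, hM⟩ := hK.exists_bound_of_continuousOn (hf'.mono hKW)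
  have hV : IsOpen (W ∩ f' ⁻¹' Metric.ball 0 (M + 1)) :=
    hf'.isOpen_inter_preimage hW Metric.isOpen_ball
  obtain ⟨u, v, -, hv, hu1, hv1, huv⟩ := generalized_tube_lemma isCompact_Icc
    (isCompact_singleton (x := x)) hV (fun p hp => ⟨hKW hp, by
      simpa using lt_of_le_of_lt (hM p hp) (lt_add_one M)⟩)
  have hvx : v ∈ nhds x := hv.mem_nhds (hv1 rfl)
  have hsub : Set.uIoc (0 : ℝ) 1 ⊆ Set.Icc 0 1 := by
    rw [Set.uIoc_of_le zero_le_one]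
    exact Set.Ioc_subset_Icc_self
  have hmem : ∀ s ∈ Set.Icc (0 : ℝ) 1, ∀ y ∈ v, (s, y) ∈ W ∩ f' ⁻¹' Metric.ball 0 (M + 1) :=
    fun s hs y hy => huv ⟨hu1 hs, hy⟩
  have hcont : ∀ y ∈ v, ContinuousOn (fun s => f (s, y)) (Set.Icc 0 1) := fun y hy =>
    hf.continuousOn.comp (by fun_prop) fun s hs => (hmem s hs y hy).1
  have hcont' : ContinuousOn (fun s => f' (s, x)) (Set.Icc 0 1) :=
    hf'.comp (by fun_prop) fun s hs => hx s hs
  refine intervalIntegral.hasFDerivAt_integral_of_dominated_of_fderiv_le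
    (F := fun y s => f (s, y)) (F' := fun y s => f' (s, y)) (bound := fun _ => M + 1) hvx ?_ ?_ ?_ ?_
    ?_ ?_
  · filter_upwards [hvx] with y hy
    exact ((hcont y hy).mono hsub).aestronglyMeasurable measurableSet_uIoc
  · refine ContinuousOn.intervalIntegrable ?_
    rw [Set.uIcc_of_le zero_le_one]
    exact hcont x (mem_of_mem_nhds hvx)
  · exact (hcont'.mono hsub).aestronglyMeasurable measurableSet_uIoc
  · refine Filter.Eventually.of_forall fun s hs y hy => ?_
    have := (hmem s (hsub hs) y hy).2
    exact (by simpa using this : ‖f' (s, y)‖ < M + 1).le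
  · exact intervalIntegrable_const
  · refine Filter.Eventually.of_forall fun s hs y hy => ?_
    have hd : DifferentiableAt ℝ f (s, y) :=
      (hf.contDiffAt (hW.mem_nhds (hmem s (hsub hs) y hy).1)).differentiableAt (by simp)
    exact hd.hasFDerivAt.comp y (hasFDerivAt_prodMk_right s y)

/-- Induction on `k` with the target space generalised, since the derivative is an integral of the
same kind with values in linear maps. -/
theorem contDiffOn_parametric_integral_nat (k : ℕ) {E : Type} [NormedAddCommGroup E]
    [NormedSpace ℝ E] {W : Set (ℝ × E)} (hW : IsOpen W) {U : Set E} (hU : IsOpen U)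
    (hUW : ∀ x ∈ U, ∀ s ∈ Set.Icc (0 : ℝ) 1, (s, x) ∈ W) {F : Type} [NormedAddCommGroup F]
    [NormedSpace ℝ F] [CompleteSpace F] {f : ℝ × E → F} (hf : ContDiffOn ℝ ∞ f W) :
    ContDiffOn ℝ k (fun y => ∫ s in (0 : ℝ)..1, f (s, y)) U := by
  have h1 : ContDiffOn ℝ 1 f W := hf.of_le (by exact_mod_cast le_top)
  induction k generalizing F with
  | zero =>
    rw [Nat.cast_zero, contDiffOn_zero]
    exact fun x hx =>
      (hasFDerivAt_parametric_integral hW h1 (hUW x hx)).continuousAt.continuousWithinAt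
  | succ k ih =>
    rw [Nat.cast_succ, contDiffOn_succ_iff_fderiv_of_isOpen hU]
    refine ⟨fun x hx => (hasFDerivAt_parametric_integral hW h1
      (hUW x hx)).differentiableAt.differentiableWithinAt, by simp, ?_⟩
    have h2 : ContDiffOn ℝ ∞
        (fun p => (fderiv ℝ f p).comp (ContinuousLinearMap.inr ℝ ℝ E)) W :=
      (hf.fderiv_of_isOpen hW (m := ∞) (by simp)).clm_comp contDiffOn_const
    refine (ih h2 (h2.of_le (by exact_mod_cast le_top))).congr fun x hx => ?_
    exact (hasFDerivAt_parametric_integral hW h1 (hUW x hx)).fderiv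

theorem contDiffOn_parametric_integral {E : Type} [NormedAddCommGroup E]
    [NormedSpace ℝ E] {W : Set (ℝ × E)} (hW : IsOpen W) {U : Set E} (hU : IsOpen U)
    (hUW : ∀ x ∈ U, ∀ s ∈ Set.Icc (0 : ℝ) 1, (s, x) ∈ W) {F : Type} [NormedAddCommGroup F]
    [NormedSpace ℝ F] [CompleteSpace F] {f : ℝ × E → F} (hf : ContDiffOn ℝ ∞ f W) :
    ContDiffOn ℝ ∞ (fun y => ∫ s in (0 : ℝ)..1, f (s, y)) U :=
  contDiffOn_infty.2 fun k => contDiffOn_parametric_integral_nat k hW hU hUW hf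

end ParametricIntegral

/-! ### Integration over an additional parameter coordinate. -/

section TameIntegral

variable {ι X : Type} [AddCommGroup X] [Module ℝ X] [TopologicalSpace X]
  [IsTopologicalAddGroup X] [ContinuousSMul ℝ X] (C : CoordSystem ι X)

/-- Coordinates on `ℝ × X`, with a parameter as an additional coordinate. -/
def CoordSystem.withParam : CoordSystem (Option ι) (ℝ × X) where
  coord := fun a => a.elim (ContinuousLinearMap.fst ℝ ℝ X) fun i =>
    (C.coord i).comp (ContinuousLinearMap.snd ℝ ℝ X)
  vec := fun a => a.elim (1, 0) fun i => (0, C.vec i)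
  coord_vec_self := by
    rintro (_ | i)
    · rfl
    · exact C.coord_vec_self i
  coord_vec_ne := by
    rintro (_ | i) (_ | j) h
    · exact absurd rfl h
    · rfl
    · exact map_zero (C.coord i)
    · exact C.coord_vec_ne i j fun h' => h (by rw [h'])

variable {C} {O : Opens X} {O' : Opens (ℝ × X)}

theorem CoordSystem.Tame.continuousOn (f : C.Tame O) :
    ContinuousOn (Function.extend Subtype.val f.1 0) O := by
  obtain ⟨c, φ, h1, h2⟩ := Tame.exists_factors f
  refine (h1.continuousOn.comp (C.proj c).continuous.continuousOn
    (Set.mapsTo_image _ _)).congr fun z hz => ?_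
  rw [extend_apply _ hz, h2]
  rfl

variable (hO : ∀ z ∈ O, ∀ s ∈ Set.Icc (0 : ℝ) 1, (s, z) ∈ O')

include hO in
theorem intervalIntegrable_slice (f : C.withParam.Tame O') {z : X} (hz : z ∈ O) :
    IntervalIntegrable (fun s => Function.extend Subtype.val f.1 0 (s, z)) volume 0 1 := by
  refine ContinuousOn.intervalIntegrable ?_
  rw [Set.uIcc_of_le zero_le_one]
  exact (Tame.continuousOn f).comp (by fun_prop) fun s hs => hO z hz s hs

/-- Insert the parameter into a point of coordinate space. -/
noncomputable def paramInsert (c : Finset ι) :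
    ℝ × (c → ℝ) →L[ℝ] (Finset.insertNone c → ℝ) :=
  ContinuousLinearMap.pi fun a =>
    match a with
    | ⟨none, _⟩ => ContinuousLinearMap.fst ℝ ℝ (c → ℝ)
    | ⟨some i, h⟩ => (ContinuousLinearMap.proj (R := ℝ) (φ := fun _ : c => ℝ)
        ⟨i, Finset.some_mem_insertNone.1 h⟩).comp (ContinuousLinearMap.snd ℝ ℝ (c → ℝ))

theorem paramInsert_proj (c : Finset ι) (s : ℝ) (z : X) :
    paramInsert c (s, C.proj c z) = C.withParam.proj (Finset.insertNone c) (s, z) := by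
  ext ⟨a, ha⟩
  cases a <;> rfl

theorem exists_factors_insertNone (f : C.withParam.Tame O') :
    ∃ c : Finset ι, C.withParam.Factors O' (Finset.insertNone c) f.1 := by
  obtain ⟨c, hc⟩ := Tame.exists_factors f
  refine ⟨Finset.eraseNone c, hc.mono fun a ha => ?_⟩
  cases a with
  | none => exact Finset.none_mem_insertNone
  | some i => exact Finset.some_mem_insertNone.2 (Finset.mem_eraseNone.2 ha)

variable {c : Finset ι} {φ : (Finset.insertNone c → ℝ) → ℝ}
  (hφ : ContDiffOn ℝ ∞ φ (C.withParam.proj (Finset.insertNone c) '' O'))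

include hφ hO in
theorem hasFDerivAt_integral_of_factors {z : X} (hz : z ∈ O) :
    HasFDerivAt (fun y => ∫ s in (0 : ℝ)..1, φ (paramInsert c (s, y)))
      (∫ s in (0 : ℝ)..1, (fderiv ℝ (fun p => φ (paramInsert c p)) (s, C.proj c z)).comp
        (ContinuousLinearMap.inr ℝ ℝ (c → ℝ))) (C.proj c z) := by
  have hW := (C.withParam.isOpen_image_proj (Finset.insertNone c) O'.isOpen).preimage
    (paramInsert c).continuous
  refine hasFDerivAt_parametric_integral (f := fun p => φ (paramInsert c p)) hW
    ((hφ.comp (paramInsert c).contDiff.contDiffOn fun p hp => hp).of_le (by exact_mod_cast le_top)) ?_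
  intro s hs
  exact ⟨(s, z), hO z hz s hs, (paramInsert_proj c s z).symm⟩

include hφ hO in
theorem contDiffOn_integral_of_factors :
    ContDiffOn ℝ ∞ (fun y => ∫ s in (0 : ℝ)..1, φ (paramInsert c (s, y))) (C.proj c '' O) := by
  have hW := (C.withParam.isOpen_image_proj (Finset.insertNone c) O'.isOpen).preimage
    (paramInsert c).continuous
  refine contDiffOn_parametric_integral (f := fun p => φ (paramInsert c p)) hW
    (C.isOpen_image_proj c O.isOpen) ?_ (hφ.comp (paramInsert c).contDiff.contDiffOn fun p hp => hp)
  rintro _ ⟨z, hz, rfl⟩ s hs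
  exact ⟨(s, z), hO z hz s hs, (paramInsert_proj c s z).symm⟩

include hO in
theorem integral_eq_of_factors {f : O' → ℝ}
    (hf : ∀ z : O', f z = φ (C.withParam.proj (Finset.insertNone c) z)) {z : X} (hz : z ∈ O) :
    ∫ s in (0 : ℝ)..1, Function.extend Subtype.val f 0 (s, z) =
      ∫ s in (0 : ℝ)..1, φ (paramInsert c (s, C.proj c z)) := by
  refine intervalIntegral.integral_congr fun s hs => ?_
  rw [Set.uIcc_of_le zero_le_one] at hs
  rw [extend_apply _ (hO z hz s hs), hf, paramInsert_proj]

/-- Integration over the parameter. -/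
noncomputable def tameIntegral : C.withParam.Tame O' →ₗ[ℝ] C.Tame O where
  toFun f := ⟨fun z => ∫ s in (0 : ℝ)..1, Function.extend Subtype.val f.1 0 (s, z.1), by
    obtain ⟨c, φ, h1, h2⟩ := exists_factors_insertNone f
    exact ⟨c, _, contDiffOn_integral_of_factors hO h1,
      fun z => integral_eq_of_factors hO h2 z.2⟩⟩
  map_add' f g := by
    ext z
    refine (intervalIntegral.integral_congr fun s _ => ?_).trans
      (intervalIntegral.integral_add (intervalIntegrable_slice hO f z.2)
        (intervalIntegrable_slice hO g z.2))
    exact extend_map₂ f.1 g.1 (· + ·) (by simp) _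
  map_smul' r f := by
    ext z
    refine (intervalIntegral.integral_congr fun s _ => ?_).trans
      (intervalIntegral.integral_const_mul r _)
    exact extend_map₂ f.1 f.1 (fun x _ => r * x) (by simp) _

theorem tameIntegral_apply (f : C.withParam.Tame O') (z : O) :
    (tameIntegral hO f).1 z = ∫ s in (0 : ℝ)..1, Function.extend Subtype.val f.1 0 (s, z.1) := rfl

theorem pd_tameIntegral (f : C.withParam.Tame O') (a : ι) :
    C.pd O a (tameIntegral hO f) = tameIntegral hO (C.withParam.pd O' (some a) f) := by
  obtain ⟨c, φ, h1, h2⟩ := exists_factors_insertNone f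
  ext z
  refine (partialFun_eq (contDiffOn_integral_of_factors hO h1)
    (fun z => integral_eq_of_factors hO h2 z.2) a z).trans ?_
  rw [(hasFDerivAt_integral_of_factors hO h1 z.2).fderiv, tameIntegral_apply]
  have hW := (C.withParam.isOpen_image_proj (Finset.insertNone c) O'.isOpen).preimage
    (paramInsert c).continuous
  have hψ : ContDiffOn ℝ ∞ (fun p => φ (paramInsert c p)) _ :=
    h1.comp (paramInsert c).contDiff.contDiffOn fun p hp => hp
  rw [ContinuousLinearMap.intervalIntegral_apply]
  · refine intervalIntegral.integral_congr fun s hs => ?_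
    rw [Set.uIcc_of_le zero_le_one] at hs
    have hmem := hO z z.2 s hs
    rw [extend_apply _ hmem]
    refine Eq.trans ?_ (partialFun_eq h1 h2 (some a) ⟨(s, z), hmem⟩).symm
    have hd : DifferentiableAt ℝ φ (paramInsert c (s, C.proj c z)) := by
      rw [paramInsert_proj]
      exact (h1.contDiffAt ((C.withParam.isOpen_image_proj _ O'.isOpen).mem_nhds
        ⟨_, hmem, rfl⟩)).differentiableAt (by simp)
    have := (hd.hasFDerivAt.comp (s, C.proj c z) (paramInsert c).hasFDerivAt).fderiv
    rw [Function.comp_def] at this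
    rw [this, paramInsert_proj, ContinuousLinearMap.comp_apply, ContinuousLinearMap.comp_apply,
      ContinuousLinearMap.inr_apply, paramInsert_proj]
    rfl
  · refine ContinuousOn.intervalIntegrable ?_
    rw [Set.uIcc_of_le zero_le_one]
    have hc : ContinuousOn (fderiv ℝ fun p => φ (paramInsert c p)) _ :=
      hψ.continuousOn_fderiv_of_isOpen hW (by simp)
    refine ContinuousOn.clm_comp (hc.comp (by fun_prop) fun s hs => ?_) continuousOn_const
    exact ⟨(s, z.1), hO z z.2 s hs, (paramInsert_proj c s z.1).symm⟩

/-- Functions constant in the parameter can be taken out of the integral. -/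
theorem tameIntegral_mul {y : C.Tame O} {y' : C.withParam.Tame O'}
    (h : ∀ z : O', ∀ hz : z.1.2 ∈ O, y'.1 z = y.1 ⟨z.1.2, hz⟩) (f : C.withParam.Tame O') :
    tameIntegral hO (f * y') = tameIntegral hO f * y := by
  ext z
  refine (intervalIntegral.integral_congr fun s hs => ?_).trans
    (intervalIntegral.integral_mul_const (y.1 z) _)
  rw [Set.uIcc_of_le zero_le_one] at hs
  have hmem := hO z z.2 s hs
  rw [extend_apply _ hmem, extend_apply _ hmem]
  exact congrArg _ (h ⟨(s, z), hmem⟩ z.2)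

/-- A field that does not move the parameter and whose components do not depend on it can be taken
under the integral. -/
theorem lie_tameIntegral {Y : ι → C.Tame O} {Y' : Option ι → C.withParam.Tame O'}
    (h0 : Y' none = 0)
    (h : ∀ a, ∀ z : O', ∀ hz : z.1.2 ∈ O, (Y' (some a)).1 z = (Y a).1 ⟨z.1.2, hz⟩)
    (f : C.withParam.Tame O') :
    C.lie Y (tameIntegral hO f) = tameIntegral hO (C.withParam.lie Y' f) := by
  obtain ⟨c, φ, h1, h2⟩ := exists_factors_insertNone f
  have hI : C.Factors O c (tameIntegral hO f).1 :=
    ⟨_, contDiffOn_integral_of_factors hO h1, fun z => integral_eq_of_factors hO h2 z.2⟩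
  rw [lie_apply Y hI, lie_apply Y' ⟨φ, h1, h2⟩]
  have : ∀ g : Option ι → C.withParam.Tame O', ∑ a ∈ Finset.insertNone c, g a =
      g none + ∑ a ∈ c, g (some a) := by
    intro g
    rw [Finset.sum_insertNone]
  rw [this, h0, mul_zero, zero_add, map_sum]
  refine Finset.sum_congr rfl fun a _ => ?_
  rw [tameIntegral_mul hO (h a), pd_tameIntegral]

/-- The fundamental theorem of calculus on each segment. -/
theorem tameIntegral_param_derivative (f : C.withParam.Tame O') {f₀ f₁ : C.Tame O}
    (h₀ : ∀ z : O, f₀.1 z = f.1 ⟨(0, z), hO z z.2 0 (by simp)⟩)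
    (h₁ : ∀ z : O, f₁.1 z = f.1 ⟨(1, z), hO z z.2 1 (by simp)⟩) :
    tameIntegral hO (C.withParam.pd O' none f) = f₁ - f₀ := by
  ext z
  rw [tameIntegral_apply, intervalIntegral.integral_eq_sub_of_hasDerivAt
    (f := fun s => Function.extend Subtype.val f.1 0 (s, z.1)) _
    (intervalIntegrable_slice hO _ z.2)]
  · rw [extend_apply _ (hO z z.2 0 (by simp)), extend_apply _ (hO z z.2 1 (by simp)), ← h₀, ← h₁]
    rfl
  · intro s hs
    rw [Set.uIcc_of_le zero_le_one] at hs
    have hmem := hO z z.2 s hs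
    rw [extend_apply _ hmem]
    have h := hasLineDerivAt_extend f ⟨(s, z), hmem⟩ none
    have h2 : HasDerivAt (fun t : ℝ => Function.extend Subtype.val f.1 0 ((s, z.1) + t • (1, 0)))
      ((C.withParam.pd O' none f).1 ⟨(s, z), hmem⟩) (s - s) := by
      rw [sub_self]
      exact h
    have h3 := h2.comp_sub_const s s
    refine h3.congr_of_eventuallyEq (Filter.Eventually.of_forall fun t => ?_)
    simp

end TameIntegral

end ConsLaw

namespace ConsLaw

/-! ### Multi-indices and ordered index tuples. -/

section Multinomial

open MvPolynomial

variable {n : ℕ}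

theorem mem_multiIndicesLE {k : ℕ} {J : MultiIndex n} : J ∈ multiIndicesLE n k ↔ ∑ i, J i ≤ k := by
  unfold multiIndicesLE
  rw [Finset.mem_filter, and_iff_right_iff_imp, Fintype.mem_piFinset]
  intro h i
  have := Finset.single_le_sum (f := J) (fun _ _ => Nat.zero_le _) (Finset.mem_univ i)
  rw [Finset.mem_range]
  omega

/-- Expanding the power enumerates ordered tuples; each contributes the monomial of its multi-index.
-/
theorem sum_monomial_listIndex (r : ℕ) :
    ∑ I : Fin r → Fin n, monomial (Finsupp.equivFunOnFinite.symm (listIndex (List.ofFn I))) 1 =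
      (∑ i, X i : MvPolynomial (Fin n) ℕ) ^ r := by
  induction r with
  | zero =>
    rw [sum_ofFn_zero fun L => monomial (Finsupp.equivFunOnFinite.symm (listIndex L)) 1, pow_zero]
    have : Finsupp.equivFunOnFinite.symm (listIndex ([] : List (Fin n))) = 0 := by
      ext a
      simp [listIndex]
    rw [this]
    rfl
  | succ r ih =>
    rw [sum_ofFn_succ r fun L => monomial (Finsupp.equivFunOnFinite.symm (listIndex L)) 1, pow_succ',
      ← ih, Finset.sum_mul_sum]
    refine Finset.sum_congr rfl fun i _ => Finset.sum_congr rfl fun I _ => ?_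
    have : Finsupp.equivFunOnFinite.symm (listIndex (i :: List.ofFn I)) =
        Finsupp.single i 1 + Finsupp.equivFunOnFinite.symm (listIndex (List.ofFn I)) := by
      ext a
      simp [listIndex_cons, Finsupp.single_apply, Pi.single_apply, add_comm, eq_comm]
    rw [X, monomial_mul, one_mul, this]

/-- Comparison of coefficients with the multinomial theorem. This count cancels the normalisation of
the symmetric derivatives. -/
theorem card_listIndex_eq (r : ℕ) (J : MultiIndex n) (hJ : ∑ i, J i = r) :
    (Finset.univ.filter fun I : Fin r → Fin n => listIndex (List.ofFn I) = J).card =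
      Nat.multinomial Finset.univ J := by
  have h1 := congrArg (coeff (Finsupp.equivFunOnFinite.symm J)) (sum_monomial_listIndex (n := n) r)
  rw [Finset.sum_pow_eq_sum_piAntidiag, coeff_sum, coeff_sum] at h1
  simp only [coeff_monomial, Equiv.apply_eq_iff_eq] at h1
  rw [Finset.sum_boole, Nat.cast_id] at h1
  rw [h1, Finset.sum_eq_single J]
  · have : ∏ i, (X i : MvPolynomial (Fin n) ℕ) ^ J i =
        monomial (Finsupp.equivFunOnFinite.symm J) 1 := by
      rw [monomial_eq, C_1, one_mul, Finsupp.prod_fintype _ _ (by simp)]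
      rfl
    rw [this, ← nsmul_eq_mul, coeff_smul, coeff_monomial, if_pos rfl, smul_eq_mul, mul_one]
  · intro K _ hK
    have : ∏ i, (X i : MvPolynomial (Fin n) ℕ) ^ K i =
        monomial (Finsupp.equivFunOnFinite.symm K) 1 := by
      rw [monomial_eq, C_1, one_mul, Finsupp.prod_fintype _ _ (by simp)]
      rfl
    rw [this, ← nsmul_eq_mul, coeff_smul, coeff_monomial, if_neg (by simpa using hK), smul_zero]
  · intro h
    exact absurd (Finset.mem_piAntidiag.2 ⟨hJ, fun _ _ => Finset.mem_univ _⟩) h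

theorem sum_listIndex (L : List (Fin n)) : ∑ i, listIndex L i = L.length := by
  induction L with
  | nil => simp [listIndex]
  | cons a L ih =>
    rw [listIndex_cons]
    simp [Finset.sum_add_distrib, ih]

/-- A sum over multi-indices as a sum over lists of indices. -/
theorem sum_multiIndicesLE {M : Type*} [AddCommGroup M] [Module ℝ M] (k : ℕ)
    (G : MultiIndex n → M) :
    ∑ J ∈ multiIndicesLE n k, G J = ∑ r ∈ Finset.range (k + 1), ∑ I : Fin r → Fin n,
      ((Nat.multinomial Finset.univ (listIndex (List.ofFn I)) : ℝ))⁻¹ •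
        G (listIndex (List.ofFn I)) := by
  rw [← Finset.sum_fiberwise_of_maps_to (s := multiIndicesLE n k) (t := Finset.range (k + 1))
    (g := fun J => ∑ i, J i) (fun J hJ => Finset.mem_range.2 (by
      have := mem_multiIndicesLE.1 hJ
      omega))]
  refine Finset.sum_congr rfl fun r hr => ?_
  rw [← Finset.sum_fiberwise_of_maps_to (s := Finset.univ)
    (t := (multiIndicesLE n k).filter fun J => ∑ i, J i = r)
    (g := fun I : Fin r → Fin n => listIndex (List.ofFn I)) (fun I _ => by
      rw [Finset.mem_filter, mem_multiIndicesLE, sum_listIndex, List.length_ofFn]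
      have := Finset.mem_range.1 hr
      omega)]
  refine Finset.sum_congr rfl fun J hJ => ?_
  rw [Finset.sum_congr rfl (g := fun _ => ((Nat.multinomial Finset.univ J : ℝ))⁻¹ • G J)
    (fun I hI => by rw [(Finset.mem_filter.1 hI).2]), Finset.sum_const,
    card_listIndex_eq r J (Finset.mem_filter.1 hJ).2, ← Nat.cast_smul_eq_nsmul ℝ, smul_smul,
    mul_inv_cancel₀, one_smul]
  exact_mod_cast (Nat.multinomial_pos Finset.univ J).ne'

theorem sum_mul_iterD {S : Type*} [CommRing S] [Algebra ℝ S] (D : Fin n → Derivation ℝ S S)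
    (hD : ∀ i j f, D i (D j f) = D j (D i f)) (k : ℕ) (G : MultiIndex n → S) (V : S) :
    ∑ J ∈ multiIndicesLE n k, G J * iterD D J V = listOp D k
      (fun L => ((Nat.multinomial Finset.univ (listIndex L) : ℝ))⁻¹ • G (listIndex L)) V := by
  rw [sum_multiIndicesLE k, listOp]
  refine Finset.sum_congr rfl fun r _ => Finset.sum_congr rfl fun I _ => ?_
  rw [listD_eq_iterD D hD, smul_mul_assoc]

end Multinomial

/-! ### Jet coordinates and expressions of finite order. -/

section JetCoordinates

open TopologicalSpace CoordSystem

/-- Labels of the jet coordinates `t`, `xⁱ` and `u^σ_J`. -/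
abbrev JetCoord (n N : ℕ) := Option (Fin n) ⊕ (Fin N × MultiIndex n)

/-- The coordinates `t` and `xⁱ` on the base. -/
noncomputable def baseCoords (n : ℕ) : CoordSystem (Option (Fin n)) (Base n) where
  coord a := a.elim (ContinuousLinearMap.fst ℝ ℝ (Fin n → ℝ)) fun i =>
    (ContinuousLinearMap.proj (R := ℝ) (φ := fun _ : Fin n => ℝ) i).comp
      (ContinuousLinearMap.snd ℝ ℝ (Fin n → ℝ))
  vec a := a.elim (1, 0) fun i => (0, Pi.single i 1)
  coord_vec_self := by
    rintro (_ | i)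
    · rfl
    · exact Pi.single_eq_same i 1
  coord_vec_ne := by
    rintro (_ | i) (_ | j) h
    · exact absurd rfl h
    · rfl
    · rfl
    · exact Pi.single_eq_of_ne (fun h' => h (by rw [h'])) 1

/-- The jet coordinates. -/
noncomputable def jetCoords (n N : ℕ) : CoordSystem (JetCoord n N) (Jet n N) where
  coord a := a.elim
    (fun b => ((baseCoords n).coord b).comp
      (ContinuousLinearMap.fst ℝ (Base n) (Fin N → MultiIndex n → ℝ)))
    (fun q => (ContinuousLinearMap.proj (R := ℝ) (φ := fun _ : MultiIndex n => ℝ) q.2).comp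
      ((ContinuousLinearMap.proj (R := ℝ) (φ := fun _ : Fin N => MultiIndex n → ℝ) q.1).comp
        (ContinuousLinearMap.snd ℝ (Base n) (Fin N → MultiIndex n → ℝ))))
  vec a := a.elim (fun b => ((baseCoords n).vec b, 0))
    (fun q => (0, Pi.single q.1 (Pi.single q.2 1)))
  coord_vec_self := by
    rintro (b | ⟨σ, J⟩)
    · exact (baseCoords n).coord_vec_self b
    · change (Pi.single σ (Pi.single J 1) : Fin N → MultiIndex n → ℝ) σ J = 1
      simp
  coord_vec_ne := by
    rintro (b | ⟨σ, J⟩) (b' | ⟨σ', J'⟩) h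
    · exact (baseCoords n).coord_vec_ne b b' fun h' => h (by rw [h'])
    · exact map_zero ((baseCoords n).coord b)
    · rfl
    · change (Pi.single σ' (Pi.single J' 1) : Fin N → MultiIndex n → ℝ) σ J = 0
      by_cases h1 : σ = σ'
      · subst h1
        rw [Pi.single_eq_same, Pi.single_eq_of_ne]
        exact fun h2 => h (by rw [h2])
      · rw [Pi.single_eq_of_ne h1]
        rfl

variable {n N : ℕ}

/-- The coordinates of jets of order at most `k`. -/
def jetFinset (n N k : ℕ) : Finset (JetCoord n N) :=
  Finset.univ.disjSum (Finset.univ ×ˢ multiIndicesLE n k)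

theorem inl_mem_jetFinset (k : ℕ) (b : Option (Fin n)) : Sum.inl b ∈ jetFinset n N k := by
  simp [jetFinset]

theorem inr_mem_jetFinset {k : ℕ} {σ : Fin N} {J : MultiIndex n} :
    Sum.inr (σ, J) ∈ jetFinset n N k ↔ J ∈ multiIndicesLE n k := by
  simp [jetFinset]

variable {Ω : Opens (Jet n N)}

/-- Points of coordinate space as truncated jets. -/
noncomputable def toJetLE (k : ℕ) : (jetFinset n N k → ℝ) →L[ℝ] JetLE n N k :=
  ((ContinuousLinearMap.proj (R := ℝ) (φ := fun _ : jetFinset n N k => ℝ)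
      ⟨Sum.inl none, inl_mem_jetFinset k none⟩).prod
    (ContinuousLinearMap.pi fun i => ContinuousLinearMap.proj (R := ℝ)
      (φ := fun _ : jetFinset n N k => ℝ) ⟨Sum.inl (some i), inl_mem_jetFinset k _⟩)).prod
  (ContinuousLinearMap.pi fun σ => ContinuousLinearMap.pi fun J => ContinuousLinearMap.proj (R := ℝ)
      (φ := fun _ : jetFinset n N k => ℝ) ⟨Sum.inr (σ, J.1), inr_mem_jetFinset.2 J.2⟩)

/-- Truncated jets as points of coordinate space. -/
noncomputable def ofJetLE (k : ℕ) (y : JetLE n N k) : jetFinset n N k → ℝ := fun a =>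
  match a with
  | ⟨Sum.inl b, _⟩ => (baseCoords n).coord b y.1
  | ⟨Sum.inr (σ, J), h⟩ => y.2 σ ⟨J, inr_mem_jetFinset.1 h⟩

theorem ofJetLE_trunc (k : ℕ) (z : Jet n N) :
    ofJetLE k (trunc k z) = (jetCoords n N).proj (jetFinset n N k) z := by
  ext ⟨a, ha⟩
  rcases a with b | ⟨σ, J⟩ <;> rfl

theorem contDiff_ofJetLE (k : ℕ) : ContDiff ℝ ∞ (ofJetLE (n := n) (N := N) k) := by
  refine contDiff_pi.2 ?_
  rintro ⟨a, ha⟩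
  rcases a with b | ⟨σ, J⟩
  · exact ((baseCoords n).coord b).contDiff.comp contDiff_fst
  · change ContDiff ℝ ∞ fun y : JetLE n N k => y.2 σ ⟨J, inr_mem_jetFinset.1 ha⟩
    fun_prop

theorem IsDiffFun.exists_tame {k : ℕ} {F : Jet n N → ℝ} (h : IsDiffFun (Ω : Set (Jet n N)) k F) :
    ∃ f : (jetCoords n N).Tame Ω, (jetCoords n N).Factors Ω (jetFinset n N k) f.1 ∧
      ∀ z : Ω, F z = f.1 z := by
  obtain ⟨f, h1, h2⟩ := h
  have hf : (jetCoords n N).Factors Ω (jetFinset n N k) fun z => F z := by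
    refine ⟨fun y => f (toJetLE k y), h1.comp (toJetLE k).contDiff.contDiffOn ?_, fun z => ?_⟩
    · rintro _ ⟨z, hz, rfl⟩
      exact ⟨z, hz, rfl⟩
    · exact h2 z z.2
  exact ⟨⟨_, _, hf⟩, hf, fun z => rfl⟩

theorem exists_factors_jetFinset (f : (jetCoords n N).Tame Ω) :
    ∃ k₀, ∀ k, k₀ ≤ k → (jetCoords n N).Factors Ω (jetFinset n N k) f.1 := by
  obtain ⟨c, hc⟩ := Tame.exists_factors f
  refine ⟨c.sup fun a => a.elim (fun _ => 0) fun q => ∑ i, q.2 i, fun k hk => hc.mono ?_⟩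
  rintro (b | ⟨σ, J⟩) ha
  · exact inl_mem_jetFinset k b
  · rw [inr_mem_jetFinset, mem_multiIndicesLE]
    exact (Finset.le_sup (f := fun a : JetCoord n N => a.elim (fun _ => 0) fun q => ∑ i, q.2 i)
      ha).trans hk

/-- The bound is allowed to grow so that finitely many expressions can be given a common order. -/
theorem exists_isDiffFun (f : (jetCoords n N).Tame Ω) :
    ∃ k₀, ∀ k, k₀ ≤ k → ∀ F : Jet n N → ℝ, (∀ z : Ω, F z = f.1 z) →
      IsDiffFun (Ω : Set (Jet n N)) k F := by
  obtain ⟨k₀, hk₀⟩ := exists_factors_jetFinset f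
  refine ⟨k₀, fun k hk F hF => ?_⟩
  obtain ⟨φ, h1, h2⟩ := hk₀ k hk
  refine ⟨fun y => φ (ofJetLE k y), h1.comp (contDiff_ofJetLE k).contDiffOn ?_, fun z hz => ?_⟩
  · rintro _ ⟨z, hz, rfl⟩
    exact ⟨z, hz, (ofJetLE_trunc k z).symm⟩
  · exact (hF ⟨z, hz⟩).trans ((h2 _).trans (congrArg φ (ofJetLE_trunc k z).symm))

end JetCoordinates

end ConsLaw

namespace ConsLaw

open TopologicalSpace CoordSystem

/-! ### Transfer of iterated operations. -/

section Relations

variable {n : ℕ} {α S : Type*} [CommRing S] [Algebra ℝ S] (D : Fin n → Derivation ℝ S S)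
  {rel : α → S → Prop} {op : Fin n → α → α} (h : ∀ i F f, rel F f → rel (op i F) (D i f))

include h in
theorem foldr_iterate_rel (J : MultiIndex n) {F : α} {f : S} (hF : rel F f) :
    rel ((List.finRange n).foldr (fun i G => (op i)^[J i] G) F) (iterD D J f) := by
  unfold iterD
  induction List.finRange n with
  | nil => exact hF
  | cons a l ih =>
    rw [List.map_cons, List.prod_cons, Module.End.mul_apply, Module.End.pow_apply, List.foldr_cons]
    induction J a with
    | zero => exact ih
    | succ k ihk =>
      rw [Function.iterate_succ_apply', Function.iterate_succ_apply']
      exact h a _ _ ihk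

include h in
theorem foldr_rel (L : List (Fin n)) {F : α} {f : S} (hF : rel F f) :
    rel (L.foldr op F) (listD D L f) := by
  induction L with
  | nil => exact hF
  | cons a l ih => exact h a _ _ ih

end Relations

/-! ### Total derivatives on jet space and on the solution space. -/

section JetFields

variable {n N : ℕ}

/-- The components of the total derivative `D_i`. -/
noncomputable def totalField (Ω : Opens (Jet n N)) (i : Fin n) :
    JetCoord n N → (jetCoords n N).Tame Ω
  | Sum.inl none => 0
  | Sum.inl (some j) => if i = j then 1 else 0
  | Sum.inr (σ, J) => (jetCoords n N).coordFun Ω (Sum.inr (σ, J + Pi.single i 1))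

/-- The total derivatives as derivations. -/
noncomputable def totalD (Ω : Opens (Jet n N)) (i : Fin n) :
    Derivation ℝ ((jetCoords n N).Tame Ω) ((jetCoords n N).Tame Ω) :=
  (jetCoords n N).lie (totalField Ω i)

variable {Ω : Opens (Jet n N)}

theorem totalD_coordFun (i : Fin n) (a : JetCoord n N) :
    totalD Ω i ((jetCoords n N).coordFun Ω a) = totalField Ω i a := lie_coordFun _ a

theorem totalD_comm (i j : Fin n) (f : (jetCoords n N).Tame Ω) :
    totalD Ω i (totalD Ω j f) = totalD Ω j (totalD Ω i f) := by
  refine lie_comm (fun a => ?_) f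
  change totalD Ω i _ = totalD Ω j _
  rcases a with (_ | l) | ⟨σ, J⟩
  · simp [totalField]
  · simp only [totalField]
    split_ifs <;> simp
  · simp only [totalField, totalD_coordFun]
    rw [add_right_comm]

theorem iterD_coordFun (σ : Fin N) (J : MultiIndex n) :
    iterD (totalD Ω) J ((jetCoords n N).coordFun Ω (Sum.inr (σ, 0))) =
      (jetCoords n N).coordFun Ω (Sum.inr (σ, J)) := by
  induction J using multi_induction with
  | h0 => rw [iterD_zero]; rfl
  | h1 J i ih => rw [iterD_add_single (totalD Ω) totalD_comm, ih, totalD_coordFun]; rfl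

variable (g : Fin N → (jetCoords n N).Tame Ω)

/-- The components of the total `t`-derivative on the solution space. -/
noncomputable def solField : JetCoord n N → (jetCoords n N).Tame Ω
  | Sum.inl none => 1
  | Sum.inl (some _) => 0
  | Sum.inr (ρ, J) => -iterD (totalD Ω) J (g ρ)

/-- The total `t`-derivative on the solution space. -/
noncomputable def solD : Derivation ℝ ((jetCoords n N).Tame Ω) ((jetCoords n N).Tame Ω) :=
  (jetCoords n N).lie (solField g)

theorem solD_coordFun (a : JetCoord n N) :
    solD g ((jetCoords n N).coordFun Ω a) = solField g a := lie_coordFun _ a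

/-- The component of `solField` at `J + e_i` is `D_i` of its component at `J`, and the components
along the base are constant. -/
theorem solD_comm (i : Fin n) (f : (jetCoords n N).Tame Ω) :
    solD g (totalD Ω i f) = totalD Ω i (solD g f) := by
  refine lie_comm (fun a => ?_) f
  change solD g _ = totalD Ω i _
  rcases a with (_ | l) | ⟨σ, J⟩
  · simp [totalField, solField]
  · simp only [totalField, solField]
    split_ifs <;> simp
  · simp only [totalField, solD_coordFun, solField]
    rw [map_neg, iterD_add_single (totalD Ω) totalD_comm]

/-- A function on jets that restricts to the given element. -/
def Represents (F : Jet n N → ℝ) (f : (jetCoords n N).Tame Ω) : Prop := ∀ z : Ω, F z = f.1 z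

/-- The direction has infinitely many nonzero entries, but only finitely many coordinates matter,
and the line through `z` stays in the open set `Ω` for small times; values of `F` outside `Ω` play
no role. -/
theorem Represents.totalD {F : Jet n N → ℝ} {f : (jetCoords n N).Tame Ω} (h : Represents F f)
    (i : Fin n) : Represents (D i F) (totalD Ω i f) := fun z =>
  (lie_apply_hasLineDerivAt (totalField Ω i) f h z
    ((0, Pi.single i 1), fun σ J => z.1.2 σ (J + Pi.single i 1)) (by
      rintro ((_ | l) | ⟨σ, J⟩)
      · rfl
      · change (Pi.single i 1 : Fin n → ℝ) l = (if i = l then 1 else 0 : (jetCoords n N).Tame Ω).1 z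
        by_cases h : i = l
        · subst h
          rw [if_pos rfl, Pi.single_eq_same]
          rfl
        · rw [if_neg h, Pi.single_eq_of_ne (Ne.symm h)]
          rfl
      · rfl)).lineDeriv

theorem Represents.iterD {F : Jet n N → ℝ} {f : (jetCoords n N).Tame Ω} (h : Represents F f)
    (J : MultiIndex n) : Represents (DMulti J F) (iterD (ConsLaw.totalD Ω) J f) :=
  foldr_iterate_rel (ConsLaw.totalD Ω) (rel := Represents) (op := D) (fun i _ _ h => h.totalD i) J h

theorem Represents.listD {F : Jet n N → ℝ} {f : (jetCoords n N).Tame Ω} (h : Represents F f)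
    (L : List (Fin n)) : Represents (DList L F) (listD (ConsLaw.totalD Ω) L f) :=
  foldr_rel (ConsLaw.totalD Ω) (rel := Represents) (op := D) (fun i _ _ h => h.totalD i) L h

theorem Represents.solD {F : Jet n N → ℝ} {f : (jetCoords n N).Tame Ω} (h : Represents F f)
    {g : Fin N → Jet n N → ℝ} {g' : Fin N → (jetCoords n N).Tame Ω}
    (hg : ∀ ρ, Represents (g ρ) (g' ρ)) : Represents (DtSol g F) (solD g' f) := fun z =>
  (lie_apply_hasLineDerivAt (solField g') f h z
    ((1, 0), fun ρ J => -DMulti J (g ρ) z) (by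
      rintro ((_ | l) | ⟨σ, J⟩)
      · rfl
      · rfl
      · exact congrArg Neg.neg ((hg σ).iterD J z))).lineDeriv

/-- The symmetric partial derivatives. -/
noncomputable def symD (σ : Fin N) (L : List (Fin n)) (f : (jetCoords n N).Tame Ω) :
    (jetCoords n N).Tame Ω :=
  (Nat.multinomial Finset.univ (listIndex L) : ℝ)⁻¹ •
    (jetCoords n N).pd Ω (Sum.inr (σ, listIndex L)) f

theorem listIndex_perm {L L' : List (Fin n)} (h : L.Perm L') : listIndex L = listIndex L' :=
  funext fun a => h.count_eq a

theorem symD_perm (σ : Fin N) {L L' : List (Fin n)} (h : L.Perm L')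
    (f : (jetCoords n N).Tame Ω) : symD σ L f = symD σ L' f := by
  rw [symD, symD, listIndex_perm h]

theorem Represents.symD {F : Jet n N → ℝ} {f : (jetCoords n N).Tame Ω} (h : Represents F f)
    (σ : Fin N) (L : List (Fin n)) : Represents (symDeriv σ L F) (symD σ L f) := fun z => by
  have h1 : coordDeriv σ (listIndex L) F z =
      ((jetCoords n N).pd Ω (Sum.inr (σ, listIndex L)) f).1 z := by
    obtain ⟨c, φ, h1, h2⟩ := Tame.exists_factors f
    refine Eq.trans ?_ (partialFun_eq h1 h2 (Sum.inr (σ, listIndex L)) z).symm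
    exact (hasLineDerivAt_of_factors h1 (fun z hz => (h ⟨z, hz⟩).trans (h2 _)) z.2 _).lineDeriv
  unfold symDeriv
  rw [h1]
  rfl

end JetFields

/-! ### Prolongation and linearisation along a map. -/

section Prolongation

variable {n N : ℕ} {Ω : Opens (Jet n N)} {ι' X' : Type*} [AddCommGroup X'] [Module ℝ X']
  [TopologicalSpace X'] [IsTopologicalAddGroup X'] [ContinuousSMul ℝ X']
  {C' : CoordSystem ι' X'} {O' : Opens X'}
  (T : TameMap C' O' (jetCoords n N) Ω)

theorem TameMap.along_smul (Y : JetCoord n N → C'.Tame O') (r : ℝ) (f : (jetCoords n N).Tame Ω) :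
    T.along Y (r • f) = r • T.along Y f := by
  obtain ⟨c, hc⟩ := Tame.exists_factors f
  have hc' : (jetCoords n N).Factors Ω c (r • f).1 := by
    obtain ⟨φ, h1, h2⟩ := hc
    exact ⟨fun y => r * φ y, contDiffOn_const.mul h1, fun z => congrArg (r * ·) (h2 z)⟩
  rw [T.along_apply Y hc, T.along_apply Y hc', Finset.smul_sum]
  refine Finset.sum_congr rfl fun a _ => ?_
  rw [Derivation.map_smul, map_smul, smul_mul_assoc]

/-- The prolongation of `V = (V¹, …, Vᴺ)` to the derivatives `u^σ_J`. -/
noncomputable def prolong (E : Fin n → Derivation ℝ (C'.Tame O') (C'.Tame O'))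
    (V : Fin N → C'.Tame O') : JetCoord n N → C'.Tame O'
  | Sum.inl _ => 0
  | Sum.inr (σ, J) => iterD E J (V σ)

/-- The base coordinates do not contribute, and the weights of the list form are those of the
symmetric derivatives. -/
theorem sum_jetFinset_mul_prolong (E : Fin n → Derivation ℝ (C'.Tame O') (C'.Tame O'))
    (hE : ∀ i j f, E i (E j f) = E j (E i f)) (V : Fin N → C'.Tame O') (k : ℕ)
    (G : JetCoord n N → C'.Tame O') :
    ∑ a ∈ jetFinset n N k, G a * prolong E V a = ∑ σ, listOp E k
      (fun L => ((Nat.multinomial Finset.univ (listIndex L) : ℝ))⁻¹ • G (Sum.inr (σ, listIndex L)))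
      (V σ) := by
  rw [jetFinset, Finset.sum_disjSum, Finset.sum_product]
  simp only [prolong, mul_zero, Finset.sum_const_zero, zero_add]
  exact Finset.sum_congr rfl fun σ _ => sum_mul_iterD E hE k (fun J => G (Sum.inr (σ, J))) (V σ)

variable {Y : Fin n → ι' → C'.Tame O'}
  (hE : ∀ i j f, C'.lie (Y i) (C'.lie (Y j) f) = C'.lie (Y j) (C'.lie (Y i) f))
  (hT : ∀ i a, C'.lie (Y i) (T.comp a) = T.pullback (totalField Ω i a))

include hT in
theorem lie_pullback_totalD (i : Fin n) (f : (jetCoords n N).Tame Ω) :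
    T.pullback (totalD Ω i f) = C'.lie (Y i) (T.pullback f) :=
  (T.lie_pullback_of_related (hT i) f).symm

theorem TameMap.along_one (Z : JetCoord n N → C'.Tame O') : T.along Z 1 = 0 := by
  obtain ⟨c, hc⟩ := Tame.exists_factors (1 : (jetCoords n N).Tame Ω)
  rw [T.along_apply Z hc]
  refine Finset.sum_eq_zero fun a _ => ?_
  rw [Derivation.map_one_eq_zero, map_zero, zero_mul]

include hE hT in
-- The prolonged component at `u^σ_{J+e_i}` is the derivative of the one at `u^σ_J`, so
-- linearisation commutes with total differentiation.
theorem along_prolong_totalD (V : Fin N → C'.Tame O') (i : Fin n) (f : (jetCoords n N).Tame Ω) :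
    T.along (prolong (fun i => C'.lie (Y i)) V) (totalD Ω i f) =
      C'.lie (Y i) (T.along (prolong (fun i => C'.lie (Y i)) V) f) := by
  refine (T.lie_along_of_related (hT i) (fun a => ?_) f).symm
  rcases a with (_ | l) | ⟨σ, J⟩
  · simp [prolong, totalField]
  · simp only [prolong, totalField, map_zero]
    split_ifs
    · exact (T.along_one _).symm
    · exact (map_zero _).symm
  · rw [totalField, T.along_coordFun]
    exact (iterD_add_single _ hE J i (V σ)).symm

include hE in
theorem along_prolong_eq_listOp (V : Fin N → C'.Tame O') {k : ℕ} {f : (jetCoords n N).Tame Ω}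
    (hf : (jetCoords n N).Factors Ω (jetFinset n N k) f.1) :
    T.along (prolong (fun i => C'.lie (Y i)) V) f = ∑ σ, listOp (fun i => C'.lie (Y i)) k
      (fun L => T.pullback (symD σ L f)) (V σ) := by
  rw [T.along_apply _ hf, sum_jetFinset_mul_prolong _ hE]
  simp only [symD, map_smul]

include hE in
theorem isTotalOp_along_prolong (f : (jetCoords n N).Tame Ω) :
    IsTotalOp (fun i => C'.lie (Y i)) fun V => T.along (prolong (fun i => C'.lie (Y i)) V) f := by
  obtain ⟨k, hk⟩ := exists_factors_jetFinset f
  simp only [along_prolong_eq_listOp T hE _ (hk k le_rfl)]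
  exact IsTotalOp.sum _ fun σ _ => (IsTotalOp.component σ).listOp hE k _

include hE hT in
/-- Linearisation of the total `t`-derivative. -/
theorem along_prolong_solD (g : Fin N → (jetCoords n N).Tame Ω) (V : Fin N → C'.Tame O')
    {c : Finset (JetCoord n N)} {f : (jetCoords n N).Tame Ω}
    (hc : (jetCoords n N).Factors Ω c f.1) :
    T.along (prolong (fun i => C'.lie (Y i)) V) (solD g f) =
      ∑ a ∈ c, T.pullback (solD g ((jetCoords n N).pd Ω a f)) *
        prolong (fun i => C'.lie (Y i)) V a -
      T.along (prolong (fun i => C'.lie (Y i)) fun ρ =>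
        T.along (prolong (fun i => C'.lie (Y i)) V) (g ρ)) f := by
  have h1 := T.along_lie (prolong (fun i => C'.lie (Y i)) V) (solField g) hc
  refine h1.trans ?_
  rw [T.along_apply _ hc, add_comm, sub_eq_add_neg, ← Finset.sum_neg_distrib]
  congr 1
  refine Finset.sum_congr rfl fun a _ => ?_
  rw [neg_mul_eq_mul_neg]
  congr 1
  rcases a with (_ | l) | ⟨σ, J⟩
  · rw [solField, T.along_one, prolong, neg_zero]
  · rw [solField, map_zero, prolong, neg_zero]
  · rw [solField, map_neg, prolong]
    congr 1
    exact map_iterD (totalD Ω) totalD_comm (fun i => C'.lie (Y i)) hE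
      (χ := T.along (prolong (fun i => C'.lie (Y i)) V))
      (fun i f => along_prolong_totalD T hE hT V i f) J (g σ)

variable {k m p : ℕ} {Φt : (jetCoords n N).Tame Ω} {Φx : Fin n → (jetCoords n N).Tame Ω}
  {g Λ : Fin N → (jetCoords n N).Tame Ω}
  (hΦt : (jetCoords n N).Factors Ω (jetFinset n N k) Φt.1)
  (hg : ∀ σ, (jetCoords n N).Factors Ω (jetFinset n N m) (g σ).1)
  (hΛ : ∀ σ, (jetCoords n N).Factors Ω (jetFinset n N p) (Λ σ).1)
  (hmul : ∀ σ, Λ σ = listAdjoint (totalD Ω) k fun L => symD σ L Φt)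
  (hcons : solD g Φt + ∑ i, totalD Ω i (Φx i) = 0)

include hE hT hΦt hmul in
/-- The first variation of the conserved density. -/
theorem along_prolong_density (V : Fin N → C'.Tame O') :
    T.along (prolong (fun i => C'.lie (Y i)) V) Φt = ∑ σ, V σ * T.pullback (Λ σ) +
      ∑ i, C'.lie (Y i) (∑ σ, greenCurrent (fun i => C'.lie (Y i)) k i
        (fun L => T.pullback (symD σ L Φt)) (V σ)) := by
  rw [along_prolong_eq_listOp T hE V hΦt]
  simp only [map_sum]
  rw [Finset.sum_comm, ← Finset.sum_add_distrib]
  refine Finset.sum_congr rfl fun σ _ => ?_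
  have h1 := sum_derivation_greenCurrent (fun i => C'.lie (Y i)) k
    (fun L => T.pullback (symD σ L Φt)) (fun L L' h => by rw [symD_perm σ h]) (V σ)
  have h2 := map_listAdjoint (totalD Ω) (fun i => C'.lie (Y i))
    (T.pullback : (jetCoords n N).Tame Ω →+ C'.Tame O')
    (fun i f => lie_pullback_totalD T hT i f) k fun L => symD σ L Φt
  have h3 : T.pullback (listAdjoint (totalD Ω) k fun L => symD σ L Φt) =
      listAdjoint (fun i => C'.lie (Y i)) k fun L => T.pullback (symD σ L Φt) := h2
  rw [h1, hmul, h3]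
  ring

include hE hT hΦt hg hΛ hmul hcons in
-- Here `τ` is a time derivative for which the map fails by `Q` to be a solution. The linearised
-- conservation law required by `exists_flux_potential` is obtained by linearising `hcons` in the
-- direction `V`.
theorem exists_flux_potential_along (x : Fin n → C'.Tame O')
    (hx : ∀ i j, C'.lie (Y i) (x j) = if i = j then 1 else 0)
    (τ : Derivation ℝ (C'.Tame O') (C'.Tame O')) (Q : Fin N → C'.Tame O')
    (hτ : ∀ f, τ (T.pullback f) = T.pullback (solD g f) +
      T.along (prolong (fun i => C'.lie (Y i)) Q) f) (V : Fin N → C'.Tame O') :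
    ∃ ψ : Fin n → Fin n → C'.Tame O', (∀ i j, ψ i j = -ψ j i) ∧ ∀ i,
      ∑ σ, greenCurrent (fun i => C'.lie (Y i)) k i
          (fun L => τ (T.pullback (symD σ L Φt))) (V σ) -
        ∑ σ, greenCurrent (fun i => C'.lie (Y i)) k i
          (fun L => T.along (prolong (fun i => C'.lie (Y i)) V) (symD σ L Φt)) (Q σ) -
        ∑ σ, greenCurrent (fun i => C'.lie (Y i)) k i (fun L => T.pullback (symD σ L Φt))
          (T.along (prolong (fun i => C'.lie (Y i)) V) (g σ)) +
        T.along (prolong (fun i => C'.lie (Y i)) V) (Φx i) -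
        ∑ ρ, ∑ σ, greenCurrent (fun i => C'.lie (Y i)) m i
          (fun L => T.pullback (Λ σ) * T.pullback (symD ρ L (g σ))) (V ρ) -
        ∑ ρ, ∑ σ, greenCurrent (fun i => C'.lie (Y i)) p i
          (fun L => Q σ * T.pullback (symD ρ L (Λ σ))) (V ρ) =
      ∑ j, C'.lie (Y j) (ψ i j) := by
  simp only [along_prolong_eq_listOp T hE V (hg _)]
  refine exists_flux_potential hE x hx k m p Q (fun σ L => T.pullback (symD σ L Φt))
    (fun σ L => τ (T.pullback (symD σ L Φt)))
    (fun σ L V => T.along (prolong (fun i => C'.lie (Y i)) V) (symD σ L Φt))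
    (fun σ L L' h => by rw [symD_perm σ h]) (fun σ L L' h => by rw [symD_perm σ h])
    (fun σ V L L' h => by rw [symD_perm σ h])
    (fun σ L => isTotalOp_along_prolong T hE _)
    (fun σ => T.pullback (Λ σ)) (fun σ ρ L => T.pullback (symD ρ L (g σ)))
    (fun σ ρ L => T.pullback (symD ρ L (Λ σ)))
    (fun σ ρ L L' h => by rw [symD_perm ρ h]) (fun σ ρ L L' h => by rw [symD_perm ρ h])
    (fun σ => ?_) (fun σ V => ?_)
    (fun i V => T.along (prolong (fun i => C'.lie (Y i)) V) (Φx i))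
    (fun i => isTotalOp_along_prolong T hE _) (fun V => ?_) V
  · rw [hmul]
    exact (map_listAdjoint (totalD Ω) (fun i => C'.lie (Y i))
      (T.pullback : (jetCoords n N).Tame Ω →+ C'.Tame O')
      (fun i f => lie_pullback_totalD T hT i f) k _).symm
  · rw [← along_prolong_eq_listOp T hE V (hΛ σ), hmul]
    exact (map_listAdjoint (totalD Ω) (fun i => C'.lie (Y i))
      (T.along (prolong (fun i => C'.lie (Y i)) V))
      (fun i f => along_prolong_totalD T hE hT V i f) k _).symm
  · simp only [← along_prolong_eq_listOp T hE V (hg _)]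
    have e1 := sum_jetFinset_mul_prolong (fun i => C'.lie (Y i)) hE V k
      (fun a => τ (T.pullback ((jetCoords n N).pd Ω a Φt)))
    have e2 := sum_jetFinset_mul_prolong (fun i => C'.lie (Y i)) hE Q k
      (fun a => T.along (prolong (fun i => C'.lie (Y i)) V) ((jetCoords n N).pd Ω a Φt))
    have e3 := along_prolong_eq_listOp T hE (fun ρ =>
      T.along (prolong (fun i => C'.lie (Y i)) V) (g ρ)) hΦt
    have f1 : ∀ σ L, τ (T.pullback (symD σ L Φt)) =
        ((Nat.multinomial Finset.univ (listIndex L) : ℝ))⁻¹ •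
          τ (T.pullback ((jetCoords n N).pd Ω (Sum.inr (σ, listIndex L)) Φt)) := by
      intro σ L
      rw [symD, map_smul, Derivation.map_smul]
    have f2 : ∀ σ L, T.along (prolong (fun i => C'.lie (Y i)) V) (symD σ L Φt) =
        ((Nat.multinomial Finset.univ (listIndex L) : ℝ))⁻¹ •
          T.along (prolong (fun i => C'.lie (Y i)) V)
            ((jetCoords n N).pd Ω (Sum.inr (σ, listIndex L)) Φt) := by
      intro σ L
      rw [symD, T.along_smul]
    simp only [f1, f2]
    rw [← e1, ← e2, ← e3]
    have e4 := along_prolong_solD T hE hT g V hΦt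
    -- The correction by `Q` in `τ` is a second variation of the density; being symmetric in `V` and
    -- `Q`, it cancels against the term with the varied coefficients.
    have e5 := T.sum_along_pd_comm (prolong (fun i => C'.lie (Y i)) V)
      (prolong (fun i => C'.lie (Y i)) Q) hΦt
    have e6 : ∑ a ∈ jetFinset n N k, τ (T.pullback ((jetCoords n N).pd Ω a Φt)) *
        prolong (fun i => C'.lie (Y i)) V a =
        ∑ a ∈ jetFinset n N k, T.pullback (solD g ((jetCoords n N).pd Ω a Φt)) *
          prolong (fun i => C'.lie (Y i)) V a +
        ∑ a ∈ jetFinset n N k, T.along (prolong (fun i => C'.lie (Y i)) Q)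
          ((jetCoords n N).pd Ω a Φt) * prolong (fun i => C'.lie (Y i)) V a := by
      rw [← Finset.sum_add_distrib]
      exact Finset.sum_congr rfl fun a _ => by rw [hτ, add_mul]
    have e7 := congrArg (T.along (prolong (fun i => C'.lie (Y i)) V)) hcons
    rw [map_add, map_sum, map_zero] at e7
    simp only [along_prolong_totalD T hE hT] at e7
    linear_combination e6 - e5 - e4 + e7

end Prolongation

end ConsLaw

namespace ConsLaw

open TopologicalSpace CoordSystem

/-! ### Derivatives in the independent variables. -/

section BaseDerivations

variable {n : ℕ}

/-- The partial derivatives on the base. -/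
noncomputable def baseD (B : Opens (Base n)) (a : Option (Fin n)) :
    Derivation ℝ ((baseCoords n).Tame B) ((baseCoords n).Tame B) :=
  (baseCoords n).lie (Pi.single a 1)

theorem derivation_single_one {κ A : Type*} [DecidableEq κ] [CommRing A] [Algebra ℝ A]
    (E : Derivation ℝ A A) (a b : κ) : E ((Pi.single a 1 : κ → A) b) = 0 := by
  by_cases h : b = a
  · subst h
    rw [Pi.single_eq_same, Derivation.map_one_eq_zero]
  · rw [Pi.single_eq_of_ne h, map_zero]

theorem baseD_comm {B : Opens (Base n)} (a b : Option (Fin n)) (f : (baseCoords n).Tame B) :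
    baseD B a (baseD B b f) = baseD B b (baseD B a f) :=
  lie_comm (fun c => (derivation_single_one _ b c).trans (derivation_single_one _ a c).symm) f

theorem baseD_coordFun {B : Opens (Base n)} (a b : Option (Fin n)) :
    baseD B a ((baseCoords n).coordFun B b) =
      (Pi.single a 1 : Option (Fin n) → (baseCoords n).Tame B) b := lie_coordFun _ _

theorem hasLineDerivAt_baseD {B : Opens (Base n)} (a : Option (Fin n)) (f : (baseCoords n).Tame B)
    {F : Base n → ℝ} (hF : ∀ b : B, F b = f.1 b) (b : B) :
    lineDeriv ℝ F b ((baseCoords n).vec a) = (baseD B a f).1 b :=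
  (lie_apply_hasLineDerivAt _ f hF b _ fun c => by
    by_cases h : c = a
    · subst h
      rw [(baseCoords n).coord_vec_self, Pi.single_eq_same]
      rfl
    · rw [(baseCoords n).coord_vec_ne _ _ h, Pi.single_eq_of_ne h]
      rfl).lineDeriv

end BaseDerivations

/-! ### The homotopy with its parameter as an additional coordinate. -/

namespace IsAdmissible

variable {n N : ℕ} {Ω : Set (Jet n N)} {w : Fin N → Base n → ℝ} (hΩ : IsAdmissible Ω w)

/-- The open set of jets. -/
def jets : Opens (Jet n N) := ⟨Ω, hΩ.isOpen⟩

/-- The projection of the set of jets to the base. -/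
def base : Opens (Base n) := ⟨Prod.fst '' Ω, isOpenMap_fst Ω hΩ.isOpen⟩

/-- The functions `w^σ` as elements of the algebra of functions on the base. -/
noncomputable def background (σ : Fin N) : (baseCoords n).Tame hΩ.base :=
  ⟨fun b => w σ b, Finset.univ, fun y => w σ (y ⟨none, Finset.mem_univ _⟩,
    fun i => y ⟨some i, Finset.mem_univ _⟩), by
      refine (hΩ.smooth σ).comp (ContDiff.contDiffOn (by fun_prop)) ?_
      rintro _ ⟨b, hb, rfl⟩
      exact hb, fun _ => rfl⟩

/-- The derivatives of the functions `w^σ`. -/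
noncomputable def backgroundJet (σ : Fin N) (J : MultiIndex n) : (baseCoords n).Tame hΩ.base :=
  iterD (fun i => baseD hΩ.base (some i)) J (hΩ.background σ)

theorem backgroundJet_apply (σ : Fin N) (J : MultiIndex n) (b : hΩ.base) :
    partialMulti J (w σ) b = (hΩ.backgroundJet σ J).1 b :=
  foldr_iterate_rel (fun i => baseD hΩ.base (some i))
    (rel := fun (F : Base n → ℝ) f => ∀ b : hΩ.base, F b = f.1 b)
    (op := fun i h q => lineDeriv ℝ h q (0, Pi.single i 1))
    (fun i F f h b => hasLineDerivAt_baseD (some i) f h b) J (fun _ => rfl) b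

theorem baseD_backgroundJet (σ : Fin N) (J : MultiIndex n) (i : Fin n) :
    baseD hΩ.base (some i) (hΩ.backgroundJet σ J) = hΩ.backgroundJet σ (J + Pi.single i 1) :=
  (iterD_add_single (fun i => baseD hΩ.base (some i)) (fun i j => baseD_comm _ _) J i _).symm

theorem homotopy_zero (z : Jet n N) : homotopy w 0 z = jetOf w z.1 := by
  simp [homotopy, jetOf]

theorem homotopy_one (z : Jet n N) : homotopy w 1 z = z := by
  simp [homotopy]

theorem jetOf_mem {b : Base n} (hb : b ∈ hΩ.base) : jetOf w b ∈ Ω := by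
  obtain ⟨z, hz, rfl⟩ := hb
  rw [← homotopy_zero]
  exact hΩ.homotopy_mem z hz 0 (by simp)

/-- The map `b ↦ jetOf w b`. -/
noncomputable def jetMap : TameMap (baseCoords n) hΩ.base (jetCoords n N) hΩ.jets where
  toFun b := ⟨jetOf w b, hΩ.jetOf_mem b.2⟩
  comp a := a.elim (fun a => (baseCoords n).coordFun hΩ.base a)
    fun q => hΩ.backgroundJet q.1 q.2
  comp_eq := by
    rintro (a | ⟨σ, J⟩) b
    · rfl
    · exact hΩ.backgroundJet_apply σ J b

/-- The projection of jets to the base. -/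
noncomputable def baseMap : TameMap (jetCoords n N) hΩ.jets (baseCoords n) hΩ.base where
  toFun z := ⟨z.1.1, ⟨z, z.2, rfl⟩⟩
  comp a := (jetCoords n N).coordFun hΩ.jets (Sum.inl a)
  comp_eq _ _ := rfl

include hΩ in
-- Continuity is coordinatewise in the product topology; it makes the domain `paramJets` open.
theorem continuousOn_homotopy : ContinuousOn (fun p : ℝ × Jet n N => homotopy w p.1 p.2)
    {p | p.2 ∈ Ω} := by
  have h1 : ∀ σ J, ContinuousOn (fun p : ℝ × Jet n N => partialMulti J (w σ) p.2.1)
      {p | p.2 ∈ Ω} := by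
    intro σ J
    have h2 : ContinuousOn (partialMulti J (w σ)) hΩ.base :=
      (Tame.continuousOn (hΩ.backgroundJet σ J)).congr fun b hb => by
        rw [extend_apply _ hb]
        exact hΩ.backgroundJet_apply σ J ⟨b, hb⟩
    exact h2.comp (by fun_prop) fun p hp => ⟨p.2, hp, rfl⟩
  refine ContinuousOn.prodMk (by fun_prop) ?_
  refine continuousOn_pi.2 fun σ => continuousOn_pi.2 fun J => ?_
  exact ContinuousOn.add (by fun_prop) (ContinuousOn.mul (by fun_prop) (h1 σ J))

/-- The domain of the functions of the homotopy parameter `s` and of jets. -/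
def paramJets : Opens (ℝ × Jet n N) where
  carrier := {p | p.2 ∈ Ω} ∩ (fun p => homotopy w p.1 p.2) ⁻¹' Ω ∩
    (fun p => p.1 • p.2.1) ⁻¹' hΩ.base
  is_open' := by
    refine (hΩ.continuousOn_homotopy.isOpen_inter_preimage
      (hΩ.isOpen.preimage continuous_snd) hΩ.isOpen).inter (hΩ.base.isOpen.preimage ?_)
    fun_prop

theorem mem_paramJets (z : Jet n N) (hz : z ∈ hΩ.jets) (s : ℝ) (hs : s ∈ Set.Icc (0 : ℝ) 1) :
    (s, z) ∈ hΩ.paramJets :=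
  ⟨⟨hz, hΩ.homotopy_mem z hz s hs⟩, hΩ.scale_mem z.1 ⟨z, hz, rfl⟩ s hs s hs⟩

/-- Functions of the homotopy parameter and of jets. -/
abbrev ParamFun := (jetCoords n N).withParam.Tame hΩ.paramJets

/-- The map `(s, z) ↦ z`. -/
noncomputable def forgetMap :
    TameMap (jetCoords n N).withParam hΩ.paramJets (jetCoords n N) hΩ.jets where
  toFun p := ⟨p.1.2, p.2.1.1⟩
  comp a := (jetCoords n N).withParam.coordFun hΩ.paramJets (some a)
  comp_eq _ _ := rfl

/-- The homotopy parameter. -/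
noncomputable def param : hΩ.ParamFun := (jetCoords n N).withParam.coordFun hΩ.paramJets none

/-- The map `(s, z) ↦ u_(s)`. -/
noncomputable def homotopyMap :
    TameMap (jetCoords n N).withParam hΩ.paramJets (jetCoords n N) hΩ.jets where
  toFun p := ⟨homotopy w p.1.1 p.1.2, p.2.1.2⟩
  comp a := a.elim (fun a => (jetCoords n N).withParam.coordFun hΩ.paramJets (some (Sum.inl a)))
    fun q => hΩ.param * (jetCoords n N).withParam.coordFun hΩ.paramJets (some (Sum.inr q)) +
      (1 - hΩ.param) * hΩ.forgetMap.pullback (hΩ.baseMap.pullback (hΩ.backgroundJet q.1 q.2))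
  comp_eq := by
    rintro (a | ⟨σ, J⟩) p
    · rfl
    · exact congrArg (fun r => p.1.1 * p.1.2.2 σ J + (1 - p.1.1) * r)
        (hΩ.backgroundJet_apply σ J ⟨p.1.2.1, ⟨p.1.2, p.2.1.1, rfl⟩⟩)

/-- The map `(s, z) ↦ (s t, s x)`. -/
noncomputable def scaleMap :
    TameMap (jetCoords n N).withParam hΩ.paramJets (baseCoords n) hΩ.base where
  toFun p := ⟨p.1.1 • p.1.2.1, p.2.2⟩
  comp a := hΩ.param * (jetCoords n N).withParam.coordFun hΩ.paramJets (some (Sum.inl a))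
  comp_eq a p := map_smul ((baseCoords n).coord a) p.1.1 p.1.2.1

/-- The map `z ↦ (s, z)` for a fixed `s`. -/
noncomputable def sliceMap (s : ℝ) (hs : s ∈ Set.Icc (0 : ℝ) 1) :
    TameMap (jetCoords n N) hΩ.jets (jetCoords n N).withParam hΩ.paramJets where
  toFun z := ⟨(s, z), hΩ.mem_paramJets z z.2 s hs⟩
  comp a := a.elim (algebraMap ℝ _ s) fun a => (jetCoords n N).coordFun hΩ.jets a
  comp_eq := by
    rintro (_ | a) z
    · rfl
    · rfl

/-- A vector field on jets as a field that does not move the parameter. -/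
noncomputable def liftField (Z : JetCoord n N → (jetCoords n N).Tame hΩ.jets)
    (a : Option (JetCoord n N)) : hΩ.ParamFun :=
  a.elim 0 fun a => hΩ.forgetMap.pullback (Z a)

theorem lie_liftField_forget (Z : JetCoord n N → (jetCoords n N).Tame hΩ.jets)
    (f : (jetCoords n N).Tame hΩ.jets) :
    (jetCoords n N).withParam.lie (hΩ.liftField Z) (hΩ.forgetMap.pullback f) =
      hΩ.forgetMap.pullback ((jetCoords n N).lie Z f) :=
  hΩ.forgetMap.lie_pullback_of_related
    (fun a => lie_coordFun (C := (jetCoords n N).withParam) (hΩ.liftField Z) (some a)) f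

theorem lie_liftField_param (Z : JetCoord n N → (jetCoords n N).Tame hΩ.jets) :
    (jetCoords n N).withParam.lie (hΩ.liftField Z) hΩ.param = 0 :=
  lie_coordFun (C := (jetCoords n N).withParam) (hΩ.liftField Z) none

theorem lie_liftField_comm {Z Z' : JetCoord n N → (jetCoords n N).Tame hΩ.jets}
    (h : ∀ a, (jetCoords n N).lie Z (Z' a) = (jetCoords n N).lie Z' (Z a)) (f : hΩ.ParamFun) :
    (jetCoords n N).withParam.lie (hΩ.liftField Z)
        ((jetCoords n N).withParam.lie (hΩ.liftField Z') f) =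
      (jetCoords n N).withParam.lie (hΩ.liftField Z')
        ((jetCoords n N).withParam.lie (hΩ.liftField Z) f) := by
  refine lie_comm (fun a => ?_) f
  cases a with
  | none => exact (map_zero _).trans (map_zero _).symm
  | some a =>
    refine (hΩ.lie_liftField_forget Z _).trans ?_
    rw [h a]
    exact (hΩ.lie_liftField_forget Z' _).symm

/-- Differentiating at a fixed parameter value agrees with differentiating first and fixing the
value afterwards, as the lifted field does not move the parameter. -/
theorem lie_slice (s : ℝ) (hs : s ∈ Set.Icc (0 : ℝ) 1)
    (Z : JetCoord n N → (jetCoords n N).Tame hΩ.jets) (f : hΩ.ParamFun) :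
    (jetCoords n N).lie Z ((hΩ.sliceMap s hs).pullback f) =
      (hΩ.sliceMap s hs).pullback ((jetCoords n N).withParam.lie (hΩ.liftField Z) f) := by
  refine (hΩ.sliceMap s hs).lie_pullback_of_related (fun a => ?_) f
  cases a with
  | none => exact (Derivation.map_algebraMap _ s).trans (map_zero _).symm
  | some a => exact lie_coordFun Z a

/-- The total derivatives on functions of the homotopy parameter and of jets. -/
noncomputable def paramD (i : Fin n) : Derivation ℝ hΩ.ParamFun hΩ.ParamFun :=
  (jetCoords n N).withParam.lie (hΩ.liftField (totalField hΩ.jets i))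

/-- The derivative with respect to the homotopy parameter. -/
noncomputable def paramS : Derivation ℝ hΩ.ParamFun hΩ.ParamFun :=
  (jetCoords n N).withParam.lie (Pi.single none 1)

/-- The total `t`-derivative on functions of the homotopy parameter and of jets. -/
noncomputable def paramT (g : Fin N → (jetCoords n N).Tame hΩ.jets) :
    Derivation ℝ hΩ.ParamFun hΩ.ParamFun :=
  (jetCoords n N).withParam.lie (hΩ.liftField (solField g))

theorem paramD_comm (i j : Fin n) (f : hΩ.ParamFun) :
    hΩ.paramD i (hΩ.paramD j f) = hΩ.paramD j (hΩ.paramD i f) := by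
  refine hΩ.lie_liftField_comm (fun a => ?_) f
  rw [← totalD_coordFun, ← totalD_coordFun]
  exact totalD_comm i j _

theorem paramT_comm (g : Fin N → (jetCoords n N).Tame hΩ.jets) (i : Fin n) (f : hΩ.ParamFun) :
    hΩ.paramT g (hΩ.paramD i f) = hΩ.paramD i (hΩ.paramT g f) := by
  refine hΩ.lie_liftField_comm (fun a => ?_) f
  rw [← totalD_coordFun, ← solD_coordFun]
  exact solD_comm g i _

theorem paramS_forget (f : (jetCoords n N).Tame hΩ.jets) :
    hΩ.paramS (hΩ.forgetMap.pullback f) = 0 := by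
  obtain ⟨c, hc⟩ := Tame.exists_factors f
  rw [paramS, hΩ.forgetMap.lie_pullback, hΩ.forgetMap.along_apply _ hc]
  refine Finset.sum_eq_zero fun a _ => ?_
  have : (jetCoords n N).withParam.lie (Pi.single none 1 : _ → hΩ.ParamFun)
      (hΩ.forgetMap.comp a) = 0 :=
    (lie_coordFun (C := (jetCoords n N).withParam) _ (some a)).trans
      (Pi.single_eq_of_ne (by simp) _)
  rw [this, mul_zero]

theorem paramS_param : hΩ.paramS hΩ.param = 1 :=
  (lie_coordFun (C := (jetCoords n N).withParam) _ none).trans (Pi.single_eq_same _ _)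

theorem paramS_comm (i : Fin n) (f : hΩ.ParamFun) :
    hΩ.paramS (hΩ.paramD i f) = hΩ.paramD i (hΩ.paramS f) := by
  refine lie_comm (fun a => ?_) f
  cases a with
  | none => exact (map_zero _).trans (derivation_single_one _ _ _).symm
  | some a => exact (hΩ.paramS_forget _).trans (derivation_single_one _ _ _).symm

theorem totalD_baseMap (i : Fin n) (f : (baseCoords n).Tame hΩ.base) :
    totalD hΩ.jets i (hΩ.baseMap.pullback f) =
      hΩ.baseMap.pullback (baseD hΩ.base (some i) f) := by
  refine hΩ.baseMap.lie_pullback_of_related (fun a => ?_) f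
  refine (lie_coordFun (totalField hΩ.jets i) (Sum.inl a)).trans ?_
  rcases a with _ | j
  · rw [Pi.single_eq_of_ne (by simp), map_zero]
    rfl
  · rw [totalField]
    split_ifs with h
    · subst h
      rw [Pi.single_eq_same, map_one]
    · rw [Pi.single_eq_of_ne (by simpa using Ne.symm h), map_zero]

theorem solD_baseMap (g : Fin N → (jetCoords n N).Tame hΩ.jets)
    (f : (baseCoords n).Tame hΩ.base) :
    solD g (hΩ.baseMap.pullback f) = hΩ.baseMap.pullback (baseD hΩ.base none f) := by
  refine hΩ.baseMap.lie_pullback_of_related (fun a => ?_) f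
  refine (lie_coordFun (solField g) (Sum.inl a)).trans ?_
  rcases a with _ | j
  · rw [Pi.single_eq_same, map_one]
    rfl
  · rw [Pi.single_eq_of_ne (by simp), map_zero]
    rfl

theorem paramD_forget (i : Fin n) (f : (jetCoords n N).Tame hΩ.jets) :
    hΩ.paramD i (hΩ.forgetMap.pullback f) = hΩ.forgetMap.pullback (totalD hΩ.jets i f) :=
  hΩ.lie_liftField_forget _ f

theorem paramT_forget (g : Fin N → (jetCoords n N).Tame hΩ.jets)
    (f : (jetCoords n N).Tame hΩ.jets) :
    hΩ.paramT g (hΩ.forgetMap.pullback f) = hΩ.forgetMap.pullback (solD g f) :=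
  hΩ.lie_liftField_forget _ f

theorem paramD_param (i : Fin n) : hΩ.paramD i hΩ.param = 0 := hΩ.lie_liftField_param _

theorem paramT_param (g : Fin N → (jetCoords n N).Tame hΩ.jets) : hΩ.paramT g hΩ.param = 0 :=
  hΩ.lie_liftField_param _

theorem iterD_param_mul {c : hΩ.ParamFun} (hc : ∀ i, hΩ.paramD i c = 0) (J : MultiIndex n)
    (f : hΩ.ParamFun) : iterD hΩ.paramD J (c * f) = c * iterD hΩ.paramD J f := by
  induction J using multi_induction with
  | h0 => simp [iterD_zero]
  | h1 J i ih =>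
    rw [iterD_add_single hΩ.paramD hΩ.paramD_comm, iterD_add_single hΩ.paramD hΩ.paramD_comm, ih,
      Derivation.leibniz, hc, smul_zero, add_zero, smul_eq_mul]

/-- The functions `u^σ - w^σ`. -/
noncomputable def deviation (σ : Fin N) : (jetCoords n N).Tame hΩ.jets :=
  (jetCoords n N).coordFun hΩ.jets (Sum.inr (σ, 0)) - hΩ.baseMap.pullback (hΩ.background σ)

theorem iterD_deviation (σ : Fin N) (J : MultiIndex n) :
    iterD (totalD hΩ.jets) J (hΩ.deviation σ) =
      (jetCoords n N).coordFun hΩ.jets (Sum.inr (σ, J)) -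
        hΩ.baseMap.pullback (hΩ.backgroundJet σ J) := by
  rw [deviation, map_sub, iterD_coordFun, backgroundJet,
    map_iterD (fun i => baseD hΩ.base (some i)) (fun i j => baseD_comm _ _) (totalD hΩ.jets)
      (χ := hΩ.baseMap.pullback) totalD_comm (fun i f => (hΩ.totalD_baseMap i f).symm)]

/-- The left-hand side of the system on `u_(s)`. -/
noncomputable def residual (g : Fin N → (jetCoords n N).Tame hΩ.jets) (σ : Fin N) : hΩ.ParamFun :=
  hΩ.homotopyMap.pullback (g σ) - hΩ.param * hΩ.forgetMap.pullback (g σ) +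
    (1 - hΩ.param) *
      hΩ.forgetMap.pullback (hΩ.baseMap.pullback (baseD hΩ.base none (hΩ.background σ)))

theorem paramD_homotopyMap (i : Fin n) (a : JetCoord n N) :
    hΩ.paramD i (hΩ.homotopyMap.comp a) = hΩ.homotopyMap.pullback (totalField hΩ.jets i a) := by
  rcases a with a | ⟨σ, J⟩
  · refine (lie_coordFun (C := (jetCoords n N).withParam) _ (some (Sum.inl a))).trans ?_
    change hΩ.forgetMap.pullback (totalField hΩ.jets i (Sum.inl a)) = _
    rcases a with _ | j
    · rfl
    · simp only [totalField]
      split_ifs <;> rfl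
  · have h1 : hΩ.paramD i ((jetCoords n N).withParam.coordFun hΩ.paramJets (some (Sum.inr (σ, J)))) =
        (jetCoords n N).withParam.coordFun hΩ.paramJets (some (Sum.inr (σ, J + Pi.single i 1))) :=
      lie_coordFun (C := (jetCoords n N).withParam) _ _
    change hΩ.paramD i (hΩ.param * _ + (1 - hΩ.param) * _) = _
    rw [totalField, TameMap.pullback_coordFun]
    simp only [map_add, map_sub, Derivation.leibniz, h1, hΩ.paramD_param, hΩ.paramD_forget,
      hΩ.totalD_baseMap, hΩ.baseD_backgroundJet, Derivation.map_one_eq_zero, sub_zero,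
      add_zero, smul_eq_mul, mul_zero]
    rfl

/-- `u_(s)` is affine in `s` with slope `u - w`, and this persists for all derivatives. -/
theorem paramS_homotopyMap (a : JetCoord n N) :
    hΩ.paramS (hΩ.homotopyMap.comp a) =
      prolong hΩ.paramD (fun σ => hΩ.forgetMap.pullback (hΩ.deviation σ)) a := by
  rcases a with a | ⟨σ, J⟩
  · exact (lie_coordFun (C := (jetCoords n N).withParam) _ (some (Sum.inl a))).trans
      (Pi.single_eq_of_ne (by simp) _)
  · have h1 : hΩ.paramS ((jetCoords n N).withParam.coordFun hΩ.paramJets (some (Sum.inr (σ, J)))) =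
        0 := (lie_coordFun (C := (jetCoords n N).withParam) _ _).trans
          (Pi.single_eq_of_ne (by simp) _)
    change hΩ.paramS (hΩ.param * _ + (1 - hΩ.param) * _) = _
    rw [prolong, ← map_iterD (totalD hΩ.jets) totalD_comm hΩ.paramD (χ := hΩ.forgetMap.pullback)
      hΩ.paramD_comm (fun i f => (hΩ.paramD_forget i f).symm), iterD_deviation, map_sub]
    simp only [map_add, map_sub, Derivation.leibniz, h1, hΩ.paramS_param, hΩ.paramS_forget,
      Derivation.map_one_eq_zero, smul_eq_mul]
    rw [TameMap.pullback_coordFun]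
    change _ = (jetCoords n N).withParam.coordFun hΩ.paramJets (some (Sum.inr (σ, J))) - _
    ring

/-- The two time derivatives are related by the homotopy up to the prolonged residual, because the
system is not assumed to hold on `u_(s)`. -/
theorem paramT_homotopyMap (g : Fin N → (jetCoords n N).Tame hΩ.jets) (a : JetCoord n N) :
    hΩ.paramT g (hΩ.homotopyMap.comp a) =
      hΩ.homotopyMap.pullback (solField g a) + prolong hΩ.paramD (hΩ.residual g) a := by
  rcases a with a | ⟨σ, J⟩
  · refine (lie_coordFun (C := (jetCoords n N).withParam) _ (some (Sum.inl a))).trans ?_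
    change hΩ.forgetMap.pullback (solField g (Sum.inl a)) = _
    rw [prolong, add_zero]
    rcases a with _ | j <;> rfl
  · have h1 : hΩ.paramT g
        ((jetCoords n N).withParam.coordFun hΩ.paramJets (some (Sum.inr (σ, J)))) =
        hΩ.forgetMap.pullback (solField g (Sum.inr (σ, J))) :=
      lie_coordFun (C := (jetCoords n N).withParam) _ _
    change hΩ.paramT g (hΩ.param * _ + (1 - hΩ.param) * _) = _
    have h2 : ∀ i, hΩ.paramD i (1 - hΩ.param) = 0 := fun i => by
      rw [map_sub, Derivation.map_one_eq_zero, paramD_param, sub_zero]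
    have h3 : ∀ f, iterD hΩ.paramD J (hΩ.homotopyMap.pullback f) =
        hΩ.homotopyMap.pullback (iterD (totalD hΩ.jets) J f) := fun f =>
      (map_iterD (totalD hΩ.jets) totalD_comm hΩ.paramD (χ := hΩ.homotopyMap.pullback)
        hΩ.paramD_comm (fun i f =>
          (hΩ.homotopyMap.lie_pullback_of_related (hΩ.paramD_homotopyMap i) f).symm) J f).symm
    have h4 : ∀ f, iterD hΩ.paramD J (hΩ.forgetMap.pullback f) =
        hΩ.forgetMap.pullback (iterD (totalD hΩ.jets) J f) := fun f =>
      (map_iterD (totalD hΩ.jets) totalD_comm hΩ.paramD (χ := hΩ.forgetMap.pullback)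
        hΩ.paramD_comm (fun i f => (hΩ.paramD_forget i f).symm) J f).symm
    have h5 : iterD (totalD hΩ.jets) J
        (hΩ.baseMap.pullback (baseD hΩ.base none (hΩ.background σ))) =
        hΩ.baseMap.pullback (baseD hΩ.base none (hΩ.backgroundJet σ J)) := by
      rw [← map_iterD (fun i => baseD hΩ.base (some i)) (fun i j => baseD_comm _ _)
        (totalD hΩ.jets) (χ := hΩ.baseMap.pullback) totalD_comm
        (fun i f => (hΩ.totalD_baseMap i f).symm), backgroundJet]
      congr 1
      exact (map_iterD (fun i => baseD hΩ.base (some i)) (fun i j => baseD_comm _ _)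
        (fun i => baseD hΩ.base (some i)) (χ := baseD hΩ.base none) (fun i j => baseD_comm _ _)
        (fun i f => baseD_comm _ _ _) J _).symm
    have h6 : prolong hΩ.paramD (hΩ.residual g) (Sum.inr (σ, J)) =
        iterD hΩ.paramD J (hΩ.residual g σ) := rfl
    rw [h6, residual, map_add (iterD hΩ.paramD J), map_sub (iterD hΩ.paramD J),
      hΩ.iterD_param_mul hΩ.paramD_param,
      hΩ.iterD_param_mul h2, h3, h4, h4, h5]
    simp only [map_add, map_sub, Derivation.leibniz, h1, hΩ.paramT_param, hΩ.paramT_forget,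
      hΩ.solD_baseMap, Derivation.map_one_eq_zero, sub_zero, smul_eq_mul,
      solField, map_neg]
    ring

end IsAdmissible

end ConsLaw

namespace ConsLaw

open TopologicalSpace CoordSystem

theorem greenCurrent_add_right {n : ℕ} {S : Type*} [CommRing S] [Algebra ℝ S]
    (D : Fin n → Derivation ℝ S S) (q : ℕ) (i : Fin n) (c : List (Fin n) → S) (V W : S) :
    greenCurrent D q i c (V + W) = greenCurrent D q i c V + greenCurrent D q i c W := by
  simp only [greenCurrent, listD_add, add_mul, Finset.sum_add_distrib, mul_add]

namespace IsAdmissible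

variable {n N : ℕ} {Ω : Set (Jet n N)} {w : Fin N → Base n → ℝ} (hΩ : IsAdmissible Ω w)

/-! ### Variation of the density and the flux along the homotopy. -/

section HomotopyVariation

/-- The functions `u^σ - w^σ` on the domain with the homotopy parameter. -/
noncomputable def displacement (σ : Fin N) : hΩ.ParamFun :=
  hΩ.forgetMap.pullback (hΩ.deviation σ)

theorem paramS_homotopy (f : (jetCoords n N).Tame hΩ.jets) :
    hΩ.paramS (hΩ.homotopyMap.pullback f) =
      hΩ.homotopyMap.along (prolong hΩ.paramD hΩ.displacement) f :=
  (hΩ.homotopyMap.lie_pullback _ f).trans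
    (congrArg (fun Y => hΩ.homotopyMap.along Y f) (funext hΩ.paramS_homotopyMap))

variable (g : Fin N → (jetCoords n N).Tame hΩ.jets)

theorem paramT_homotopy (f : (jetCoords n N).Tame hΩ.jets) :
    hΩ.paramT g (hΩ.homotopyMap.pullback f) = hΩ.homotopyMap.pullback (solD g f) +
      hΩ.homotopyMap.along (prolong hΩ.paramD (hΩ.residual g)) f := by
  have h1 := hΩ.homotopyMap.lie_pullback (hΩ.liftField (solField g)) f
  have h2 := hΩ.homotopyMap.along_pullback (solField g) f
  rw [paramT, h1, solD, ← h2, ← TameMap.along_add]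
  exact congrArg (fun Y => hΩ.homotopyMap.along Y f) (funext (hΩ.paramT_homotopyMap g))

theorem paramT_displacement (σ : Fin N) :
    hΩ.paramT g (hΩ.displacement σ) = -hΩ.forgetMap.pullback (g σ) -
      hΩ.forgetMap.pullback (hΩ.baseMap.pullback (baseD hΩ.base none (hΩ.background σ))) := by
  rw [displacement, paramT_forget, deviation, map_sub, solD_coordFun, solD_baseMap, solField,
    iterD_zero, map_sub, map_neg]
  rfl

/-- Both sides are the linearised system applied to `u - w`. This identity removes the time
derivative of `u - w` from the comparison of fluxes. -/
theorem paramS_residual (σ : Fin N) :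
    hΩ.paramS (hΩ.residual g σ) = hΩ.paramT g (hΩ.displacement σ) +
      hΩ.homotopyMap.along (prolong hΩ.paramD hΩ.displacement) (g σ) := by
  rw [paramT_displacement, ← paramS_homotopy, residual]
  simp only [map_add, map_sub, Derivation.leibniz, paramS_param, paramS_forget,
    Derivation.map_one_eq_zero, smul_eq_mul]
  ring

variable (k : ℕ) (Φt : (jetCoords n N).Tame hΩ.jets)

/-- The current in the first variation of the density `Φt` along the homotopy. -/
noncomputable def densityCurrent (q : Fin N → hΩ.ParamFun) (i : Fin n) : hΩ.ParamFun :=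
  ∑ σ, greenCurrent hΩ.paramD k i (fun L => hΩ.homotopyMap.pullback (symD σ L Φt)) (q σ)

/-- The flux `S^i` along the homotopy. -/
noncomputable def multiplierCurrent (m : ℕ) (F : Fin N → (jetCoords n N).Tame hΩ.jets)
    (W : Fin N → hΩ.ParamFun) (i : Fin n) : hΩ.ParamFun :=
  ∑ ρ, ∑ σ, greenCurrent hΩ.paramD m i
    (fun L => W σ * hΩ.homotopyMap.pullback (symD ρ L (F σ))) (hΩ.displacement ρ)

variable {g k Φt} {m p : ℕ} {Φx : Fin n → (jetCoords n N).Tame hΩ.jets}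
  {Λ : Fin N → (jetCoords n N).Tame hΩ.jets}
  (hΦt : (jetCoords n N).Factors hΩ.jets (jetFinset n N k) Φt.1)
  (hg : ∀ σ, (jetCoords n N).Factors hΩ.jets (jetFinset n N m) (g σ).1)
  (hΛ : ∀ σ, (jetCoords n N).Factors hΩ.jets (jetFinset n N p) (Λ σ).1)
  (hmul : ∀ σ, Λ σ = listAdjoint (totalD hΩ.jets) k fun L => symD σ L Φt)
  (hcons : solD g Φt + ∑ i, totalD hΩ.jets i (Φx i) = 0)

include hΦt hmul in
theorem paramS_density : hΩ.paramS (hΩ.homotopyMap.pullback Φt) =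
    ∑ σ, hΩ.displacement σ * hΩ.homotopyMap.pullback (Λ σ) +
      ∑ i, hΩ.paramD i (hΩ.densityCurrent k Φt hΩ.displacement i) :=
  (hΩ.paramS_homotopy Φt).trans
    (along_prolong_density hΩ.homotopyMap (Y := fun i => hΩ.liftField (totalField hΩ.jets i))
      hΩ.paramD_comm hΩ.paramD_homotopyMap hΦt hmul hΩ.displacement)

theorem paramD_coordFun (i j : Fin n) :
    hΩ.paramD i ((jetCoords n N).withParam.coordFun hΩ.paramJets (some (Sum.inl (some j)))) =
      if i = j then 1 else 0 := by
  refine (lie_coordFun (C := (jetCoords n N).withParam) _ (some (Sum.inl (some j)))).trans ?_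
  change hΩ.forgetMap.pullback (if i = j then 1 else 0) = _
  split_ifs <;> simp

include hΦt hg hΛ hmul hcons in
-- The left-hand side is rewritten by the product rule for Green's currents until it is free of time
-- derivatives of the displacement; it is then an operator to which `exists_flux_potential_along`
-- applies.
theorem exists_paramS_flux_potential :
    ∃ ψ : Fin n → Fin n → hΩ.ParamFun, (∀ i j, ψ i j = -ψ j i) ∧ ∀ i,
      hΩ.paramT g (hΩ.densityCurrent k Φt hΩ.displacement i) -
        hΩ.paramS (hΩ.densityCurrent k Φt (hΩ.residual g) i) +
        hΩ.paramS (hΩ.homotopyMap.pullback (Φx i)) =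
      hΩ.multiplierCurrent m g (fun σ => hΩ.homotopyMap.pullback (Λ σ)) i +
        hΩ.multiplierCurrent p Λ (hΩ.residual g) i + ∑ j, hΩ.paramD j (ψ i j) := by
  obtain ⟨ψ, h1, h2⟩ := exists_flux_potential_along hΩ.homotopyMap
    (Y := fun i => hΩ.liftField (totalField hΩ.jets i)) hΩ.paramD_comm hΩ.paramD_homotopyMap
    hΦt hg hΛ hmul hcons _ hΩ.paramD_coordFun (hΩ.paramT g) (hΩ.residual g) (hΩ.paramT_homotopy g)
    hΩ.displacement
  refine ⟨ψ, h1, fun i => ?_⟩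
  have h3 : hΩ.paramT g (hΩ.densityCurrent k Φt hΩ.displacement i) =
      ∑ σ, greenCurrent hΩ.paramD k i
        (fun L => hΩ.paramT g (hΩ.homotopyMap.pullback (symD σ L Φt))) (hΩ.displacement σ) +
      ∑ σ, greenCurrent hΩ.paramD k i (fun L => hΩ.homotopyMap.pullback (symD σ L Φt))
        (hΩ.paramT g (hΩ.displacement σ)) := by
    rw [densityCurrent, map_sum, ← Finset.sum_add_distrib]
    exact Finset.sum_congr rfl fun σ _ =>
      derivation_greenCurrent hΩ.paramD (hΩ.paramT g) (hΩ.paramT_comm g) k i _ _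
  -- By `paramS_residual` the middle sum equals the last sum of `h3`, and the two drop out of the
  -- difference.
  have h4 : hΩ.paramS (hΩ.densityCurrent k Φt (hΩ.residual g) i) =
      ∑ σ, greenCurrent hΩ.paramD k i
        (fun L => hΩ.homotopyMap.along (prolong hΩ.paramD hΩ.displacement) (symD σ L Φt))
        (hΩ.residual g σ) +
      (∑ σ, greenCurrent hΩ.paramD k i (fun L => hΩ.homotopyMap.pullback (symD σ L Φt))
        (hΩ.paramT g (hΩ.displacement σ)) +
      ∑ σ, greenCurrent hΩ.paramD k i (fun L => hΩ.homotopyMap.pullback (symD σ L Φt))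
        (hΩ.homotopyMap.along (prolong hΩ.paramD hΩ.displacement) (g σ))) := by
    rw [densityCurrent, map_sum, ← Finset.sum_add_distrib, ← Finset.sum_add_distrib]
    refine Finset.sum_congr rfl fun σ _ => ?_
    rw [derivation_greenCurrent hΩ.paramD hΩ.paramS hΩ.paramS_comm k i, paramS_residual,
      greenCurrent_add_right]
    simp only [paramS_homotopy]
  have h5 := h2 i
  change _ = ∑ j, hΩ.paramD j (ψ i j) at h5
  rw [h3, h4, ← h5, paramS_homotopy, multiplierCurrent, multiplierCurrent]
  change _ = _ + _ + ((∑ σ, greenCurrent hΩ.paramD k i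
        (fun L => hΩ.paramT g (hΩ.homotopyMap.pullback (symD σ L Φt))) (hΩ.displacement σ)) -
      (∑ σ, greenCurrent hΩ.paramD k i
        (fun L => hΩ.homotopyMap.along (prolong hΩ.paramD hΩ.displacement) (symD σ L Φt))
        (hΩ.residual g σ)) -
      (∑ σ, greenCurrent hΩ.paramD k i (fun L => hΩ.homotopyMap.pullback (symD σ L Φt))
        (hΩ.homotopyMap.along (prolong hΩ.paramD hΩ.displacement) (g σ))) +
      hΩ.homotopyMap.along (prolong hΩ.paramD hΩ.displacement) (Φx i) -
      (∑ ρ, ∑ σ, greenCurrent hΩ.paramD m i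
        (fun L => hΩ.homotopyMap.pullback (Λ σ) * hΩ.homotopyMap.pullback (symD ρ L (g σ)))
        (hΩ.displacement ρ)) -
      ∑ ρ, ∑ σ, greenCurrent hΩ.paramD p i
        (fun L => hΩ.residual g σ * hΩ.homotopyMap.pullback (symD ρ L (Λ σ)))
        (hΩ.displacement ρ))
  ring

end HomotopyVariation

/-! ### The conservation law evaluated on the background functions. -/

section Background

theorem baseD_jetMap (i : Fin n) (a : JetCoord n N) :
    baseD hΩ.base (some i) (hΩ.jetMap.comp a) = hΩ.jetMap.pullback (totalField hΩ.jets i a) := by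
  rcases a with a | ⟨σ, J⟩
  · refine (baseD_coordFun (some i) a).trans ?_
    rcases a with _ | j
    · rw [Pi.single_eq_of_ne (by simp)]
      exact (map_zero _).symm
    · rw [totalField]
      split_ifs with h
      · subst h
        rw [Pi.single_eq_same, map_one]
      · rw [Pi.single_eq_of_ne (by simpa using Ne.symm h), map_zero]
  · refine (hΩ.baseD_backgroundJet σ J i).trans ?_
    rw [totalField, TameMap.pullback_coordFun]
    rfl

theorem baseD_jetPullback (i : Fin n) (f : (jetCoords n N).Tame hΩ.jets) :
    baseD hΩ.base (some i) (hΩ.jetMap.pullback f) = hΩ.jetMap.pullback (totalD hΩ.jets i f) :=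
  hΩ.jetMap.lie_pullback_of_related (hΩ.baseD_jetMap i) f

variable (g : Fin N → (jetCoords n N).Tame hΩ.jets)

/-- The left-hand side of the system on `w`. -/
noncomputable def backgroundResidual (σ : Fin N) : (baseCoords n).Tame hΩ.base :=
  baseD hΩ.base none (hΩ.background σ) + hΩ.jetMap.pullback (g σ)

/-- The analogue of `paramT_homotopyMap` for `w`, with the defect of `w` in place of the residual.
-/
theorem baseD_none_jetMap (a : JetCoord n N) :
    baseD hΩ.base none (hΩ.jetMap.comp a) = hΩ.jetMap.pullback (solField g a) +
      prolong (fun i => baseD hΩ.base (some i)) (hΩ.backgroundResidual g) a := by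
  rcases a with a | ⟨σ, J⟩
  · refine (baseD_coordFun none a).trans ?_
    rw [prolong, add_zero]
    rcases a with _ | j
    · rw [Pi.single_eq_same]
      exact (map_one _).symm
    · rw [Pi.single_eq_of_ne (by simp)]
      exact (map_zero _).symm
  · have h1 := map_iterD (fun i => baseD hΩ.base (some i)) (fun i j => baseD_comm _ _)
      (fun i => baseD hΩ.base (some i)) (χ := baseD hΩ.base none) (fun i j => baseD_comm _ _)
      (fun i f => baseD_comm _ _ _) J (hΩ.background σ)
    have h2 := map_iterD (totalD hΩ.jets) totalD_comm (fun i => baseD hΩ.base (some i))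
      (χ := hΩ.jetMap.pullback) (fun i j => baseD_comm _ _)
      (fun i f => (hΩ.baseD_jetPullback i f).symm) J (g σ)
    refine h1.trans ?_
    rw [solField, map_neg, h2, prolong, backgroundResidual, map_add]
    ring

theorem baseD_none_jetPullback (f : (jetCoords n N).Tame hΩ.jets) :
    baseD hΩ.base none (hΩ.jetMap.pullback f) = hΩ.jetMap.pullback (solD g f) +
      hΩ.jetMap.along (prolong (fun i => baseD hΩ.base (some i)) (hΩ.backgroundResidual g)) f := by
  have h1 := hΩ.jetMap.lie_pullback (Pi.single none 1) f
  have h2 := hΩ.jetMap.along_pullback (solField g) f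
  rw [baseD, h1, solD, ← h2, ← TameMap.along_add]
  exact congrArg (fun Y => hΩ.jetMap.along Y f) (funext (hΩ.baseD_none_jetMap g))

/-- The density and the flux of a conservation law on the functions `w`; the current in the flux
accounts for `w` not being a solution. -/
noncomputable def backgroundFlux (k : ℕ) (Φt : (jetCoords n N).Tame hΩ.jets)
    (Φx : Fin n → (jetCoords n N).Tame hΩ.jets) (a : Option (Fin n)) :
    (baseCoords n).Tame hΩ.base :=
  a.elim (hΩ.jetMap.pullback Φt) fun i => hΩ.jetMap.pullback (Φx i) -
    ∑ σ, greenCurrent (fun i => baseD hΩ.base (some i)) k i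
      (fun L => hΩ.jetMap.pullback (symD σ L Φt)) (hΩ.backgroundResidual g σ)

/-- The function `K`. -/
noncomputable def kernel (Λ : Fin N → (jetCoords n N).Tame hΩ.jets) :
    (baseCoords n).Tame hΩ.base :=
  ∑ ρ, hΩ.backgroundResidual g ρ * hΩ.jetMap.pullback (Λ ρ)

variable {g} {k : ℕ} {Φt : (jetCoords n N).Tame hΩ.jets}
  {Φx : Fin n → (jetCoords n N).Tame hΩ.jets} {Λ : Fin N → (jetCoords n N).Tame hΩ.jets}
  (hΦt : (jetCoords n N).Factors hΩ.jets (jetFinset n N k) Φt.1)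
  (hmul : ∀ σ, Λ σ = listAdjoint (totalD hΩ.jets) k fun L => symD σ L Φt)
  (hcons : solD g Φt + ∑ i, totalD hΩ.jets i (Φx i) = 0)

include hΦt hmul hcons in
-- The time derivative of the density on `w` contains its variation in the direction of the defect.
-- The corrected flux absorbs the divergence part of that variation and leaves the product of defect
-- and multipliers.
theorem sum_baseD_backgroundFlux :
    ∑ a, baseD hΩ.base a (hΩ.backgroundFlux g k Φt Φx a) = hΩ.kernel g Λ := by
  have h1 := along_prolong_density hΩ.jetMap
    (Y := fun i => (Pi.single (some i) 1 : Option (Fin n) → (baseCoords n).Tame hΩ.base))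
    (fun i j => baseD_comm _ _) hΩ.baseD_jetMap hΦt hmul (hΩ.backgroundResidual g)
  have h2 := hΩ.baseD_none_jetPullback g Φt
  have h3 := h2.trans (congrArg _ h1)
  have h4 := congrArg hΩ.jetMap.pullback hcons
  rw [map_add, map_sum, map_zero] at h4
  rw [Fintype.sum_option]
  simp only [backgroundFlux, Option.elim_none, Option.elim_some, map_sub,
    Finset.sum_sub_distrib, baseD_jetPullback]
  rw [h3, kernel]
  change _ + (_ + ∑ i, baseD hΩ.base (some i) (∑ σ, greenCurrent (fun i => baseD hΩ.base (some i))
    k i (fun L => hΩ.jetMap.pullback (symD σ L Φt)) (hΩ.backgroundResidual g σ))) + _ = _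
  linear_combination h4

end Background

end IsAdmissible

end ConsLaw

namespace ConsLaw

open TopologicalSpace CoordSystem

namespace IsAdmissible

variable {n N : ℕ} {Ω : Set (Jet n N)} {w : Fin N → Base n → ℝ} (hΩ : IsAdmissible Ω w)

/-! ### The endpoints of the homotopy. -/

section Slices

variable (s : ℝ) (hs : s ∈ Set.Icc (0 : ℝ) 1)

theorem slice_paramD (i : Fin n) (f : hΩ.ParamFun) :
    (hΩ.sliceMap s hs).pullback (hΩ.paramD i f) =
      totalD hΩ.jets i ((hΩ.sliceMap s hs).pullback f) :=
  (hΩ.lie_slice s hs _ f).symm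

theorem slice_param : (hΩ.sliceMap s hs).pullback hΩ.param = algebraMap ℝ _ s :=
  TameMap.pullback_coordFun _ _

theorem slice_forget (f : (jetCoords n N).Tame hΩ.jets) :
    (hΩ.sliceMap s hs).pullback (hΩ.forgetMap.pullback f) = f := rfl

theorem slice_one_homotopy (f : (jetCoords n N).Tame hΩ.jets) :
    (hΩ.sliceMap 1 (by simp)).pullback (hΩ.homotopyMap.pullback f) = f := by
  ext z
  exact congrArg f.1 (Subtype.ext (homotopy_one z.1))

theorem slice_zero_homotopy (f : (jetCoords n N).Tame hΩ.jets) :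
    (hΩ.sliceMap 0 (by simp)).pullback (hΩ.homotopyMap.pullback f) =
      hΩ.baseMap.pullback (hΩ.jetMap.pullback f) := by
  ext z
  exact congrArg f.1 (Subtype.ext (homotopy_zero z.1))

theorem slice_one_scale (f : (baseCoords n).Tame hΩ.base) :
    (hΩ.sliceMap 1 (by simp)).pullback (hΩ.scaleMap.pullback f) = hΩ.baseMap.pullback f := by
  ext z
  exact congrArg f.1 (Subtype.ext (one_smul ℝ z.1.1))

variable (g : Fin N → (jetCoords n N).Tame hΩ.jets)

/-- At the upper endpoint the homotopy is `u`, for which the eliminated time derivative is exactly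
`-g`. -/
theorem slice_one_residual (σ : Fin N) :
    (hΩ.sliceMap 1 (by simp)).pullback (hΩ.residual g σ) = 0 := by
  rw [residual, map_add, map_sub, map_mul, map_mul, map_sub, slice_param, slice_one_homotopy,
    slice_forget, map_one, map_one]
  ring

theorem slice_zero_residual (σ : Fin N) :
    (hΩ.sliceMap 0 (by simp)).pullback (hΩ.residual g σ) =
      hΩ.baseMap.pullback (hΩ.backgroundResidual g σ) := by
  rw [residual, map_add, map_sub, map_mul, map_mul, map_sub, slice_param, slice_zero_homotopy,
    slice_forget, slice_forget, map_one, map_zero, backgroundResidual, map_add]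
  ring

variable (k : ℕ) (Φt : (jetCoords n N).Tame hΩ.jets)

theorem slice_one_densityCurrent (i : Fin n) :
    (hΩ.sliceMap 1 (by simp)).pullback (hΩ.densityCurrent k Φt (hΩ.residual g) i) = 0 := by
  rw [densityCurrent, map_sum]
  refine Finset.sum_eq_zero fun σ _ => ?_
  rw [map_greenCurrent hΩ.paramD (totalD hΩ.jets) _ (hΩ.slice_paramD 1 (by simp)),
    slice_one_residual, greenCurrent_zero_right]

theorem slice_zero_densityCurrent (i : Fin n) :
    (hΩ.sliceMap 0 (by simp)).pullback (hΩ.densityCurrent k Φt (hΩ.residual g) i) =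
      hΩ.baseMap.pullback (∑ σ, greenCurrent (fun i => baseD hΩ.base (some i)) k i
        (fun L => hΩ.jetMap.pullback (symD σ L Φt)) (hΩ.backgroundResidual g σ)) := by
  rw [densityCurrent, map_sum, map_sum]
  refine Finset.sum_congr rfl fun σ _ => ?_
  rw [map_greenCurrent hΩ.paramD (totalD hΩ.jets) _ (hΩ.slice_paramD 0 (by simp)),
    map_greenCurrent (fun i => baseD hΩ.base (some i)) (totalD hΩ.jets) hΩ.baseMap.pullback
      (fun i f => (hΩ.totalD_baseMap i f).symm), slice_zero_residual]
  simp only [slice_zero_homotopy]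

end Slices

/-! ### Integration over the homotopy parameter. -/

section Integral

/-- Integration over the homotopy parameter. -/
noncomputable def integral : hΩ.ParamFun →ₗ[ℝ] (jetCoords n N).Tame hΩ.jets :=
  tameIntegral hΩ.mem_paramJets

theorem lie_integral (Z : JetCoord n N → (jetCoords n N).Tame hΩ.jets) (f : hΩ.ParamFun) :
    (jetCoords n N).lie Z (hΩ.integral f) =
      hΩ.integral ((jetCoords n N).withParam.lie (hΩ.liftField Z) f) :=
  lie_tameIntegral (Y' := hΩ.liftField Z) hΩ.mem_paramJets rfl (fun _ _ _ => rfl) f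

theorem integral_mul_forget (f : hΩ.ParamFun) (y : (jetCoords n N).Tame hΩ.jets) :
    hΩ.integral (f * hΩ.forgetMap.pullback y) = hΩ.integral f * y :=
  tameIntegral_mul hΩ.mem_paramJets (fun _ _ => rfl) f

theorem lie_single_one {ι X : Type*} [DecidableEq ι] [AddCommGroup X] [Module ℝ X]
    [TopologicalSpace X] [IsTopologicalAddGroup X] [ContinuousSMul ℝ X] {C : CoordSystem ι X}
    {O : Opens X} (a : ι) (f : C.Tame O) : C.lie (Pi.single a 1) f = C.pd O a f := by
  obtain ⟨c, hc⟩ := Tame.exists_factors f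
  rw [lie_apply _ (hc.mono (Finset.subset_insert a c)), Finset.sum_eq_single a]
  · rw [Pi.single_eq_same, mul_one]
  · intro b _ hb
    rw [Pi.single_eq_of_ne hb, mul_zero]
  · simp

theorem integral_paramS (f : hΩ.ParamFun) :
    hΩ.integral (hΩ.paramS f) = (hΩ.sliceMap 1 (by simp)).pullback f -
      (hΩ.sliceMap 0 (by simp)).pullback f := by
  rw [paramS, lie_single_one]
  exact tameIntegral_param_derivative hΩ.mem_paramJets f (fun _ => rfl) fun _ => rfl

end Integral

/-! ### The radial Poincaré lemma on the base. -/

section Poincare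

variable (g : Fin N → (jetCoords n N).Tame hΩ.jets)

/-- The total derivatives in all independent variables. -/
noncomputable def solTotalD (a : Option (Fin n)) :
    Derivation ℝ ((jetCoords n N).Tame hΩ.jets) ((jetCoords n N).Tame hΩ.jets) :=
  a.elim (solD g) (totalD hΩ.jets)

/-- The total derivatives in all independent variables on functions of the homotopy parameter and
of jets. -/
noncomputable def paramSolD (a : Option (Fin n)) : Derivation ℝ hΩ.ParamFun hΩ.ParamFun :=
  a.elim (hΩ.paramT g) hΩ.paramD

/-- The independent variables. -/
noncomputable def baseVar (a : Option (Fin n)) : (jetCoords n N).Tame hΩ.jets :=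
  (jetCoords n N).coordFun hΩ.jets (Sum.inl a)

theorem solTotalD_integral (a : Option (Fin n)) (f : hΩ.ParamFun) :
    hΩ.solTotalD g a (hΩ.integral f) = hΩ.integral (hΩ.paramSolD g a f) := by
  cases a with
  | none => exact hΩ.lie_integral _ f
  | some i => exact hΩ.lie_integral _ f

theorem paramSolD_param (a : Option (Fin n)) : hΩ.paramSolD g a hΩ.param = 0 := by
  cases a with
  | none => exact hΩ.paramT_param g
  | some i => exact hΩ.paramD_param i

theorem paramSolD_forget_baseVar (a b : Option (Fin n)) :
    hΩ.paramSolD g a (hΩ.forgetMap.pullback (hΩ.baseVar b)) = if a = b then 1 else 0 := by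
  have h : ∀ a b, (Pi.single a 1 : Option (Fin n) → (baseCoords n).Tame hΩ.base) b =
      if a = b then 1 else 0 := fun a b => by
    rw [Pi.single_apply]
    simp only [eq_comm]
  have h1 : hΩ.baseVar b = hΩ.baseMap.pullback ((baseCoords n).coordFun hΩ.base b) := rfl
  cases a with
  | none =>
    refine (hΩ.paramT_forget g _).trans ?_
    rw [h1, solD_baseMap, baseD_coordFun, h]
    split_ifs <;> simp
  | some i =>
    refine (hΩ.paramD_forget i _).trans ?_
    rw [h1, totalD_baseMap, baseD_coordFun, h]
    split_ifs <;> simp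

theorem scaleMap_comp (a : Option (Fin n)) :
    hΩ.scaleMap.comp a = hΩ.param * hΩ.forgetMap.pullback (hΩ.baseVar a) := rfl

theorem factors_univ (f : (baseCoords n).Tame hΩ.base) :
    (baseCoords n).Factors hΩ.base Finset.univ f.1 := by
  obtain ⟨c, hc⟩ := Tame.exists_factors f
  exact hc.mono (Finset.subset_univ c)

theorem paramSolD_scale (a : Option (Fin n)) (f : (baseCoords n).Tame hΩ.base) :
    hΩ.paramSolD g a (hΩ.scaleMap.pullback f) =
      hΩ.param * hΩ.scaleMap.pullback (baseD hΩ.base a f) := by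
  have h1 : hΩ.paramSolD g a (hΩ.scaleMap.pullback f) =
      hΩ.scaleMap.along (fun b => hΩ.paramSolD g a (hΩ.scaleMap.comp b)) f := by
    cases a with
    | none => exact hΩ.scaleMap.lie_pullback _ f
    | some i => exact hΩ.scaleMap.lie_pullback _ f
  rw [h1, hΩ.scaleMap.along_apply _ (hΩ.factors_univ f), baseD, lie_single_one,
    Finset.sum_eq_single a]
  · rw [scaleMap_comp, Derivation.leibniz, paramSolD_param, paramSolD_forget_baseVar, if_pos rfl,
      smul_zero, add_zero, smul_eq_mul, mul_one, mul_comm]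
  · intro b _ hb
    rw [scaleMap_comp, Derivation.leibniz, paramSolD_param, paramSolD_forget_baseVar,
      if_neg (Ne.symm hb), smul_zero, smul_zero, add_zero, mul_zero]
  · simp

/-- Euler's formula for the radial derivative, which turns a divergence into a derivative in the
parameter. -/
theorem paramS_scale (f : (baseCoords n).Tame hΩ.base) :
    hΩ.paramS (hΩ.scaleMap.pullback f) =
      ∑ a, hΩ.forgetMap.pullback (hΩ.baseVar a) * hΩ.scaleMap.pullback (baseD hΩ.base a f) := by
  have h1 : hΩ.paramS (hΩ.scaleMap.pullback f) =
      hΩ.scaleMap.along (fun b => hΩ.paramS (hΩ.scaleMap.comp b)) f :=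
    hΩ.scaleMap.lie_pullback _ f
  rw [h1, hΩ.scaleMap.along_apply _ (hΩ.factors_univ f)]
  refine Finset.sum_congr rfl fun a _ => ?_
  rw [scaleMap_comp, Derivation.leibniz, paramS_param, paramS_forget, smul_zero, zero_add,
    smul_eq_mul, mul_one, mul_comm, baseD, lie_single_one]

/-- The Poincaré lemma for fluxes on the base, with a given divergence. -/
theorem exists_base_potential (hn : 1 ≤ n) (f : Option (Fin n) → (baseCoords n).Tame hΩ.base)
    {κ : (baseCoords n).Tame hΩ.base} (hf : ∑ a, baseD hΩ.base a (f a) = κ) :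
    ∃ Ψ : Option (Fin n) → Option (Fin n) → (jetCoords n N).Tame hΩ.jets,
      (∀ a b, Ψ a b = -Ψ b a) ∧ ∀ a, hΩ.baseMap.pullback (f a) =
        hΩ.baseVar a * hΩ.integral (hΩ.param ^ n * hΩ.scaleMap.pullback κ) +
          ∑ b, hΩ.solTotalD g b (Ψ a b) := by
  obtain ⟨m, rfl⟩ : ∃ m, n = m + 1 := ⟨n - 1, by omega⟩
  let x : Option (Fin (m + 1)) → hΩ.ParamFun := fun a => hΩ.forgetMap.pullback (hΩ.baseVar a)
  let F : Option (Fin (m + 1)) → hΩ.ParamFun := fun a => hΩ.scaleMap.pullback (f a)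
  -- The radial homotopy operator for fluxes: the flux at the scaled point is antisymmetrised with
  -- the position vector, with weight `s^(n-1)`.
  refine ⟨fun a b => hΩ.integral (hΩ.param ^ m * (x b * F a - x a * F b)), fun a b => ?_,
    fun a => ?_⟩
  · change hΩ.integral _ = -hΩ.integral _
    rw [← map_neg]
    exact congrArg _ (by ring)
  · have h1 : ∀ b, hΩ.paramSolD g b (hΩ.param ^ m) = 0 := fun b => by
      rw [Derivation.leibniz_pow, paramSolD_param, smul_zero, smul_zero]
    have h2 : ∀ b, hΩ.paramSolD g b (hΩ.param ^ m * (x b * F a - x a * F b)) =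
        hΩ.param ^ m * F a + hΩ.param ^ (m + 1) * (x b * hΩ.scaleMap.pullback
          (baseD hΩ.base b (f a))) - (if b = a then hΩ.param ^ m * F b else 0) -
          x a * (hΩ.param ^ (m + 1) * hΩ.scaleMap.pullback (baseD hΩ.base b (f b))) := by
      intro b
      rw [Derivation.leibniz, h1, smul_zero, add_zero, map_sub, Derivation.leibniz,
        Derivation.leibniz, paramSolD_forget_baseVar, paramSolD_forget_baseVar, paramSolD_scale,
        paramSolD_scale, if_pos rfl]
      simp only [smul_eq_mul, F]
      split_ifs <;> ring
    -- The `m + 2` independent variables give `m + 2` copies of `s^m F a`, of which the divergence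
    -- of `x a` removes one; the `m + 1` left are what differentiating `s^(m+1)` requires.
    have h3 : ∑ b, hΩ.paramSolD g b (hΩ.param ^ m * (x b * F a - x a * F b)) =
        hΩ.paramS (hΩ.param ^ (m + 1) * F a) -
          hΩ.param ^ (m + 1) * hΩ.scaleMap.pullback κ * x a := by
      simp only [h2, Finset.sum_sub_distrib, Finset.sum_add_distrib]
      rw [Derivation.leibniz, Derivation.leibniz_pow, paramS_param, paramS_scale,
        Finset.sum_ite_eq' , if_pos (Finset.mem_univ a), ← hf, map_sum]
      simp only [← Finset.mul_sum, Finset.sum_const, Finset.card_univ, Fintype.card_option,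
        Fintype.card_fin, smul_eq_mul, Nat.add_sub_cancel, nsmul_eq_mul, Nat.cast_add, Nat.cast_one,
        x]
      ring
    simp only [solTotalD_integral]
    have h4 : (hΩ.sliceMap 1 (by simp)).pullback (hΩ.param ^ (m + 1) * F a) =
        hΩ.baseMap.pullback (f a) := by
      rw [map_mul, map_pow, slice_param, map_one, one_pow, one_mul, slice_one_scale]
    -- The lower endpoint drops out because `s^n` vanishes at 0, which uses `1 ≤ n`.
    have h5 : (hΩ.sliceMap 0 (by simp)).pullback (hΩ.param ^ (m + 1) * F a) = 0 := by
      rw [map_mul, map_pow, slice_param, map_zero, zero_pow (by omega), zero_mul]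
    rw [← map_sum, h3, map_sub, integral_mul_forget, integral_paramS, h4, h5]
    ring

end Poincare

/-! ### Comparison with the given conservation law. -/

section Construction

variable (g Λ : Fin N → (jetCoords n N).Tame hΩ.jets)

/-- The integral of `K` over the segment from the origin. -/
noncomputable def kernelIntegral : (jetCoords n N).Tame hΩ.jets :=
  hΩ.integral (hΩ.param ^ n * hΩ.scaleMap.pullback (hΩ.kernel g Λ))

/-- The constructed density. -/
noncomputable def constructedT : (jetCoords n N).Tame hΩ.jets :=
  hΩ.integral (∑ σ, hΩ.displacement σ * hΩ.homotopyMap.pullback (Λ σ)) +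
    hΩ.baseVar none * hΩ.kernelIntegral g Λ

/-- The integrand of the constructed flux. -/
noncomputable def fluxIntegrand (m p : ℕ) (i : Fin n) : hΩ.ParamFun :=
  hΩ.multiplierCurrent m g (fun σ => hΩ.homotopyMap.pullback (Λ σ)) i +
    hΩ.multiplierCurrent p Λ (hΩ.residual g) i

/-- The constructed flux. -/
noncomputable def constructedX (m p : ℕ) (i : Fin n) : (jetCoords n N).Tame hΩ.jets :=
  hΩ.baseVar (some i) * hΩ.kernelIntegral g Λ + hΩ.integral (hΩ.fluxIntegrand g Λ m p i)

variable {g Λ} {k m p : ℕ} {Φt : (jetCoords n N).Tame hΩ.jets}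
  {Φx : Fin n → (jetCoords n N).Tame hΩ.jets}
  (hΦt : (jetCoords n N).Factors hΩ.jets (jetFinset n N k) Φt.1)
  (hg : ∀ σ, (jetCoords n N).Factors hΩ.jets (jetFinset n N m) (g σ).1)
  (hΛ : ∀ σ, (jetCoords n N).Factors hΩ.jets (jetFinset n N p) (Λ σ).1)
  (hmul : ∀ σ, Λ σ = listAdjoint (totalD hΩ.jets) k fun L => symD σ L Φt)
  (hcons : solD g Φt + ∑ i, totalD hΩ.jets i (Φx i) = 0)

include hΦt hg hΛ hmul hcons in
-- Integrates the variations over the homotopy and replaces the endpoint at `w` by the radial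
-- formula. The potential entries with a time index enter `θ`; the purely spatial ones enter `ψ`.
theorem exists_trivial_densities (hn : 1 ≤ n) :
    ∃ (θ : Fin n → (jetCoords n N).Tame hΩ.jets) (ψ : Fin n → Fin n → (jetCoords n N).Tame hΩ.jets),
      (∀ i j, ψ i j = -ψ j i) ∧ hΩ.constructedT g Λ = Φt + ∑ i, totalD hΩ.jets i (θ i) ∧
      ∀ i, hΩ.constructedX g Λ m p i =
        Φx i - solD g (θ i) + ∑ j, totalD hΩ.jets j (ψ i j) := by
  obtain ⟨ψ, hψ, h1⟩ := hΩ.exists_paramS_flux_potential hΦt hg hΛ hmul hcons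
  obtain ⟨Ψ, hΨ, h2⟩ := hΩ.exists_base_potential g hn (hΩ.backgroundFlux g k Φt Φx)
    (hΩ.sum_baseD_backgroundFlux hΦt hmul hcons)
  have hI : ∀ i f, hΩ.integral (hΩ.paramD i f) = totalD hΩ.jets i (hΩ.integral f) := fun i f =>
    (hΩ.lie_integral _ f).symm
  have hIt : ∀ f, hΩ.integral (hΩ.paramT g f) = solD g (hΩ.integral f) := fun f =>
    (hΩ.lie_integral _ f).symm
  -- Antisymmetry and division by 2; hence no time derivative enters the change of density.
  have h0 : Ψ none none = 0 := by
    have h := congrArg (fun y => (2⁻¹ : ℝ) • (Ψ none none + y)) (hΨ none none)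
    simp only [add_neg_cancel, smul_zero] at h
    rwa [← two_smul ℝ, smul_smul, inv_mul_cancel₀ two_ne_zero, one_smul] at h
  refine ⟨fun i => -hΩ.integral (hΩ.densityCurrent k Φt hΩ.displacement i) - Ψ none (some i),
    fun i j => -hΩ.integral (ψ i j) - Ψ (some i) (some j), fun i j => ?_, ?_, fun i => ?_⟩
  · change -hΩ.integral (ψ i j) - Ψ (some i) (some j) =
      -(-hΩ.integral (ψ j i) - Ψ (some j) (some i))
    rw [hψ i j, hΨ (some i) (some j), map_neg]
    ring
  · have h3 := congrArg hΩ.integral (hΩ.paramS_density hΦt hmul)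
    have h4 := h2 none
    rw [Fintype.sum_option, h0, map_zero, zero_add] at h4
    change hΩ.baseMap.pullback (hΩ.jetMap.pullback Φt) = _ +
      ∑ i, totalD hΩ.jets i (Ψ none (some i)) at h4
    rw [integral_paramS, slice_one_homotopy, slice_zero_homotopy, map_add, h4] at h3
    simp only [map_sum hΩ.integral (fun i => hΩ.paramD i _), hI] at h3
    simp only [map_sub, map_neg, Finset.sum_sub_distrib, Finset.sum_neg_distrib]
    rw [constructedT, kernelIntegral]
    linear_combination -h3
  · have h3 := congrArg hΩ.integral (h1 i)
    have h4 := h2 (some i)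
    rw [Fintype.sum_option] at h4
    change hΩ.baseMap.pullback (hΩ.jetMap.pullback (Φx i) - _) = _ + (solD g (Ψ (some i) none) +
      ∑ j, totalD hΩ.jets j (Ψ (some i) (some j))) at h4
    rw [map_sub] at h4
    rw [map_add, map_sub, integral_paramS, integral_paramS, slice_one_homotopy,
      slice_zero_homotopy, slice_one_densityCurrent, slice_zero_densityCurrent, hIt, map_add,
      map_sum hΩ.integral] at h3
    simp only [hI] at h3
    simp only [map_sub, map_neg, Finset.sum_sub_distrib, Finset.sum_neg_distrib]
    rw [hΨ none (some i), constructedX, kernelIntegral, fluxIntegrand, map_neg]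
    linear_combination -h3 - h4

include hΦt hg hΛ hmul hcons in
-- Trivial changes do not affect the divergence: the terms in `θ` cancel since `𝒟_t` commutes with
-- the `D_i`, and the double divergence of an antisymmetric array vanishes.
theorem constructed_conservation (hn : 1 ≤ n) :
    solD g (hΩ.constructedT g Λ) + ∑ i, totalD hΩ.jets i (hΩ.constructedX g Λ m p i) = 0 := by
  obtain ⟨θ, ψ, h1, h2, h3⟩ := hΩ.exists_trivial_densities hΦt hg hΛ hmul hcons hn
  have h4 : ∑ i, ∑ j, totalD hΩ.jets i (totalD hΩ.jets j (ψ i j)) = 0 := by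
    have h5 : ∑ i, ∑ j, totalD hΩ.jets i (totalD hΩ.jets j (ψ i j)) =
        -∑ i, ∑ j, totalD hΩ.jets i (totalD hΩ.jets j (ψ i j)) := by
      conv_lhs => rw [Finset.sum_comm]
      rw [← Finset.sum_neg_distrib]
      refine Finset.sum_congr rfl fun i _ => ?_
      rw [← Finset.sum_neg_distrib]
      refine Finset.sum_congr rfl fun j _ => ?_
      rw [h1 j i, map_neg, map_neg, totalD_comm]
    have h := congrArg (fun y => (2⁻¹ : ℝ) •
      (∑ i, ∑ j, totalD hΩ.jets i (totalD hΩ.jets j (ψ i j)) + y)) h5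
    simp only [add_neg_cancel, smul_zero] at h
    rwa [← two_smul ℝ, smul_smul, inv_mul_cancel₀ two_ne_zero, one_smul] at h
  simp only [h2, h3, map_add, map_sub, map_sum, solD_comm, Finset.sum_add_distrib,
    Finset.sum_sub_distrib]
  rw [h4]
  linear_combination hcons

end Construction

end IsAdmissible

end ConsLaw

namespace ConsLaw

open TopologicalSpace CoordSystem MeasureTheory

/-- Evaluation at a point. -/
noncomputable def CoordSystem.Tame.evalAt {ι X : Type*} [AddCommGroup X] [Module ℝ X]
    [TopologicalSpace X] {C : CoordSystem ι X} {O : Opens X} (z : O) : C.Tame O →ₐ[ℝ] ℝ where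
  toFun f := f.1 z
  map_one' := rfl
  map_mul' _ _ := rfl
  map_zero' := rfl
  map_add' _ _ := rfl
  commutes' _ := rfl

/-! ### Identification with the explicit formulas. -/

section Formulas

variable {n N : ℕ} {Ω : Opens (Jet n N)}

theorem Represents.eulerHat {F : Jet n N → ℝ} {f : (jetCoords n N).Tame Ω} (h : Represents F f)
    (k : ℕ) (σ : Fin N) :
    Represents (eulerHat k σ F) (listAdjoint (ConsLaw.totalD Ω) k fun L => ConsLaw.symD σ L f) := by
  intro z
  change _ = Tame.evalAt z (listAdjoint (ConsLaw.totalD Ω) k fun L => ConsLaw.symD σ L f)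
  simp only [listAdjoint, map_sum, map_mul, map_pow, map_neg, map_one]
  exact Finset.sum_congr rfl fun r _ => congrArg _
    (Finset.sum_congr rfl fun I _ => (h.symD σ _).listD _ z)

theorem Represents.trilinear {V W : Fin N → Jet n N → ℝ}
    {C : Fin N → Fin N → List (Fin n) → Jet n N → ℝ} {v : Fin N → (jetCoords n N).Tame Ω}
    {c : Fin N → Fin N → List (Fin n) → (jetCoords n N).Tame Ω} (hV : ∀ ρ, Represents (V ρ) (v ρ))
    (hC : ∀ σ ρ L, Represents (fun y => W σ y * C σ ρ L y) (c σ ρ L)) (m : ℕ) (i : Fin n) :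
    Represents (trilinear m i V W C)
      (∑ ρ, ∑ σ, greenCurrent (ConsLaw.totalD Ω) m i (c σ ρ) (v ρ)) := by
  intro z
  rw [← Fintype.sum_prod_type']
  change _ = Tame.evalAt z _
  simp only [greenCurrent, map_sum, map_mul, map_pow, map_neg, map_one]
  conv_rhs => rw [Finset.sum_comm]
  refine Finset.sum_congr rfl fun l _ => ?_
  conv_rhs => rw [Finset.sum_comm]
  refine Finset.sum_congr rfl fun r _ => ?_
  rw [← Finset.mul_sum]
  congr 1
  conv_rhs => rw [Finset.sum_comm]
  refine Finset.sum_congr rfl fun I _ => ?_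
  conv_rhs => rw [Finset.sum_comm]
  refine Finset.sum_congr rfl fun J _ => ?_
  rw [Fintype.sum_prod_type]
  exact Finset.sum_congr rfl fun ρ _ => Finset.sum_congr rfl fun σ _ =>
    congrArg₂ (· * ·) ((hV _).listD _ z) ((hC _ _ _).listD _ z)

end Formulas

namespace IsAdmissible

variable {n N : ℕ} {Ω : Set (Jet n N)} {w : Fin N → Base n → ℝ} (hΩ : IsAdmissible Ω w)

section Values

variable {f : hΩ.ParamFun} {G : ℝ → ℝ} {z : Jet n N} (hz : z ∈ Ω)
  (hG : ∀ s, ∀ hs : s ∈ Set.Icc (0 : ℝ) 1, G s = f.1 ⟨(s, z), hΩ.mem_paramJets z hz s hs⟩)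

include hz hG in
theorem eqOn_extend :
    Set.EqOn G (fun s => Function.extend Subtype.val f.1 0 (s, z)) (Set.uIcc 0 1) := by
  intro s hs
  rw [Set.uIcc_of_le zero_le_one] at hs
  exact (hG s hs).trans (extend_apply f.1 (hΩ.mem_paramJets z hz s hs)).symm

include hz hG in
-- Only parameters in [0, 1] matter; outside this interval the integrand of the formula need not
-- agree with a smooth function.
theorem intervalIntegrable_of_eq : IntervalIntegrable G volume 0 1 :=
  (intervalIntegrable_slice hΩ.mem_paramJets f hz).congr_uIoo fun s hs =>
    (hΩ.eqOn_extend hz hG (Set.Ioo_subset_Icc_self hs)).symm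

include hG in
theorem integral_of_eq : ∫ s in (0 : ℝ)..1, G s = (hΩ.integral f).1 ⟨z, hz⟩ :=
  intervalIntegral.integral_congr (hΩ.eqOn_extend hz hG)

end Values

variable {g Λ : Fin N → Jet n N → ℝ} {g' Λ' : Fin N → (jetCoords n N).Tame hΩ.jets}
  (hg : ∀ σ, Represents (g σ) (g' σ)) (hΛ : ∀ σ, Represents (Λ σ) (Λ' σ))

theorem partialT_eq (σ : Fin N) (b : hΩ.base) :
    partialT (w σ) b = (baseD hΩ.base none (hΩ.background σ)).1 b :=
  hasLineDerivAt_baseD none (hΩ.background σ) (F := w σ) (fun _ => rfl) b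

include hg hΛ in
theorem kernelK_eq (b : hΩ.base) : kernelK g Λ w b = (hΩ.kernel g' Λ').1 b := by
  rw [kernel, TameMap.sum_val]
  refine Finset.sum_congr rfl fun ρ _ => ?_
  exact congrArg₂ (· * ·) (congrArg₂ (· + ·) (hΩ.partialT_eq ρ b)
    (hg ρ ⟨_, hΩ.jetOf_mem b.2⟩)) (hΛ ρ ⟨_, hΩ.jetOf_mem b.2⟩)

include hg hΛ in
theorem pow_mul_kernelK_eq {z : Jet n N} (hz : z ∈ Ω) (s : ℝ) (hs : s ∈ Set.Icc (0 : ℝ) 1) :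
    s ^ n * kernelK g Λ w (s • z.1) = (hΩ.param ^ n * hΩ.scaleMap.pullback (hΩ.kernel g' Λ')).1
      ⟨(s, z), hΩ.mem_paramJets z hz s hs⟩ :=
  congrArg (s ^ n * ·) (hΩ.kernelK_eq hg hΛ ⟨s • z.1, (hΩ.mem_paramJets z hz s hs).2⟩)

include hΛ in
theorem integrandT_eq {z : Jet n N} (hz : z ∈ Ω) (s : ℝ) (hs : s ∈ Set.Icc (0 : ℝ) 1) :
    integrandT Λ w s z = (∑ σ, hΩ.displacement σ * hΩ.homotopyMap.pullback (Λ' σ)).1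
      ⟨(s, z), hΩ.mem_paramJets z hz s hs⟩ := by
  rw [TameMap.sum_val]
  exact Finset.sum_congr rfl fun σ _ => congrArg (_ * ·)
    (hΛ σ ⟨homotopy w s z, hΩ.homotopy_mem z hz s hs⟩)

/-- The formula applies its total derivatives at a fixed `s`. Slicing intertwines the two kinds of
total derivative, so it may be applied after forming the currents. -/
theorem trilinear_eq {F : Fin N → Jet n N → ℝ} {F' : Fin N → (jetCoords n N).Tame hΩ.jets}
    (hF : ∀ σ, Represents (F σ) (F' σ)) (s : ℝ) (hs : s ∈ Set.Icc (0 : ℝ) 1)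
    {W : Fin N → Jet n N → ℝ} {W' : Fin N → hΩ.ParamFun}
    (hW : ∀ σ, Represents (W σ) ((hΩ.sliceMap s hs).pullback (W' σ))) (m : ℕ) (i : Fin n) :
    Represents (trilinear m i (fun ρ y => y.2 ρ 0 - w ρ y.1) W (coeffAt w s F))
      ((hΩ.sliceMap s hs).pullback (hΩ.multiplierCurrent m F' W' i)) := by
  have h : (hΩ.sliceMap s hs).pullback (hΩ.multiplierCurrent m F' W' i) =
      ∑ ρ, ∑ σ, greenCurrent (totalD hΩ.jets) m i
        (fun L => (hΩ.sliceMap s hs).pullback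
          (W' σ * hΩ.homotopyMap.pullback (symD ρ L (F' σ)))) (hΩ.deviation ρ) := by
    simp only [multiplierCurrent, map_sum,
      map_greenCurrent hΩ.paramD (totalD hΩ.jets) _ (hΩ.slice_paramD s hs)]
    rfl
  rw [h]
  exact Represents.trilinear (c := fun σ ρ L => (hΩ.sliceMap s hs).pullback
    (W' σ * hΩ.homotopyMap.pullback (symD ρ L (F' σ)))) (fun _ _ => rfl) (fun σ ρ L z =>
      congrArg₂ (· * ·) (hW σ z)
        ((hF σ).symD ρ L ⟨homotopy w s z, hΩ.homotopy_mem z z.2 s hs⟩)) m i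

include hg hΛ in
theorem integrandX_eq (m p : ℕ) (i : Fin n) {z : Jet n N} (hz : z ∈ Ω) (s : ℝ)
    (hs : s ∈ Set.Icc (0 : ℝ) 1) :
    integrandX m p g Λ w i s z = (hΩ.fluxIntegrand g' Λ' m p i).1
      ⟨(s, z), hΩ.mem_paramJets z hz s hs⟩ := by
  refine congrArg₂ (· + ·)
    (hΩ.trilinear_eq hg s hs (W' := fun σ => hΩ.homotopyMap.pullback (Λ' σ)) (fun σ y => ?_)
      m i ⟨z, hz⟩)
    (hΩ.trilinear_eq hΛ s hs (W' := hΩ.residual g') (fun σ y => ?_) p i ⟨z, hz⟩)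
  · exact hΛ σ ⟨homotopy w s y, hΩ.homotopy_mem y y.2 s hs⟩
  · have h1 := hg σ ⟨homotopy w s y, hΩ.homotopy_mem y y.2 s hs⟩
    have h2 := hΩ.partialT_eq σ ⟨y.1.1, ⟨y, y.2, rfl⟩⟩
    change g σ (homotopy w s y) - s * g σ y + (1 - s) * partialT (w σ) y.1.1 = _
    change g σ (homotopy w s y) = _ at h1
    change partialT (w σ) y.1.1 = _ at h2
    rw [h1, hg σ y, h2]
    rfl

include hg hΛ in
theorem formulaT_eq : Represents (formulaT g Λ w) (hΩ.constructedT g' Λ') := fun z =>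
  congrArg₂ (· + ·) (hΩ.integral_of_eq z.2 (hΩ.integrandT_eq hΛ z.2))
    (congrArg (z.1.1.1 * ·) (hΩ.integral_of_eq z.2 (hΩ.pow_mul_kernelK_eq hg hΛ z.2)))

include hg hΛ in
theorem formulaX_eq (m p : ℕ) (i : Fin n) :
    Represents (formulaX m p g Λ w i) (hΩ.constructedX g' Λ' m p i) := fun z =>
  congrArg₂ (· + ·)
    (congrArg (z.1.1.2 i * ·) (hΩ.integral_of_eq z.2 (hΩ.pow_mul_kernelK_eq hg hΛ z.2)))
    (hΩ.integral_of_eq z.2 (hΩ.integrandX_eq hg hΛ m p i z.2))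

end IsAdmissible

end ConsLaw

/-! ### The theorem in terms of jets. -/

theorem theorem2p8 (n N m p k : ℕ) (hn : 1 ≤ n)
    (Ω : Set (ConsLaw.Jet n N)) (w : Fin N → ConsLaw.Base n → ℝ)
    (hΩ : ConsLaw.IsAdmissible Ω w)
    (g : Fin N → ConsLaw.Jet n N → ℝ) (hg : ∀ σ, ConsLaw.IsDiffFun Ω m (g σ))
    (Φt : ConsLaw.Jet n N → ℝ) (Φx : Fin n → ConsLaw.Jet n N → ℝ)
    (hΦ : ConsLaw.IsNormalConservationLaw Ω g k Φt Φx)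
    (Λ : Fin N → ConsLaw.Jet n N → ℝ) (hΛ : ∀ σ, ConsLaw.IsDiffFun Ω p (Λ σ))
    (hmul : ∀ σ, ∀ z ∈ Ω, Λ σ z = ConsLaw.eulerHat k σ Φt z) :
    (∀ z ∈ Ω,
      IntervalIntegrable (fun s => ConsLaw.integrandT Λ w s z) MeasureTheory.volume 0 1 ∧
      (∀ i, IntervalIntegrable (fun s => ConsLaw.integrandX m p g Λ w i s z)
        MeasureTheory.volume 0 1) ∧
      IntervalIntegrable (fun s => s ^ n * ConsLaw.kernelK g Λ w (s • z.1))
        MeasureTheory.volume 0 1) ∧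
    (∃ k', ConsLaw.IsNormalConservationLaw Ω g k'
      (ConsLaw.formulaT g Λ w) (ConsLaw.formulaX m p g Λ w)) ∧
    ConsLaw.AgreeUpToTrivial Ω g Φt Φx
      (ConsLaw.formulaT g Λ w) (ConsLaw.formulaX m p g Λ w) := by
  open ConsLaw in
  choose g' hg1 hg2 using fun σ => IsDiffFun.exists_tame (Ω := hΩ.jets) (hg σ)
  choose Λ' hΛ1 hΛ2 using fun σ => IsDiffFun.exists_tame (Ω := hΩ.jets) (hΛ σ)
  obtain ⟨hΦt, hΦx, hcons⟩ := hΦ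
  obtain ⟨Φt', ht1, ht2⟩ := IsDiffFun.exists_tame (Ω := hΩ.jets) hΦt
  choose Φx' hx1 hx2 using fun i => IsDiffFun.exists_tame (Ω := hΩ.jets) (hΦx i)
  have divergence : ∀ {F : Jet n N → ℝ} {f : (jetCoords n N).Tame hΩ.jets}
      {G : Fin n → Jet n N → ℝ} {h : Fin n → (jetCoords n N).Tame hΩ.jets}, Represents F f →
      (∀ i, Represents (G i) (h i)) → ∀ z : hΩ.jets,
      DtSol g F z + ∑ i, D i (G i) z = (solD g' f + ∑ i, totalD hΩ.jets i (h i)).1 z := by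
    intro F f G h hF hG z
    refine congrArg₂ (· + ·) (hF.solD hg2 z) ?_
    rw [TameMap.sum_val]
    exact Finset.sum_congr rfl fun i _ => (hG i).totalD i z
  have hmul' : ∀ σ, Λ' σ = listAdjoint (totalD hΩ.jets) k fun L => symD σ L Φt' := fun σ =>
    CoordSystem.Tame.ext fun z => ((hΛ2 σ z).symm.trans (hmul σ z z.2)).trans
      (Represents.eulerHat ht2 k σ z)
  have hcons' : solD g' Φt' + ∑ i, totalD hΩ.jets i (Φx' i) = 0 :=
    CoordSystem.Tame.ext fun z => (divergence ht2 hx2 z).symm.trans (hcons z z.2)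
  have hT := hΩ.formulaT_eq hg2 hΛ2
  have hX := hΩ.formulaX_eq hg2 hΛ2 m p
  refine ⟨fun z hz => ⟨hΩ.intervalIntegrable_of_eq hz (hΩ.integrandT_eq hΛ2 hz),
    fun i => hΩ.intervalIntegrable_of_eq hz (hΩ.integrandX_eq hg2 hΛ2 m p i hz),
    hΩ.intervalIntegrable_of_eq hz (hΩ.pow_mul_kernelK_eq hg2 hΛ2 hz)⟩, ?_, ?_⟩
  · obtain ⟨k₀, hk₀⟩ := exists_isDiffFun (hΩ.constructedT g' Λ')
    choose k₁ hk₁ using fun i => exists_isDiffFun (hΩ.constructedX g' Λ' m p i)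
    refine ⟨max k₀ (Finset.univ.sup k₁), hk₀ _ (le_max_left _ _) _ hT, fun i => hk₁ i _
      ((Finset.le_sup (Finset.mem_univ i)).trans (le_max_right _ _)) _ (hX i), fun z hz => ?_⟩
    rw [divergence hT hX ⟨z, hz⟩,
      hΩ.constructed_conservation ht1 hg1 hΛ1 hmul' hcons' hn]
    rfl
  · obtain ⟨θ, ψ, h1, h2, h3⟩ := hΩ.exists_trivial_densities ht1 hg1 hΛ1 hmul' hcons' hn
    -- The potentials are needed as functions on all jets. Extension by zero suffices, because on
    -- the open set `Ω` their derivatives depend only on the values there.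
    let ext : (jetCoords n N).Tame hΩ.jets → Jet n N → ℝ := fun f => Function.extend Subtype.val f.1 0
    have hext : ∀ f, Represents (ext f) f := fun f z => CoordSystem.extend_apply f.1 z.2
    choose k₀ hk₀ using fun i => exists_isDiffFun (θ i)
    choose k₁ hk₁ using fun q : Fin n × Fin n => exists_isDiffFun (ψ q.1 q.2)
    refine ⟨max (Finset.univ.sup k₀) (Finset.univ.sup k₁), fun i => ext (θ i),
      fun i j => ext (ψ i j), fun i => hk₀ i _
        ((Finset.le_sup (Finset.mem_univ i)).trans (le_max_left _ _)) _ (hext _),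
      fun i j => hk₁ (i, j) _
        ((Finset.le_sup (Finset.mem_univ (i, j))).trans (le_max_right _ _)) _ (hext _),
      fun i j z hz => ?_, fun z hz => ?_, fun i z hz => ?_⟩
    · refine (hext (ψ i j) ⟨z, hz⟩).trans ?_
      rw [h1]
      exact congrArg Neg.neg (hext (ψ j i) ⟨z, hz⟩).symm
    · rw [hT ⟨z, hz⟩, h2, ht2 ⟨z, hz⟩]
      suffices h : (∑ i, totalD hΩ.jets i (θ i)).1 ⟨z, hz⟩ = ∑ i, D i (ext (θ i)) z from
        congrArg (Φt'.1 ⟨z, hz⟩ + ·) h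
      rw [TameMap.sum_val]
      exact Finset.sum_congr rfl fun i _ => ((hext (θ i)).totalD i ⟨z, hz⟩).symm
    · rw [hX i ⟨z, hz⟩, h3, hx2 i ⟨z, hz⟩, (hext (θ i)).solD hg2 ⟨z, hz⟩]
      suffices h : (∑ j, totalD hΩ.jets j (ψ i j)).1 ⟨z, hz⟩ = ∑ j, D j (ext (ψ i j)) z from
        congrArg ((Φx' i).1 ⟨z, hz⟩ - (solD g' (θ i)).1 ⟨z, hz⟩ + ·) h
      rw [TameMap.sum_val]
      exact Finset.sum_congr rfl fun j _ => ((hext (ψ i j)).totalD j ⟨z, hz⟩).symm
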